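/- **Setting.** Let $A$ have $\mathcal H_A=\mathbb C^4$ with basis $|0\rangle,\dots,|3\rangle$, and let $\mathcal H_B$ be the single-mode Fock space, or its subspace spanned by the states with fewer than $N_c$ photons; $|y\rangle$, $y\in\mathbb C$, is the (correspondingly projected) coherent state $e^{-|y|^2/2}\sum_k \frac{y^k}{\sqrt{k!}}|k\rangle$. For $S\subset\mathbb C$ put $E(S)=\frac1\pi\int_S|y\rangle\langle y|\,d^2y$ (heterodyne measurement). Let $R^z_B=E(\{\gamma e^{i\theta}:\gamma\ge0,\ \frac\pi4(2z-1)\le\theta<\frac\pi4(2z+1)\})$ for $z\in\{0,1,2,3\}$. For $\delta>0$ and $\Delta/\delta\in\mathbb N$, let $\tilde R^{z}_B=E(M_z)$, $z\in\{0,\dots,m-1\}$, $m=4\Delta/\delta+4$, where for $j\in\{0,\dots,3\}$ the module $M_{j+4k}$ is the set of $\gamma e^{i\theta}$ with $\theta\in[\frac\pi4(2j-1),\frac\pi4(2j+1))$ and $\gamma\in[\delta k,\delta(k+1))$ if $k<\Delta/\delta$, and $\gamma\in[\Delta,\infty)$ if $k=\Delta/\delta$. Let $\{\Gamma_{x'}\}_{x'=0}^{15}$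 be a POVM on $A$, and let $p^{\rm key},p^{\rm PE},p^{\rm tom}\ge0$ have sum $1$, with $p^{\rm key}<1$. One round is the channel $\mathcal M^{\rm EAT}:AB\to OSC$ with classical outputs $S=R$, $O=\tilde XX'\hat Z\tilde Z$, $C=\tilde X\tilde ZX'$, obtained as follows. $R\in\{0,1,2\}$ is drawn with probabilities $p^{\rm key},p^{\rm PE},p^{\rm tom}$. If $R=0$, Alice measures $\{|x\rangle\langle x|\}$ (the outcome is discarded) and Bob measures $\{R^z_B\}$, with outcome $\hat Z$. If $R=1$, Alice measures $\{|x\rangle\langle x|\}$, with outcome $\tilde X$, and Bob measures $\{\tilde R^z_B\}$, with outcome $\tilde Z$. If $R=2$, Alice measures $\{\Gamma_{x'}\}$, with outcome $X'$. All variables that are not set equal $\perp$. The channel $\mathcal M^{\rm EAT,test}$ is the same with the probabilities $0,\frac{p^{\rm PE}}{1-p^{\rm key}},\frac{p^{\rm tom}}{1-p^{\rm key}}$. Let $\tilde{\mathcal C}$ be the set of the values $(x,z,\perp)$ and $(\perp,\perp,x')$ that $C$ takes in test rounds, and let $\tilde p$ be a probability distribution on $\tilde{\mathcal C}$. Let $\Sigma(\tilde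 p)$ be the set of density operators $\rho_{AB}$ with $\langle c|\mathcal M^{\rm EAT,test}(\rho)_C|c\rangle=\tilde p(c)$ for all $c\in\tilde{\mathcal C}$. For a Hilbert space $\mathcal H_{\hat E}$ let $\Sigma_{\hat E}(\tilde p)$ be the set of unit vectors $|\rho\rangle\in\mathcal H_{AB\hat E}$ such that $\langle c|\rho^{\rm EAT,test}_C|c\rangle=\tilde p(c)$ for all $c\in\tilde{\mathcal C}$, where $\rho^{\rm EAT(,test)}_{OSC\hat E}=({\rm id}_{\hat E}\otimes\mathcal M^{\rm EAT(,test)})(|\rho\rangle\langle\rho|)$. Let $n\ge2$ be the number of rounds and $\mathcal H_{Q_1}=\mathcal H_{AB}^{\otimes(n-1)}$. Let $D(\rho\|\sigma)=\frac1{{\rm Tr}\rho}{\rm Tr}[\rho(\log\rho-\log\sigma)]$ (Umegaki relative entropy, $+\infty$ if ${\rm supp}\,\rho\not\subset{\rm supp}\,\sigma$), $H(\rho)=-{\rm Tr}[\rho\log\rho]$ and $H(X|Y)_\rho=H(XY)_\rho-H(Y)_\rho$, to be read as $-D(\rho_{XY}\|\mathbb 1_X\otimes\rho_Y)$ if $H(Y)_\rho=\infty$;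 logarithms have base $2$. Let $\mathcal G(\rho)=G\rho G^\dagger$ with $G=\mathbb 1_A\otimes\sum_{z=0}^3\sqrt{R^z_B}\otimes|z\rangle_{\hat Z}$, and $\mathcal Z(T)=\sum_{j=0}^3Z_jTZ_j$ with $Z_j=|j\rangle\langle j|_{\hat Z}\otimes\mathbb 1$. **Lemma 3.** Let $p^{\rm key}>0$ or $\Sigma(\tilde p)\ne\emptyset$. Then, with the convention $\inf\emptyset=+\infty$, the crossover min-tradeoff function $$g(\tilde p):=\inf_{\substack{\mathcal H_{\hat E}\simeq\mathcal H_{Q_1}\\ |\rho\rangle\in\Sigma_{\hat E}(\tilde p)}}H(\hat Z|S\hat E)_{\rho^{\rm EAT}}$$ satisfies $$g(\tilde p)=p^{\rm key}\inf_{\rho\in\Sigma(\tilde p)}D\bigl(\mathcal G(\rho_{AB})\,\big\|\,\mathcal Z(\mathcal G(\rho_{AB}))\bigr).$$ -/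

import Mathlib

namespace CVQKD

open MeasureTheory Filter InnerProductSpace
open scoped ENNReal NNReal Topology ComplexConjugate

noncomputable section

/-- The Hilbert space `H ⊗ ℓ²(J)`, realised as the square-summable families `J → H`. The orthonormal
basis vectors of `ℓ²(J)` are written `|j⟩`. -/
abbrev Tens (J : Type) (H : Type) [NormedAddCommGroup H] : Type := lp (fun _ : J => H) 2

/-- The Hilbert space `ℓ²(J)`. -/
abbrev Ell (J : Type) : Type := Tens J ℂ

section Hilbert

variable {J K X Y : Type}
variable {H : Type} [NormedAddCommGroup H] [InnerProductSpace ℂ H] [CompleteSpace H]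
variable {H' : Type} [NormedAddCommGroup H'] [InnerProductSpace ℂ H'] [CompleteSpace H']

open Classical in
/-- The map `1 ⊗ |j⟩ : H → H ⊗ ℓ²(J)`. -/
def ket (j : J) : H →L[ℂ] Tens J H := lp.singleContinuousLinearMap ℂ (fun _ : J => H) 2 j

/-- The map `1 ⊗ ⟨j| : H ⊗ ℓ²(J) → H`. -/
def bra (j : J) : Tens J H →L[ℂ] H := lp.evalCLM ℂ (fun _ : J => H) 2 j

/-- The map `A ⊗ 1 : H ⊗ ℓ²(J) → H' ⊗ ℓ²(J)`. -/
def ampl (J : Type) (A : H →L[ℂ] H') : Tens J H →L[ℂ] Tens J H' :=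
  LinearMap.mkContinuous
    { toFun := fun ψ => ⟨fun j => A (ψ j), by
        refine memℓp_gen ?_
        have h := ((lp.memℓp ψ).summable (by norm_num)).mul_left (‖A‖ ^ (2 : ℝ≥0∞).toReal)
        refine Summable.of_nonneg_of_le (fun j => by positivity) (fun j => ?_) h
        rw [← Real.mul_rpow (norm_nonneg _) (norm_nonneg _)]
        exact Real.rpow_le_rpow (norm_nonneg _) (A.le_opNorm _) (by norm_num)⟩
      map_add' := fun ψ φ => by ext j; exact map_add A (ψ j) (φ j)
      map_smul' := fun c ψ => by ext j; exact map_smul A c (ψ j) }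
    ‖A‖ (fun ψ => by
      refine lp.norm_le_of_forall_sum_le (by norm_num) (by positivity) fun s => ?_
      rw [Real.mul_rpow (norm_nonneg _) (norm_nonneg _)]
      refine le_trans ?_ (mul_le_mul_of_nonneg_left
        (lp.sum_rpow_le_norm_rpow (by norm_num) ψ s) (by positivity))
      rw [Finset.mul_sum]
      refine Finset.sum_le_sum fun j _ => ?_
      rw [← Real.mul_rpow (norm_nonneg _) (norm_nonneg _)]
      exact Real.rpow_le_rpow (norm_nonneg _) (A.le_opNorm _) (by norm_num))

/-! ### Traces and states -/

/-- A Hilbert basis of `H`; the quantities below do not depend on its choice. -/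
def stdBasis (H : Type) [NormedAddCommGroup H] [InnerProductSpace ℂ H] [CompleteSpace H] :
    HilbertBasis (exists_hilbertBasis ℂ H).choose ℂ H :=
  (exists_hilbertBasis ℂ H).choose_spec.choose

/-- The trace of a trace class operator. -/
def trace (T : H →L[ℂ] H) : ℂ := ∑' i, inner ℂ (stdBasis H i) (T (stdBasis H i))

/-- The trace, with values in `[0, ∞]`, of a positive operator. -/
def posTrace (T : H →L[ℂ] H) : ℝ≥0∞ :=
  ∑' i, ENNReal.ofReal (inner ℂ (stdBasis H i) (T (stdBasis H i))).re

/-- Density operators: positive operators with trace one. -/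
def IsDensity (ρ : H →L[ℂ] H) : Prop := 0 ≤ ρ ∧ posTrace ρ = 1

/-- The partial trace over `H` of a trace class operator on `H ⊗ ℓ²(J)`, namely
`∑ b, (⟨b| ⊗ 1) T (|b⟩ ⊗ 1)` with `b` running through an orthonormal basis of `H`. -/
def traceLeft (T : Tens J H →L[ℂ] Tens J H) : Ell J →L[ℂ] Ell J :=
  ∑' i, ampl J (innerSL ℂ (stdBasis H i)) ∘L T ∘L
    ContinuousLinearMap.adjoint (ampl J (innerSL ℂ (stdBasis H i)))

/-- The embedding `v ↦ v ⊗ |x⟩` of the systems `Y` and `H` into the systems `X`, `Y` and `H`. -/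
def embed [Fintype Y] (x : X) : Tens Y H →L[ℂ] Tens (X × Y) H := ∑ y, ket (x, y) ∘L bra y

/-- The partial trace over `X`. -/
def traceX [Fintype X] [Fintype Y] (T : Tens (X × Y) H →L[ℂ] Tens (X × Y) H) :
    Tens Y H →L[ℂ] Tens Y H :=
  ∑ x : X, ContinuousLinearMap.adjoint (embed x) ∘L T ∘L embed x

/-- The operator `1_X ⊗ R`. -/
def oneTensor (X : Type) [Fintype X] [Fintype Y] (R : Tens Y H →L[ℂ] Tens Y H) :
    Tens (X × Y) H →L[ℂ] Tens (X × Y) H :=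
  ∑ x : X, embed x ∘L R ∘L ContinuousLinearMap.adjoint (embed x)

/-- For a state that is classical on the register `K`: the state in which the value `k` of this
register has been replaced by `f k` and all further information on `k` has been discarded. If `f`
is the projection of a product of registers to some of them, this is the partial trace over the
remaining ones. -/
def marginal [Fintype K] (f : K → X) (T : Tens K H →L[ℂ] Tens K H) : Tens X H →L[ℂ] Tens X H :=
  ∑ k, ket (f k) ∘L (bra k ∘L T ∘L ket k) ∘L bra (f k)

/-- The diagonal entry `⟨k| T_K |k⟩` of the marginal `T_K` on the classical register `K`. -/
def diagEntry (k : K) (T : Tens K H →L[ℂ] Tens K H) : ℂ := trace (bra k ∘L T ∘L ket k)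

/-- The square root of a positive operator. -/
def opSqrt (T : H →L[ℂ] H) : H →L[ℂ] H := CFC.sqrt T

/-! ### Entropies, in bits -/

/-- The orthogonal projection onto the eigenspace `{v | T v = l v}`. -/
def eigenProj (T : H →L[ℂ] H) (l : ℝ) : H →L[ℂ] H :=
  (LinearMap.ker
    ((T - (l : ℂ) • ContinuousLinearMap.id ℂ H : H →L[ℂ] H) : H →ₗ[ℂ] H)).starProjection

/-- The von Neumann entropy `-Tr[ρ log ρ]`, with values in `[0, ∞]`, of a density operator with
spectral decomposition `ρ = ∑ l, l P_l`, that is, `∑ l, (-l log l) Tr[P_l]`. -/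
def vonNeumannEntropy (ρ : H →L[ℂ] H) : ℝ≥0∞ :=
  ∑' l : ℝ, ENNReal.ofReal (-(l * Real.logb 2 l)) * posTrace (eigenProj ρ l)

/-- The nonnegative number `l log l - l log m + (m - l) log e`, which is `+∞` for `l > 0 = m`. -/
def kleinTerm (l m : ℝ) : ℝ≥0∞ :=
  if m = 0 then (if l = 0 then 0 else ⊤)
  else ENNReal.ofReal (l * Real.logb 2 l - l * Real.logb 2 m + (m - l) / Real.log 2)

/-- The Umegaki relative entropy `D(ρ‖σ) = Tr[ρ (log ρ - log σ)] / Tr[ρ]` of positive trace class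
operators. With the spectral decompositions `ρ = ∑ l, l P_l` and `σ = ∑ m, m Q_m`, the trace is
`∑ l m, (l log l - l log m) Tr[P_l Q_m]`. As usual in infinite dimension, the terms
`(m - l) Tr[P_l Q_m]`, whose sum is `Tr[σ] - Tr[ρ]`, are added to make all summands nonnegative, and
subtracted again. The value is `+∞` unless the support of `ρ` is contained in that of `σ`. -/
def relEntropy (ρ σ : H →L[ℂ] H) : EReal :=
  (((posTrace ρ).toReal⁻¹ : ℝ) : EReal) *
    (((∑' l : ℝ, ∑' m : ℝ,
        kleinTerm l m * posTrace (eigenProj ρ l ∘L eigenProj σ m ∘L eigenProj ρ l) : ℝ≥0∞) : EReal)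
      + ((((posTrace ρ).toReal - (posTrace σ).toReal) / Real.log 2 : ℝ) : EReal))

open Classical in
/-- The conditional von Neumann entropy `H(X|YH) = H(XYH) - H(YH)` for finite registers `X`, `Y` and
a quantum system `H`. If `H(YH) = ∞`, so that the difference has no meaning, it is, as usual,
`-D(ρ_{XYH} ‖ 1_X ⊗ ρ_{YH})`, which agrees with the difference if `H(YH) < ∞`. -/
def condEntropy [Fintype X] [Fintype Y] (ρ : Tens (X × Y) H →L[ℂ] Tens (X × Y) H) : EReal :=
  if vonNeumannEntropy (traceX ρ) ≠ ⊤ then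
    ((vonNeumannEntropy ρ : ℝ≥0∞) : EReal) - ((vonNeumannEntropy (traceX ρ) : ℝ≥0∞) : EReal)
  else -relEntropy ρ (oneTensor X (traceX ρ))

end Hilbert

/-! ### Heterodyne detection -/

/-- Photon numbers below the cutoff `N`; there is no cutoff for `N = ⊤`. -/
abbrev Fock (N : ℕ∞) : Type := {k : ℕ // (k : ℕ∞) < N}

/-- The Hilbert space of the system `B`: the single-mode Fock space, cut off at `N`. -/
abbrev HB (N : ℕ∞) : Type := Ell (Fock N)

/-- The `k`-photon amplitude `exp(-|y|^2/2) y^k / sqrt(k!)` of the coherent state `|y⟩`. -/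
def coherentAmp (y : ℂ) (k : ℕ) : ℂ :=
  (Real.exp (-‖y‖ ^ 2 / 2) : ℂ) * (y ^ k / (Real.sqrt (k.factorial : ℝ) : ℂ))

lemma norm_sq_coherentAmp (y : ℂ) (k : ℕ) :
    ‖coherentAmp y k‖ ^ 2 = Real.exp (-‖y‖ ^ 2) * ((‖y‖ ^ 2) ^ k / (k.factorial : ℝ)) := by
  have h1 : Real.exp (-‖y‖ ^ 2 / 2) ^ 2 = Real.exp (-‖y‖ ^ 2) := by
    rw [← Real.exp_nat_mul]; congr 1; push_cast; ring
  rw [coherentAmp, norm_mul, norm_div, norm_pow, Complex.norm_real, Complex.norm_real,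
    Real.norm_of_nonneg (Real.exp_pos _).le, Real.norm_of_nonneg (Real.sqrt_nonneg _),
    mul_pow, h1, div_pow, Real.sq_sqrt (by positivity), ← pow_mul, ← pow_mul, mul_comm k 2]

lemma memlp_coherentAmp (N : ℕ∞) (y : ℂ) :
    Memℓp (fun k : Fock N => coherentAmp y k) 2 := by
  refine memℓp_gen ?_
  have h : Summable fun k : ℕ => ‖coherentAmp y k‖ ^ 2 := by
    simp only [norm_sq_coherentAmp]
    exact (Real.summable_pow_div_factorial _).mul_left _
  have h2 := h.comp_injective (Subtype.val_injective (p := fun k : ℕ => (k : ℕ∞) < N))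
  refine h2.congr fun k => ?_
  simp

/-- The coherent state `|y⟩`, cut off to fewer than `N` photons (no cutoff for `N = ⊤`). -/
def coherent (N : ℕ∞) (y : ℂ) : HB N := ⟨fun k => coherentAmp y k, memlp_coherentAmp N y⟩

lemma continuous_coherentAmp (k : ℕ) : Continuous fun y : ℂ => coherentAmp y k := by
  unfold coherentAmp; fun_prop

lemma integral_norm_sq_coherentAmp (k : ℕ) : ∫ y : ℂ, ‖coherentAmp y k‖ ^ 2 = Real.pi := by
  simp only [norm_sq_coherentAmp]
  have h := Complex.integral_rpow_mul_exp_neg_rpow (p := 2) (q := 2 * k) (by norm_num)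
    (by have : (0 : ℝ) ≤ k := by positivity
        linarith)
  have h2 : (2 * (k : ℝ) + 2) / 2 = k + 1 := by ring
  rw [h2, Real.Gamma_nat_eq_factorial] at h
  have h3 : ∀ y : ℂ, Real.exp (-‖y‖ ^ 2) * ((‖y‖ ^ 2) ^ k / (k.factorial : ℝ)) =
      (k.factorial : ℝ)⁻¹ * (‖y‖ ^ (2 * (k : ℝ)) * Real.exp (-‖y‖ ^ (2 : ℝ))) := by
    intro y
    have e1 : ‖y‖ ^ (2 * (k : ℝ)) = (‖y‖ ^ 2) ^ k := by
      rw [← pow_mul, ← Real.rpow_natCast]; push_cast; rfl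
    rw [e1, Real.rpow_two]; ring
  simp only [h3]
  rw [integral_const_mul, h]
  have : (k.factorial : ℝ) ≠ 0 := by positivity
  field_simp

lemma integrable_norm_sq_coherentAmp (k : ℕ) :
    Integrable fun y : ℂ => ‖coherentAmp y k‖ ^ 2 := by
  by_contra h
  have := integral_norm_sq_coherentAmp k
  rw [integral_undef h] at this
  exact Real.pi_ne_zero this.symm

lemma memLp_coherentAmp (k : ℕ) : MemLp (fun y : ℂ => coherentAmp y k) 2 :=
  (memLp_two_iff_integrable_sq_norm (continuous_coherentAmp k).aestronglyMeasurable).2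
    (integrable_norm_sq_coherentAmp k)

lemma integral_coherentAmp_mul {k l : ℕ} (hkl : k ≠ l) :
    ∫ y : ℂ, conj (coherentAmp y k) * coherentAmp y l = 0 := by
  set I := ∫ y : ℂ, conj (coherentAmp y k) * coherentAmp y l with hI
  have key : ∀ t : ℝ, I = (conj (Complex.exp (t * Complex.I)) ^ k * Complex.exp (t * Complex.I) ^ l) * I := by
    intro t
    have hm := (rotation (Circle.exp t)).measurePreserving.integral_comp
      (rotation (Circle.exp t)).toHomeomorph.measurableEmbedding
      (fun y : ℂ => conj (coherentAmp y k) * coherentAmp y l)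
    rw [← hI] at hm
    refine hm.symm.trans ?_
    rw [hI, ← integral_const_mul]
    congr 1
    ext y
    simp [coherentAmp, rotation_apply, mul_pow]
    ring
  by_contra h0
  have hk := key (Real.pi / ((l : ℝ) - k))
  have h1 : conj (Complex.exp (((Real.pi / ((l : ℝ) - k) : ℝ) : ℂ) * Complex.I)) ^ k *
      Complex.exp (((Real.pi / ((l : ℝ) - k) : ℝ) : ℂ) * Complex.I) ^ l = -1 := by
    have hne : (l : ℂ) - k ≠ 0 := sub_ne_zero.2 (by exact_mod_cast hkl.symm)
    rw [← Complex.exp_conj, ← Complex.exp_nat_mul, ← Complex.exp_nat_mul, ← Complex.exp_add,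
      ← Complex.exp_pi_mul_I]
    congr 1
    simp
    field_simp
    ring
  rw [h1] at hk
  apply h0
  have : (2 : ℂ) * I = 0 := by linear_combination hk
  simpa using this

lemma integrable_coherentAmp_mul (k l : ℕ) :
    Integrable fun y : ℂ => conj (coherentAmp y k) * coherentAmp y l :=
  MemLp.integrable_mul (p := 2) (q := 2) (memLp_coherentAmp k).star (memLp_coherentAmp l)

lemma integral_conj_coherentAmp_mul (k l : ℕ) :
    ∫ y : ℂ, conj (coherentAmp y k) * coherentAmp y l = if k = l then (Real.pi : ℂ) else 0 := by
  split_ifs with h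
  · subst h
    rw [← integral_norm_sq_coherentAmp k, ← integral_complex_ofReal]
    congr 1
    ext y
    rw [mul_comm, Complex.mul_conj, Complex.normSq_eq_norm_sq]
  · exact integral_coherentAmp_mul h

lemma integral_norm_sq_sum (N : ℕ∞) (F : Finset (Fock N)) (a : Fock N → ℂ) :
    Integrable (fun y : ℂ => ‖∑ k ∈ F, conj (coherentAmp y k) * a k‖ ^ 2) ∧
    ∫ y : ℂ, ‖∑ k ∈ F, conj (coherentAmp y k) * a k‖ ^ 2 = Real.pi * ∑ k ∈ F, ‖a k‖ ^ 2 := by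
  have hm : ∀ k ∈ F, MemLp (fun y : ℂ => conj (coherentAmp y k) * a k) 2 := fun k _ =>
    ((memLp_coherentAmp k).star).mul_const (a k)
  have hmem : MemLp (fun y : ℂ => ∑ k ∈ F, conj (coherentAmp y k) * a k) 2 :=
    memLp_finsetSum F hm
  refine ⟨(memLp_two_iff_integrable_sq_norm hmem.1).1 hmem, ?_⟩
  have hexp : ∀ y : ℂ, ((‖∑ k ∈ F, conj (coherentAmp y k) * a k‖ ^ 2 : ℝ) : ℂ) =
      ∑ k ∈ F, ∑ l ∈ F, (a k * conj (a l)) * (conj (coherentAmp y k) * coherentAmp y l) := by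
    intro y
    rw [← Complex.normSq_eq_norm_sq, ← Complex.mul_conj, map_sum, Finset.sum_mul_sum]
    refine Finset.sum_congr rfl fun k _ => Finset.sum_congr rfl fun l _ => ?_
    simp only [map_mul, Complex.conj_conj]
    ring
  have hC : ((∫ y : ℂ, ‖∑ k ∈ F, conj (coherentAmp y k) * a k‖ ^ 2 : ℝ) : ℂ) =
      ((Real.pi * ∑ k ∈ F, ‖a k‖ ^ 2 : ℝ) : ℂ) := by
    rw [← integral_complex_ofReal]
    simp only [hexp]
    rw [integral_finsetSum F fun k _ => integrable_finsetSum F fun l _ =>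
      (integrable_coherentAmp_mul k l).const_mul (a k * conj (a l))]
    push_cast
    rw [Finset.mul_sum]
    refine Finset.sum_congr rfl fun k hk => ?_
    rw [integral_finsetSum F fun l _ =>
      (integrable_coherentAmp_mul k l).const_mul (a k * conj (a l))]
    simp only [integral_const_mul, integral_conj_coherentAmp_mul, Subtype.val_inj, mul_ite,
      mul_zero, Finset.sum_ite_eq, hk, if_true, Complex.mul_conj, Complex.normSq_eq_norm_sq]
    push_cast
    ring
  exact_mod_cast hC

lemma inner_coherent_sum_single (N : ℕ∞) (ψ : HB N) (F : Finset (Fock N)) (y : ℂ) :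
    inner ℂ (coherent N y) (∑ k ∈ F, lp.single 2 k (ψ k)) =
      ∑ k ∈ F, conj (coherentAmp y k) * ψ k := by
  rw [inner_sum]
  refine Finset.sum_congr rfl fun k _ => ?_
  rw [lp.inner_single_right]
  simp [coherent, mul_comm]

lemma tendsto_inner_coherent (N : ℕ∞) (ψ : HB N) (y : ℂ) :
    Tendsto (fun F : Finset (Fock N) => ∑ k ∈ F, conj (coherentAmp y k) * ψ k) atTop
      (𝓝 (inner ℂ (coherent N y) ψ)) := by
  have h : Tendsto (fun F : Finset (Fock N) => ∑ k ∈ F, lp.single 2 k (ψ k)) atTop (𝓝 ψ) :=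
    lp.hasSum_single (by norm_num) ψ
  have h2 := ((innerSL ℂ (coherent N y)).continuous.tendsto ψ).comp h
  refine h2.congr fun F => ?_
  exact inner_coherent_sum_single N ψ F y

lemma measurable_inner_coherent (N : ℕ∞) (ψ : HB N) :
    Measurable fun y : ℂ => inner ℂ (coherent N y) ψ := by
  refine measurable_of_tendsto_metrizable' (atTop : Filter (Finset (Fock N)))
    (f := fun (F : Finset (Fock N)) y => ∑ k ∈ F, conj (coherentAmp y k) * ψ k) (fun F => ?_)
    (tendsto_pi_nhds.2 fun y => tendsto_inner_coherent N ψ y)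
  refine Continuous.measurable ?_
  refine continuous_finsetSum _ fun k _ => ?_
  exact (Complex.continuous_conj.comp (continuous_coherentAmp k)).mul continuous_const

lemma sum_norm_sq_le (N : ℕ∞) (ψ : HB N) (F : Finset (Fock N)) :
    ∑ k ∈ F, ‖ψ k‖ ^ 2 ≤ ‖ψ‖ ^ 2 := by
  have := lp.sum_rpow_le_norm_rpow (p := 2) (by norm_num) ψ F
  simpa using this

lemma lintegral_inner_coherent_sq_le (N : ℕ∞) (ψ : HB N) :
    ∫⁻ y : ℂ, ‖inner ℂ (coherent N y) ψ‖ₑ ^ 2 ≤ ENNReal.ofReal (Real.pi * ‖ψ‖ ^ 2) := by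
  have hF : ∀ F : Finset (Fock N), ∫⁻ y : ℂ, ‖∑ k ∈ F, conj (coherentAmp y k) * ψ k‖ₑ ^ 2 ≤
      ENNReal.ofReal (Real.pi * ‖ψ‖ ^ 2) := by
    intro F
    obtain ⟨h1, h2⟩ := integral_norm_sq_sum N F fun k => ψ k
    have h3 := ofReal_integral_eq_lintegral_ofReal h1 (ae_of_all _ fun y => by positivity)
    rw [h2] at h3
    have h4 : ∀ y : ℂ, ‖∑ k ∈ F, conj (coherentAmp y k) * ψ k‖ₑ ^ 2 =
        ENNReal.ofReal (‖∑ k ∈ F, conj (coherentAmp y k) * ψ k‖ ^ 2) := by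
      intro y
      rw [ENNReal.ofReal_pow (norm_nonneg _), ofReal_norm]
    simp only [h4]
    rw [← h3]
    exact ENNReal.ofReal_le_ofReal
      (mul_le_mul_of_nonneg_left (sum_norm_sq_le N ψ F) Real.pi_pos.le)
  have hlim : ∀ y : ℂ, ‖inner ℂ (coherent N y) ψ‖ₑ ^ 2 =
      liminf (fun F : Finset (Fock N) => ‖∑ k ∈ F, conj (coherentAmp y k) * ψ k‖ₑ ^ 2) atTop := by
    intro y
    exact ((((ENNReal.continuous_pow 2).comp continuous_enorm).tendsto _).comp
      (tendsto_inner_coherent N ψ y)).liminf_eq.symm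
  simp only [hlim]
  refine (lintegral_liminf_le' fun F => ?_).trans ?_
  · refine Measurable.aemeasurable ?_
    refine Measurable.pow_const (Measurable.enorm (Continuous.measurable ?_)) 2
    refine continuous_finsetSum _ fun k _ => ?_
    exact (Complex.continuous_conj.comp (continuous_coherentAmp k)).mul continuous_const
  · refine liminf_le_of_le (by isBoundedDefault) fun b hb => ?_
    obtain ⟨F, hF'⟩ := hb.exists
    exact hF'.trans (hF F)

lemma memLp_inner_coherent (N : ℕ∞) (ψ : HB N) :
    MemLp (fun y : ℂ => inner ℂ (coherent N y) ψ) 2 := by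
  refine ⟨(measurable_inner_coherent N ψ).aestronglyMeasurable, ?_⟩
  rw [eLpNorm_lt_top_iff_lintegral_rpow_enorm_lt_top (by norm_num) (by norm_num)]
  have := (lintegral_inner_coherent_sq_le N ψ).trans_lt ENNReal.ofReal_lt_top
  simpa using this

lemma integral_inner_coherent_sq_le (N : ℕ∞) (S : Set ℂ) (ψ : HB N) :
    ∫ y in S, ‖inner ℂ (coherent N y) ψ‖ ^ 2 ≤ Real.pi * ‖ψ‖ ^ 2 := by
  have hi := (memLp_two_iff_integrable_sq_norm (memLp_inner_coherent N ψ).1).1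
    (memLp_inner_coherent N ψ)
  refine (setIntegral_le_integral hi (ae_of_all _ fun y => by positivity)).trans ?_
  rw [integral_eq_lintegral_of_nonneg_ae (ae_of_all _ fun y => by positivity) hi.1]
  refine ENNReal.toReal_le_of_le_ofReal (by positivity) ?_
  refine le_trans (le_of_eq ?_) (lintegral_inner_coherent_sq_le N ψ)
  refine lintegral_congr fun y => ?_
  rw [ENNReal.ofReal_pow (norm_nonneg _), ofReal_norm]

lemma integrable_heterodyneForm (N : ℕ∞) (S : Set ℂ) (φ ψ : HB N) :
    IntegrableOn (fun y : ℂ => inner ℂ φ (coherent N y) * inner ℂ (coherent N y) ψ) S := by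
  have h : Integrable (fun y : ℂ => inner ℂ φ (coherent N y) * inner ℂ (coherent N y) ψ) := by
    have := MemLp.integrable_mul (p := 2) (q := 2) (memLp_inner_coherent N φ).star
      (memLp_inner_coherent N ψ)
    refine this.congr (ae_of_all _ fun y => ?_)
    simp
  exact h.integrableOn

lemma norm_heterodyneForm_le (N : ℕ∞) (S : Set ℂ) (φ ψ : HB N) :
    ‖(Real.pi : ℂ)⁻¹ * ∫ y in S, inner ℂ φ (coherent N y) * inner ℂ (coherent N y) ψ‖ ≤
      1 * ‖φ‖ * ‖ψ‖ := by
  have hφ := (memLp_inner_coherent N φ).norm.restrict S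
  have hψ := (memLp_inner_coherent N ψ).norm.restrict S
  have h1 := integral_mul_le_Lp_mul_Lq_of_nonneg (μ := volume.restrict S) (p := 2) (q := 2)
    (by rw [Real.holderConjugate_iff]; norm_num)
    (f := fun y => ‖inner ℂ (coherent N y) φ‖) (g := fun y => ‖inner ℂ (coherent N y) ψ‖)
    (ae_of_all _ fun y => norm_nonneg _) (ae_of_all _ fun y => norm_nonneg _)
    (by simpa using hφ) (by simpa using hψ)
  have h2 : ‖∫ y in S, inner ℂ φ (coherent N y) * inner ℂ (coherent N y) ψ‖ ≤
      ∫ y in S, ‖inner ℂ (coherent N y) φ‖ * ‖inner ℂ (coherent N y) ψ‖ := by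
    refine (norm_integral_le_integral_norm _).trans (le_of_eq ?_)
    refine integral_congr_ae (ae_of_all _ fun y => ?_)
    simp only [norm_mul]
    rw [norm_inner_symm]
  have h3 : ∀ χ : HB N, (∫ y in S, ‖inner ℂ (coherent N y) χ‖ ^ (2 : ℝ)) ^ ((1 : ℝ) / 2) ≤
      Real.sqrt Real.pi * ‖χ‖ := by
    intro χ
    rw [← Real.sqrt_eq_rpow]
    refine Real.sqrt_le_iff.2 ⟨by positivity, ?_⟩
    rw [mul_pow, Real.sq_sqrt Real.pi_pos.le]
    simpa using integral_inner_coherent_sq_le N S χ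
  have h4 : ‖∫ y in S, inner ℂ φ (coherent N y) * inner ℂ (coherent N y) ψ‖ ≤
      Real.pi * (‖φ‖ * ‖ψ‖) := by
    refine h2.trans (h1.trans ((mul_le_mul (h3 φ) (h3 ψ) (by positivity) (by positivity)).trans
      (le_of_eq ?_)))
    calc _ = (Real.sqrt Real.pi * Real.sqrt Real.pi) * (‖φ‖ * ‖ψ‖) := by ring
      _ = _ := by rw [Real.mul_self_sqrt Real.pi_pos.le]
  rw [norm_mul, norm_inv, Complex.norm_real, Real.norm_of_nonneg Real.pi_pos.le, one_mul,
    inv_mul_le_iff₀ Real.pi_pos]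
  exact h4

/-- The form `(φ, ψ) ↦ π⁻¹ ∫_S ⟨φ|y⟩⟨y|ψ⟩ d²y`. -/
def heterodyneForm (N : ℕ∞) (S : Set ℂ) : HB N →L⋆[ℂ] HB N →L[ℂ] ℂ :=
  LinearMap.mkContinuous₂
    (LinearMap.mk₂'ₛₗ (starRingEnd ℂ) (RingHom.id ℂ)
      (fun φ ψ => (Real.pi : ℂ)⁻¹ *
        ∫ y in S, inner ℂ φ (coherent N y) * inner ℂ (coherent N y) ψ)
      (fun φ₁ φ₂ ψ => by
        simp only [inner_add_left, add_mul]
        rw [integral_add (integrable_heterodyneForm N S φ₁ ψ)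
          (integrable_heterodyneForm N S φ₂ ψ), mul_add])
      (fun c φ ψ => by
        simp only [inner_smul_left, mul_assoc, integral_const_mul, smul_eq_mul]
        ring)
      (fun φ ψ₁ ψ₂ => by
        simp only [inner_add_right, mul_add]
        rw [integral_add (integrable_heterodyneForm N S φ ψ₁)
          (integrable_heterodyneForm N S φ ψ₂), mul_add])
      (fun c φ ψ => by
        simp only [inner_smul_right, mul_left_comm _ c, integral_const_mul, smul_eq_mul,
          RingHom.id_apply]))
    1 (fun φ ψ => norm_heterodyneForm_le N S φ ψ)

/-- The effect `π⁻¹ ∫_S |y⟩⟨y| d²y` of the heterodyne measurement for outcomes in `S`; the integral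
is the weak one, see `inner_heterodyne`. -/
def heterodyne (N : ℕ∞) (S : Set ℂ) : HB N →L[ℂ] HB N :=
  ContinuousLinearMap.adjoint (InnerProductSpace.continuousLinearMapOfBilin (heterodyneForm N S))

lemma inner_heterodyne (N : ℕ∞) (S : Set ℂ) (φ ψ : HB N) :
    inner ℂ φ (heterodyne N S ψ) =
      (Real.pi : ℂ)⁻¹ * ∫ y in S, inner ℂ φ (coherent N y) * inner ℂ (coherent N y) ψ := by
  rw [heterodyne, ContinuousLinearMap.adjoint_inner_right,
    InnerProductSpace.continuousLinearMapOfBilin_apply]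
  rfl

/-! ### One round of the protocol -/

/-- The Hilbert space of the systems `A`, of dimension four, and `B`. -/
abbrev HAB (N : ℕ∞) : Type := Tens (Fin 4) (HB N)

/-- The operator `a_A ⊗ R_B`. -/
def opTensor {N : ℕ∞} (a : Matrix (Fin 4) (Fin 4) ℂ) (R : HB N →L[ℂ] HB N) : HAB N →L[ℂ] HAB N :=
  ∑ x, ∑ y, a x y • (ket x ∘L R ∘L bra y)

/-- The angular sector `π/4 (2j - 1) ≤ θ < π/4 (2j + 1)` of the phase space. -/
def sector (j : ℕ) : Set ℂ :=
  {y | ∃ r θ : ℝ, 0 ≤ r ∧ Real.pi / 4 * (2 * j - 1) ≤ θ ∧ θ < Real.pi / 4 * (2 * j + 1) ∧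
    y = r * Complex.exp (θ * Complex.I)}

/-- The region operators `R^z` of the key rounds. -/
def regionOp (N : ℕ∞) (z : Fin 4) : HB N →L[ℂ] HB N := heterodyne N (sector z)

open scoped ComplexOrder in
/-- The parameters of the protocol: the probabilities of key, parameter estimation and tomography
rounds, the discretisation for parameter estimation with `modules = Δ / δ`, and the POVM of the
tomography measurement. (That this POVM is informationally complete is not required.) -/
structure Protocol where
  pkey : ℝ
  pPE : ℝ
  ptom : ℝ
  pkey_nonneg : 0 ≤ pkey
  pPE_nonneg : 0 ≤ pPE
  ptom_nonneg : 0 ≤ ptom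
  sum_eq_one : pkey + pPE + ptom = 1
  modules : ℕ
  δ : ℝ
  δ_pos : 0 < δ
  Γ : Fin 16 → Matrix (Fin 4) (Fin 4) ℂ
  Γ_posSemidef : ∀ x, (Γ x).PosSemidef
  Γ_sum : ∑ x, Γ x = 1

namespace Protocol

variable (P : Protocol)

/-- The number `m = 4 Δ / δ + 4` of modules. -/
abbrev m : ℕ := 4 * P.modules + 4

/-- The module with number `z = j + 4 k`: the sector `j`, intersected with `|y| ∈ [δ k, δ (k + 1))`
if `k < Δ / δ` and with `|y| ∈ [Δ, ∞)` if `k = Δ / δ`. -/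
def module (z : Fin P.m) : Set ℂ :=
  sector ((z : ℕ) % 4) ∩
    {y | P.δ * ((z : ℕ) / 4 : ℕ) ≤ ‖y‖ ∧
      ((z : ℕ) / 4 < P.modules → ‖y‖ < P.δ * (((z : ℕ) / 4 : ℕ) + 1))}

/-- What happens in a round: a key round with outcomes `x` of Alice and `z` of Bob, a parameter
estimation round with outcomes `x` and `z`, or a tomography round with outcome `x'` of Alice. -/
abbrev Event : Type := (Fin 4 × Fin 4) ⊕ (Fin 4 × Fin P.m) ⊕ Fin 16

/-- The POVM element on `AB` belonging to the outcomes of a round. -/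
def effect (N : ℕ∞) : P.Event → (HAB N →L[ℂ] HAB N)
  | .inl (x, z) => opTensor (Matrix.single x x 1) (regionOp N z)
  | .inr (.inl (x, z)) => opTensor (Matrix.single x x 1) (heterodyne N (P.module z))
  | .inr (.inr x') => opTensor (P.Γ x') (ContinuousLinearMap.id ℂ (HB N))

/-- The random variable `R`, which is also the side information `S`. -/
def side : P.Event → Fin 3
  | .inl _ => 0
  | .inr (.inl _) => 1
  | .inr (.inr _) => 2

/-- The random variable `X̃`, where `none` stands for `⊥`. -/
def xTilde : P.Event → Option (Fin 4)
  | .inl _ => none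
  | .inr (.inl (x, _)) => some x
  | .inr (.inr _) => none

/-- The random variable `X'`. -/
def xPrime : P.Event → Option (Fin 16)
  | .inl _ => none
  | .inr (.inl _) => none
  | .inr (.inr x') => some x'

/-- The random variable `Ẑ`. -/
def zHat : P.Event → Option (Fin 4)
  | .inl (_, z) => some z
  | .inr (.inl _) => none
  | .inr (.inr _) => none

/-- The random variable `Z̃`. -/
def zTilde : P.Event → Option (Fin P.m)
  | .inl _ => none
  | .inr (.inl (_, z)) => some z
  | .inr (.inr _) => none

/-- The alphabet of `O = X̃ X' Ẑ Z̃`. -/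
abbrev OReg : Type := Option (Fin 4) × Option (Fin 16) × Option (Fin 4) × Option (Fin P.m)

/-- The alphabet of `C = X̃ Z̃ X'`. -/
abbrev CReg : Type := Option (Fin 4) × Option (Fin P.m) × Option (Fin 16)

/-- The registers `O S C`. -/
abbrev Reg : Type := P.OReg × Fin 3 × P.CReg

/-- The values of `O S C` in a round. -/
def output (e : P.Event) : P.Reg :=
  ((P.xTilde e, P.xPrime e, P.zHat e, P.zTilde e), P.side e, (P.xTilde e, P.zTilde e, P.xPrime e))

/-- The alphabet of the values that `C` takes in test rounds: `(x, z, ⊥)` and `(⊥, ⊥, x')`. -/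
abbrev CTest : Type := (Fin 4 × Fin P.m) ⊕ Fin 16

/-- The inclusion of the test alphabet into the alphabet of `C`. -/
def CTest.toCReg {P : Protocol} : P.CTest → P.CReg
  | .inl (x, z) => (some x, some z, none)
  | .inr x' => (none, none, some x')

/-- The law of `R` in the channel `M^EAT`. -/
def law : Fin 3 → ℝ := ![P.pkey, P.pPE, P.ptom]

/-- The law of `R` in the channel `M^{EAT,test}`, conditioned on not being a key round. -/
def testLaw : Fin 3 → ℝ := ![0, P.pPE / (1 - P.pkey), P.ptom / (1 - P.pkey)]

/-- The channel `AB → OSC` of a round in which `R` has the law `w`. -/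
def channel (N : ℕ∞) (w : Fin 3 → ℝ) (ρ : HAB N →L[ℂ] HAB N) : Ell P.Reg →L[ℂ] Ell P.Reg :=
  ∑ e : P.Event, ((w (P.side e) : ℂ) * trace (P.effect N e ∘L ρ)) •
    (ket (P.output e) ∘L bra (P.output e))

/-- The tensor product of the channel `AB → OSC` and the identity on `Ê = ℓ²(J)`. -/
def channelRef (N : ℕ∞) (w : Fin 3 → ℝ) {J : Type} (T : Tens J (HAB N) →L[ℂ] Tens J (HAB N)) :
    Tens P.Reg (Ell J) →L[ℂ] Tens P.Reg (Ell J) :=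
  ∑ e : P.Event, (w (P.side e) : ℂ) •
    (ket (P.output e) ∘L traceLeft (ampl J (P.effect N e) ∘L T) ∘L bra (P.output e))

/-- The set `Σ(p)` of the states of `AB` that are compatible with the test statistics `p`. -/
def states (N : ℕ∞) (p : P.CTest → ℝ) : Set (HAB N →L[ℂ] HAB N) :=
  {ρ | IsDensity ρ ∧ ∀ c : P.CTest,
    diagEntry c.toCReg (marginal (fun k => k.2.2) (P.channel N P.testLaw ρ)) = p c}

/-- The set `Σ_Ê(p)` of the pure states of `ABÊ`, with `Ê = ℓ²(J)`, that are compatible with the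
test statistics `p`. -/
def pureStates (N : ℕ∞) (J : Type) (p : P.CTest → ℝ) : Set (Tens J (HAB N)) :=
  {ψ | ‖ψ‖ = 1 ∧ ∀ c : P.CTest,
    diagEntry c.toCReg
      (marginal (fun k => k.2.2) (P.channelRef N P.testLaw (rankOne ℂ ψ ψ))) = p c}

/-- The conditional entropy `H(Ẑ|SÊ)` of the state that the channel `M^EAT` produces from the pure
state `ψ` of `ABÊ`. -/
def keyEntropy (N : ℕ∞) {J : Type} (ψ : Tens J (HAB N)) : EReal :=
  condEntropy (marginal (fun k : P.Reg => (k.1.2.2.1, k.2.1))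
    (P.channelRef N P.law (rankOne ℂ ψ ψ)))

/-- The crossover min-tradeoff function `g(p)` for `n` rounds: the infimum of `H(Ẑ|SÊ)` over the
systems `Ê` isomorphic to `Q_1 = A_2 B_2 ⋯ A_n B_n` and the pure states in `Σ_Ê(p)`. The infimum of
the empty set is `+∞`. -/
def crossover (N : ℕ∞) (n : ℕ) (p : P.CTest → ℝ) : EReal :=
  sInf {h | ∃ J : Type, Nonempty (J ≃ (Fin (n - 1) → Fin 4 × Fock N)) ∧
    ∃ ψ ∈ P.pureStates N J p, h = P.keyEntropy N ψ}

end Protocol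

/-! ### The key map and the pinching -/

/-- The Kraus operator `G = 1_A ⊗ ∑ z, √(R^z_B) ⊗ |z⟩`. -/
def krausG (N : ℕ∞) : HAB N →L[ℂ] Tens (Fin 4) (HAB N) :=
  ∑ z : Fin 4, ket z ∘L opTensor 1 (opSqrt (regionOp N z))

/-- The map `𝒢(ρ) = G ρ G†` from `AB` to `ABẐ`. -/
def keyMap (N : ℕ∞) (ρ : HAB N →L[ℂ] HAB N) : Tens (Fin 4) (HAB N) →L[ℂ] Tens (Fin 4) (HAB N) :=
  krausG N ∘L ρ ∘L ContinuousLinearMap.adjoint (krausG N)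

/-- The pinching `𝒵(T) = ∑ j, Z_j T Z_j` with `Z_j = |j⟩⟨j|` on the key register `Ẑ`. -/
def pinch {N : ℕ∞} (T : Tens (Fin 4) (HAB N) →L[ℂ] Tens (Fin 4) (HAB N)) :
    Tens (Fin 4) (HAB N) →L[ℂ] Tens (Fin 4) (HAB N) :=
  ∑ j : Fin 4, (ket j ∘L bra j) ∘L T ∘L (ket j ∘L bra j)

end

end CVQKD

namespace CVQKD

open MeasureTheory Filter InnerProductSpace
open scoped ENNReal NNReal Topology ComplexConjugate

noncomputable section

set_option linter.unusedSectionVars false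

/-! ### Traces, Hilbert–Schmidt operators and diagonalisation in Hilbert bases. -/

section General

variable {ι κ K J : Type}
variable {H : Type} [NormedAddCommGroup H] [InnerProductSpace ℂ H] [CompleteSpace H]
variable {H' : Type} [NormedAddCommGroup H'] [InnerProductSpace ℂ H'] [CompleteSpace H']

/-! ### Parseval's identity and traces -/

/-! The theorem rests on two facts about a pure state ψ of ABÊ with reduced state ρ on AB.

The test statistics of ψ depend only on ρ (`trace_refOp`, `Protocol.mem_pureStates_iff`), and every
density operator on AB occurs as such a ρ, because for n ≥ 2 the system Ê is at least as large as AB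
(`exists_redState_eq`, `exists_hilbertBasis_HAB`). So both infima run over the same reduced states.
Moreover H(Ẑ|SÊ) equals p^key D(𝒢(ρ)‖𝒵(𝒢(ρ))) for every unit vector ψ (`Protocol.keyEntropy_eq`), so
the infima agree.

For the entropy identity, let σ_z be the unnormalised state of Ê conditioned on the effect R^z, and
σ = ∑ σ_z its reduced state. In test rounds Ẑ = ⊥ is deterministic and contributes nothing, whereas
key rounds contribute -p^key ∑_z Tr[σ_z (log σ_z - log σ)] (`condEntropy_blockDiag`). On the other
side, G is an isometry with blocks A_z = 1 ⊗ √R^z, and the relative entropy compares GρG† with the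
direct sum of the A_z ρ A_z†. Now σ and GρG† are the two marginals of (G ⊗ 1)ψ, while σ_z and A_z ρ
A_z† are those of (A_z ⊗ 1)ψ. The Schmidt decomposition (`exists_isEigenbasis_conj`) therefore
matches eigenvectors with nonzero eigenvalues: f of σ (eigenvalue l) with b, and v of σ_z
(eigenvalue s) with c. The overlaps satisfy |⟨c, b_z⟩|² = (s/l) |⟨f, v⟩|², where b_z is the z-block
of b. As (l log l - l log s) s/l = -(s log s - s log l), the two relative entropies are negatives of
each other term by term (`relEntropy_conj_blockDiag`).

Everything is phrased with double series over pairs of eigenvectors, which converge absolutely by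
`abs_logTerm_le`; the entropies themselves may be infinite, and then their difference would be
meaningless. -/

lemma hasSum_norm_inner_sq (b : HilbertBasis ι ℂ H) (x : H) :
    HasSum (fun i => ‖inner ℂ (b i) x‖ ^ 2) (‖x‖ ^ 2) := by
  have h := b.hasSum_inner_mul_inner x x
  have h2 : HasSum (fun i => ((‖inner ℂ (b i) x‖ ^ 2 : ℝ) : ℂ)) ((‖x‖ ^ 2 : ℝ) : ℂ) := by
    have e : inner ℂ x x = ((‖x‖ ^ 2 : ℝ) : ℂ) := by
      rw [inner_self_eq_norm_sq_to_K]; simp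
    rw [e] at h
    refine h.congr_fun fun i => ?_
    rw [← inner_conj_symm x (b i), mul_comm, Complex.mul_conj, Complex.normSq_eq_norm_sq]
  exact_mod_cast h2

lemma tsum_norm_inner_sq (b : HilbertBasis ι ℂ H) (x : H) :
    ∑' i, ENNReal.ofReal (‖inner ℂ (b i) x‖ ^ 2) = ENNReal.ofReal (‖x‖ ^ 2) := by
  rw [← (hasSum_norm_inner_sq b x).tsum_eq,
    ENNReal.ofReal_tsum_of_nonneg (fun i => by positivity) (hasSum_norm_inner_sq b x).summable]

lemma hasSum_norm_inner_sq' (b : HilbertBasis ι ℂ H) (x : H) :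
    HasSum (fun i => ‖inner ℂ x (b i)‖ ^ 2) (‖x‖ ^ 2) := by
  simpa only [norm_inner_symm x] using hasSum_norm_inner_sq b x

lemma tsum_norm_inner_sq' (b : HilbertBasis ι ℂ H) (x : H) :
    ∑' i, ENNReal.ofReal (‖inner ℂ x (b i)‖ ^ 2) = ENNReal.ofReal (‖x‖ ^ 2) := by
  simpa only [norm_inner_symm x] using tsum_norm_inner_sq b x

/-- Both sides are the double sum of |⟨c j, S (b i)⟩|², in different orders. Applied to a square
root, this makes `posTrace` independent of the basis. -/
lemma tsum_norm_sq_adjoint (S : H →L[ℂ] H') (b : HilbertBasis ι ℂ H) (c : HilbertBasis κ ℂ H') :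
    ∑' i, ENNReal.ofReal (‖S (b i)‖ ^ 2) =
      ∑' j, ENNReal.ofReal (‖ContinuousLinearMap.adjoint S (c j)‖ ^ 2) := by
  simp_rw [← tsum_norm_inner_sq c (S (b _)), ← tsum_norm_inner_sq' b (ContinuousLinearMap.adjoint S (c _)),
    ContinuousLinearMap.adjoint_inner_left]
  exact ENNReal.tsum_comm

lemma sqrt_selfAdjoint (T : H →L[ℂ] H) :
    ContinuousLinearMap.adjoint (CFC.sqrt T) = CFC.sqrt T :=
  (CFC.sqrt_nonneg T).isSelfAdjoint.star_eq

lemma sqrt_apply_sqrt {T : H →L[ℂ] H} (hT : 0 ≤ T) (x : H) :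
    CFC.sqrt T (CFC.sqrt T x) = T x := by
  have := CFC.sqrt_mul_sqrt_self T hT
  exact DFunLike.congr_fun this x

lemma inner_sqrt_sqrt {T : H →L[ℂ] H} (hT : 0 ≤ T) (x y : H) :
    inner ℂ (CFC.sqrt T x) (CFC.sqrt T y) = inner ℂ x (T y) := by
  rw [← ContinuousLinearMap.adjoint_inner_right, sqrt_selfAdjoint, sqrt_apply_sqrt hT]

lemma inner_apply_self {T : H →L[ℂ] H} (hT : 0 ≤ T) (x : H) :
    inner ℂ x (T x) = ((‖CFC.sqrt T x‖ ^ 2 : ℝ) : ℂ) := by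
  rw [← inner_sqrt_sqrt hT, inner_self_eq_norm_sq_to_K]; simp

lemma re_inner_apply_self {T : H →L[ℂ] H} (hT : 0 ≤ T) (x : H) :
    (inner ℂ x (T x)).re = ‖CFC.sqrt T x‖ ^ 2 := by
  rw [inner_apply_self hT, Complex.ofReal_re]

lemma posTrace_eq {T : H →L[ℂ] H} (hT : 0 ≤ T) (b : HilbertBasis ι ℂ H) :
    posTrace T = ∑' i, ENNReal.ofReal (inner ℂ (b i) (T (b i))).re := by
  simp_rw [posTrace, re_inner_apply_self hT]
  rw [tsum_norm_sq_adjoint _ _ b, sqrt_selfAdjoint]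

lemma posTrace_eq_norm {T : H →L[ℂ] H} (hT : 0 ≤ T) (b : HilbertBasis ι ℂ H) :
    posTrace T = ∑' i, ENNReal.ofReal (‖CFC.sqrt T (b i)‖ ^ 2) := by
  simp_rw [posTrace_eq hT b, re_inner_apply_self hT]

lemma trace_eq_posTrace {T : H →L[ℂ] H} (hT : 0 ≤ T) :
    trace T = ((posTrace T).toReal : ℂ) := by
  rw [posTrace_eq_norm hT (stdBasis H), trace]
  simp_rw [inner_apply_self hT]
  rw [← Complex.ofReal_tsum, ENNReal.tsum_toReal_eq (fun _ => ENNReal.ofReal_ne_top)]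
  simp_rw [ENNReal.toReal_ofReal (sq_nonneg _)]

/-! ### Eigenbases -/

/-- The Hilbert basis `b` consists of eigenvectors of `T`, with the eigenvalues `μ`. -/
def IsEigenbasis (T : H →L[ℂ] H) (b : HilbertBasis ι ℂ H) (μ : ι → ℝ) : Prop :=
  ∀ i, T (b i) = (μ i : ℂ) • b i

/-- Self-adjointness of T is not needed: expand x in the basis and apply T to each term. -/
lemma inner_basis_apply {T : H →L[ℂ] H} {b : HilbertBasis ι ℂ H} {μ : ι → ℝ}
    (h : IsEigenbasis T b μ) (i : ι) (x : H) :
    inner ℂ (b i) (T x) = (μ i : ℂ) * inner ℂ (b i) x := by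
  classical
  have hx := b.hasSum_repr x
  have h1 := ((innerSL ℂ (b i)).comp T).hasSum hx
  have h2 := ((innerSL ℂ (b i)).hasSum hx).mul_left (μ i : ℂ)
  refine h1.unique (h2.congr_fun ?_)
  intro j
  have := orthonormal_iff_ite.1 b.orthonormal i j
  simp [h j, this]
  split_ifs with hij
  · subst hij; ring
  · simp

lemma eigenProj_basis {T : H →L[ℂ] H} {b : HilbertBasis ι ℂ H} {μ : ι → ℝ}
    (h : IsEigenbasis T b μ) (l : ℝ) (i : ι) :
    eigenProj T l (b i) = if μ i = l then b i else 0 := by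
  unfold eigenProj
  split_ifs with hl
  · refine Submodule.starProjection_eq_self_iff.2 ?_
    simp [h i, hl]
  · refine (Submodule.starProjection_apply_eq_zero_iff _).2 ?_
    rw [Submodule.mem_orthogonal']
    intro v hv
    have hv' : T v = (l : ℂ) • v := by
      simpa [sub_eq_zero] using hv
    have h1 := inner_basis_apply h i v
    rw [hv', inner_smul_right] at h1
    have h2 : ((l : ℂ) - μ i) * inner ℂ (b i) v = 0 := by rw [sub_mul, h1, sub_self]
    rcases mul_eq_zero.1 h2 with h3 | h3
    · exact absurd (by exact_mod_cast (sub_eq_zero.1 h3).symm) hl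
    · exact h3

lemma eigenProj_adjoint (T : H →L[ℂ] H) (l : ℝ) :
    ContinuousLinearMap.adjoint (eigenProj T l) = eigenProj T l :=
  (isSelfAdjoint_starProjection _).star_eq

lemma inner_eigenProj_left (T : H →L[ℂ] H) (l : ℝ) (x y : H) :
    inner ℂ (eigenProj T l x) y = inner ℂ x (eigenProj T l y) := by
  rw [← ContinuousLinearMap.adjoint_inner_right, eigenProj_adjoint]

lemma eigenProj_apply_eigenProj (T : H →L[ℂ] H) (l : ℝ) (x : H) :
    eigenProj T l (eigenProj T l x) = eigenProj T l x :=
  Submodule.starProjection_eq_self_iff.2 (Submodule.starProjection_apply_mem _ _)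

lemma inner_eigenProj_self (T : H →L[ℂ] H) (l : ℝ) (x : H) :
    inner ℂ x (eigenProj T l x) = ((‖eigenProj T l x‖ ^ 2 : ℝ) : ℂ) := by
  rw [← eigenProj_apply_eigenProj, ← inner_eigenProj_left, inner_self_eq_norm_sq_to_K,
    eigenProj_apply_eigenProj]
  simp

lemma eigenProj_nonneg (T : H →L[ℂ] H) (l : ℝ) : 0 ≤ eigenProj T l := by
  rw [ContinuousLinearMap.nonneg_iff_isPositive]
  have := ContinuousLinearMap.isPositive_adjoint_comp_self (eigenProj T l)
  rw [eigenProj_adjoint] at this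
  convert this using 1
  ext x
  simp [eigenProj_apply_eigenProj]

lemma posTrace_eigenProj {T : H →L[ℂ] H} {b : HilbertBasis ι ℂ H} {μ : ι → ℝ}
    (h : IsEigenbasis T b μ) (l : ℝ) :
    posTrace (eigenProj T l) = ∑' i, if μ i = l then 1 else 0 := by
  rw [posTrace_eq (eigenProj_nonneg T l) b]
  refine tsum_congr fun i => ?_
  rw [eigenProj_basis h]
  split_ifs
  · rw [inner_self_eq_norm_sq_to_K, b.orthonormal.1 i]; simp
  · simp

lemma posTrace_eigenProj_comp {T S : H →L[ℂ] H} {b : HilbertBasis ι ℂ H} {μ : ι → ℝ}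
    {c : HilbertBasis κ ℂ H} {ν : κ → ℝ} (h : IsEigenbasis T b μ) (h' : IsEigenbasis S c ν)
    (l m : ℝ) :
    posTrace (eigenProj T l ∘L eigenProj S m ∘L eigenProj T l) =
      ∑' i, ∑' j, if μ i = l ∧ ν j = m then ENNReal.ofReal (‖inner ℂ (c j) (b i)‖ ^ 2) else 0 := by
  have hpos : 0 ≤ eigenProj T l ∘L eigenProj S m ∘L eigenProj T l := by
    rw [ContinuousLinearMap.nonneg_iff_isPositive]
    have := ((ContinuousLinearMap.nonneg_iff_isPositive _).1 (eigenProj_nonneg S m)).conj_adjoint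
      (eigenProj T l)
    rwa [eigenProj_adjoint] at this
  rw [posTrace_eq hpos b]
  refine tsum_congr fun i => ?_
  rw [ContinuousLinearMap.comp_apply, ContinuousLinearMap.comp_apply, ← inner_eigenProj_left,
    eigenProj_basis h]
  split_ifs with hl
  · simp only [hl, true_and]
    rw [inner_eigenProj_self, Complex.ofReal_re, ← tsum_norm_inner_sq c]
    refine tsum_congr fun j => ?_
    rw [← inner_eigenProj_left, eigenProj_basis h']
    split_ifs <;> simp
  · simp [hl]

/-- The trace of a spectral projection counts the basis vectors with that eigenvalue. This turns
sums over all real numbers, as in the definition of the entropy, into sums over an arbitrary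
eigenbasis. -/
lemma tsum_mul_posTrace_eigenProj {T : H →L[ℂ] H} {b : HilbertBasis ι ℂ H} {μ : ι → ℝ}
    (h : IsEigenbasis T b μ) (F : ℝ → ℝ≥0∞) :
    ∑' l : ℝ, F l * posTrace (eigenProj T l) = ∑' i, F (μ i) := by
  simp_rw [posTrace_eigenProj h, ← ENNReal.tsum_mul_left]
  rw [ENNReal.tsum_comm]
  refine tsum_congr fun i => ?_
  rw [tsum_eq_single (μ i) (fun l hl => by simp [hl.symm])]
  simp

lemma tsum_mul_posTrace_eigenProj_comp {T S : H →L[ℂ] H} {b : HilbertBasis ι ℂ H} {μ : ι → ℝ}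
    {c : HilbertBasis κ ℂ H} {ν : κ → ℝ} (h : IsEigenbasis T b μ) (h' : IsEigenbasis S c ν)
    (F : ℝ → ℝ → ℝ≥0∞) :
    ∑' l : ℝ, ∑' m : ℝ, F l m * posTrace (eigenProj T l ∘L eigenProj S m ∘L eigenProj T l) =
      ∑' i, ∑' j, F (μ i) (ν j) * ENNReal.ofReal (‖inner ℂ (c j) (b i)‖ ^ 2) := by
  simp_rw [posTrace_eigenProj_comp h h', ← ENNReal.tsum_mul_left]
  have : ∀ l : ℝ, (∑' m : ℝ, ∑' i, ∑' j, F l m * (if μ i = l ∧ ν j = m then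
      ENNReal.ofReal (‖inner ℂ (c j) (b i)‖ ^ 2) else 0)) =
      ∑' i, ∑' j, ∑' m : ℝ, F l m * (if μ i = l ∧ ν j = m then
      ENNReal.ofReal (‖inner ℂ (c j) (b i)‖ ^ 2) else 0) := by
    intro l
    rw [ENNReal.tsum_comm]
    exact tsum_congr fun i => ENNReal.tsum_comm
  simp_rw [this]
  rw [ENNReal.tsum_comm]
  refine tsum_congr fun i => ?_
  rw [ENNReal.tsum_comm]
  refine tsum_congr fun j => ?_
  rw [tsum_eq_single (μ i) (fun l hl => by simp [hl.symm]),
    tsum_eq_single (ν j) (fun m hm => by simp [hm.symm])]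
  simp

lemma posTrace_eq_tsum_eigenvalues {T : H →L[ℂ] H} (hT : 0 ≤ T) {b : HilbertBasis ι ℂ H} {μ : ι → ℝ}
    (h : IsEigenbasis T b μ) : posTrace T = ∑' i, ENNReal.ofReal (μ i) := by
  rw [posTrace_eq hT b]
  refine tsum_congr fun i => ?_
  rw [h i, inner_smul_right, inner_self_eq_norm_sq_to_K, b.orthonormal.1 i]; simp

lemma eigenvalue_nonneg {T : H →L[ℂ] H} (hT : 0 ≤ T) {b : HilbertBasis ι ℂ H} {μ : ι → ℝ}
    (h : IsEigenbasis T b μ) (i : ι) : 0 ≤ μ i := by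
  have := re_inner_apply_self hT (b i)
  rw [h i, inner_smul_right, inner_self_eq_norm_sq_to_K, b.orthonormal.1 i] at this
  simp at this
  rw [this]; positivity

lemma nonneg_of_isEigenbasis {T : H →L[ℂ] H} {b : HilbertBasis ι ℂ H} {μ : ι → ℝ}
    (h : IsEigenbasis T b μ) (hμ : ∀ i, 0 ≤ μ i) : 0 ≤ T := by
  rw [ContinuousLinearMap.nonneg_iff_isPositive, ContinuousLinearMap.isPositive_iff_complex]
  have key : ∀ x, inner ℂ x (T x) = ((∑' i, μ i * ‖inner ℂ (b i) x‖ ^ 2 : ℝ) : ℂ) := by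
    intro x
    rw [← b.tsum_inner_mul_inner, Complex.ofReal_tsum]
    refine tsum_congr fun i => ?_
    rw [inner_basis_apply h, ← inner_conj_symm x (b i), mul_left_comm, mul_comm (conj _),
      Complex.mul_conj, Complex.normSq_eq_norm_sq]
    push_cast; rfl
  intro x
  have hx := key x
  rw [← inner_conj_symm, hx, Complex.conj_ofReal]
  exact ⟨by simp, by simpa using tsum_nonneg fun i => mul_nonneg (hμ i) (sq_nonneg _)⟩

lemma hasSum_eigenvalues {T : H →L[ℂ] H} (hT : 0 ≤ T) {b : HilbertBasis ι ℂ H} {μ : ι → ℝ}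
    (h : IsEigenbasis T b μ) (hfin : posTrace T ≠ ⊤) : HasSum μ (posTrace T).toReal := by
  rw [posTrace_eq_tsum_eigenvalues hT h] at hfin ⊢
  have h1 := ENNReal.hasSum_toReal hfin
  rw [ENNReal.tsum_toReal_eq (fun _ => ENNReal.ofReal_ne_top)]
  simpa only [ENNReal.toReal_ofReal (eigenvalue_nonneg hT h _)] using h1

/-! ### The spectral theorem for positive trace class operators -/

/-- The operator norm is at most the Hilbert–Schmidt norm: for the adjoint, use Parseval and the
Cauchy–Schwarz bound |⟨S (b i), y⟩| ≤ ‖S (b i)‖ ‖y‖. -/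
lemma norm_sq_le_tsum_norm_sq (S : H →L[ℂ] H') (b : HilbertBasis ι ℂ H) :
    ENNReal.ofReal (‖S‖ ^ 2) ≤ ∑' i, ENNReal.ofReal (‖S (b i)‖ ^ 2) := by
  by_cases h : ∑' i, ENNReal.ofReal (‖S (b i)‖ ^ 2) = ⊤
  · rw [h]; exact le_top
  refine (ENNReal.ofReal_le_iff_le_toReal h).2 ?_
  rw [← Real.le_sqrt (norm_nonneg _), ← LinearIsometryEquiv.norm_map ContinuousLinearMap.adjoint S]
  refine ContinuousLinearMap.opNorm_le_bound _ (Real.sqrt_nonneg _) fun y => ?_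
  rw [← Real.sqrt_sq (norm_nonneg y), ← Real.sqrt_mul ENNReal.toReal_nonneg,
    Real.le_sqrt (norm_nonneg _), ← ENNReal.ofReal_le_ofReal_iff (mul_nonneg ENNReal.toReal_nonneg (sq_nonneg _)),
    ENNReal.ofReal_mul ENNReal.toReal_nonneg, ENNReal.ofReal_toReal h, ← tsum_norm_inner_sq b,
    ← ENNReal.tsum_mul_right]
  · refine ENNReal.tsum_le_tsum fun i => ?_
    rw [ContinuousLinearMap.adjoint_inner_right, ← ENNReal.ofReal_mul (by positivity), ← mul_pow]
    exact ENNReal.ofReal_le_ofReal (pow_le_pow_left₀ (norm_nonneg _) (norm_inner_le_norm _ _) 2)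
  · exact mul_nonneg ENNReal.toReal_nonneg (sq_nonneg _)
  · exact ENNReal.toReal_nonneg

/-- The finite-rank truncations of S to finitely many basis vectors converge in operator norm, since
the error is bounded by a tail of the Hilbert–Schmidt sum. -/
lemma isCompactOperator_of_tsum_norm_sq {S : H →L[ℂ] H'} (b : HilbertBasis ι ℂ H)
    (h : ∑' i, ENNReal.ofReal (‖S (b i)‖ ^ 2) ≠ ⊤) : IsCompactOperator S := by
  classical
  let SF : Finset ι → (H →L[ℂ] H') := fun F => ∑ i ∈ F, rankOne ℂ (S (b i)) (b i)
  have hSF : ∀ F, IsCompactOperator (SF F) := by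
    intro F
    induction F using Finset.induction_on with
    | empty => simpa [SF] using isCompactOperator_zero
    | insert a F ha ih =>
      have : SF (insert a F) = rankOne ℂ (S (b a)) (b a) + SF F := Finset.sum_insert ha
      rw [this]
      refine IsCompactOperator.add ?_ ih
      rw [rankOne_def']
      exact (isCompactOperator_of_locallyCompactSpace_rng
        (ContinuousLinearMap.toSpanSingleton ℂ (S (b a)))).comp_clm _
  have hval : ∀ F i, (S - SF F) (b i) = if i ∈ F then 0 else S (b i) := by
    intro F i
    have : SF F (b i) = if i ∈ F then S (b i) else 0 := by
      simp only [SF, sum_apply, rankOne_apply,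
        orthonormal_iff_ite.1 b.orthonormal, ite_smul, one_smul, zero_smul, Finset.sum_ite_eq']
    rw [sub_apply, this]
    split_ifs <;> simp
  have hnorm : ∀ F, ENNReal.ofReal (‖S - SF F‖ ^ 2) ≤
      ∑' i : {i // i ∉ F}, ENNReal.ofReal (‖S (b i)‖ ^ 2) := by
    intro F
    have e : ∑' i : {i // i ∉ F}, ENNReal.ofReal (‖S (b i)‖ ^ 2) =
        ∑' i, ENNReal.ofReal (‖(S - SF F) (b i)‖ ^ 2) := by
      rw [← tsum_subtype_eq_of_support_subset (s := {i | i ∉ F})]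
      · refine tsum_congr fun i => ?_
        rw [hval, if_neg i.2]
      · intro i hi hiF
        simp [hval, hiF] at hi
    rw [e]
    exact norm_sq_le_tsum_norm_sq _ b
  refine isCompactOperator_of_tendsto (l := (atTop : Filter (Finset ι))) (F := SF) ?_ (Eventually.of_forall fun F => hSF F)
  rw [tendsto_iff_norm_sub_tendsto_zero]
  have h0 := ENNReal.tendsto_tsum_compl_atTop_zero h
  have h1 : Tendsto (fun F => ENNReal.ofReal (‖S - SF F‖ ^ 2)) atTop (𝓝 0) :=
    tendsto_of_tendsto_of_tendsto_of_le_of_le tendsto_const_nhds h0 (fun _ => zero_le) hnorm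
  have h2 := (ENNReal.tendsto_toReal ENNReal.zero_ne_top).comp h1
  have h3 := (Real.continuous_sqrt.tendsto _).comp h2
  simpa [Function.comp_def, norm_sub_rev] using h3

/-- The square root of T is Hilbert–Schmidt, hence T is compact and its eigenspaces span a dense
subspace; bases of the eigenspaces are then put together. -/
lemma exists_isEigenbasis {T : H →L[ℂ] H} (hT : 0 ≤ T) (hfin : posTrace T ≠ ⊤) :
    ∃ (ι : Type) (b : HilbertBasis ι ℂ H) (μ : ι → ℝ), IsEigenbasis T b μ := by
  have hsym : (T : H →ₗ[ℂ] H).IsSymmetric :=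
    ((ContinuousLinearMap.nonneg_iff_isPositive T).1 hT).isSymmetric
  have hcomp : IsCompactOperator T := by
    rw [posTrace_eq_norm hT (stdBasis H)] at hfin
    have h := (isCompactOperator_of_tsum_norm_sq _ hfin).clm_comp (CFC.sqrt T)
    have e : (⇑(CFC.sqrt T) ∘ ⇑(CFC.sqrt T)) = ⇑T := funext fun x => sqrt_apply_sqrt hT x
    rwa [e] at h
  have hbot := ContinuousLinearMap.orthogonalComplement_iSup_eigenspaces_eq_bot hcomp hsym
  have hclosed : ∀ μ : ℂ, CompleteSpace (Module.End.eigenspace (T : Module.End ℂ H) μ) := by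
    intro μ
    have e : (Module.End.eigenspace (T : Module.End ℂ H) μ : Set H) = {x | T x = μ • x} := by
      ext x; simp
    refine IsClosed.completeSpace_coe (hs := ?_)
    rw [e]
    exact isClosed_eq T.continuous (continuous_const_smul μ)
  -- All complex μ are admitted; a μ that is not an eigenvalue has the zero eigenspace, whose basis
  -- is empty.
  let b : ∀ μ : ℂ, HilbertBasis _ ℂ (Module.End.eigenspace (T : Module.End ℂ H) μ) :=
    fun μ => stdBasis _
  have hon := hsym.orthogonalFamily_eigenspaces.orthonormal_sigma_orthonormal
    (fun μ => (b μ).orthonormal)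
  refine ⟨_, HilbertBasis.mkOfOrthogonalEqBot hon ?_, fun i => i.1.re, ?_⟩
  · rw [eq_bot_iff, ← hbot]
    intro v hv
    rw [← Submodule.iInf_orthogonal, Submodule.mem_iInf]
    intro μ
    rw [Submodule.mem_orthogonal]
    intro u hu
    have hz : ∀ i, inner ℂ ((b μ i : H)) v = 0 := fun i =>
      (Submodule.mem_orthogonal _ v).1 hv _ (Submodule.subset_span ⟨⟨μ, i⟩, rfl⟩)
    have hs := ((b μ).hasSum_repr ⟨u, hu⟩).mapL (Submodule.subtypeL _)
    have hs' := (innerSL ℂ v).hasSum hs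
    have h0 : inner ℂ v u = 0 := by
      refine hs'.unique ?_
      convert hasSum_zero using 2 with i
      have := hz i
      rw [inner_eq_zero_symm] at this
      simp [this]
    exact inner_eq_zero_symm.1 h0
  · rintro ⟨μ, i⟩
    simp only [HilbertBasis.coe_mkOfOrthogonalEqBot]
    have hmem := (b μ i).2
    have hne : ((b μ i : H)) ≠ 0 := by
      have := (b μ).orthonormal.ne_zero i
      simpa using this
    -- By symmetry the eigenvalue is real, so nothing was lost in recording its real part.
    have hc := hsym.conj_eigenvalue_eq_self (Module.End.hasEigenvalue_of_hasEigenvector ⟨hmem, hne⟩)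
    rw [Complex.conj_eq_iff_re.1 hc]
    exact Module.End.mem_eigenspace_iff.1 hmem

/-! ### Construction of Hilbert bases -/

/-- Add a basis of the orthogonal complement. It serves to complete the eigenvectors with nonzero
eigenvalue by vectors of the kernel. -/
lemma exists_hilbertBasis_sum {e : ι → H} (he : Orthonormal ℂ e) :
    ∃ (κ : Type) (b : HilbertBasis (ι ⊕ κ) ℂ H), ∀ i, b (.inl i) = e i := by
  let V : Submodule ℂ H := (Submodule.span ℂ (Set.range e))ᗮ
  let c := stdBasis V
  have horth : ∀ i j, inner ℂ (e i) (c j : H) = 0 := fun i j =>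
    (Submodule.mem_orthogonal _ _).1 (c j).2 _ (Submodule.subset_span ⟨i, rfl⟩)
  have hc : Orthonormal ℂ fun j => (c j : H) := c.orthonormal.comp_linearIsometry V.subtypeₗᵢ
  have hon : Orthonormal ℂ (Sum.elim e fun j => (c j : H)) := by
    constructor
    · rintro (i | j)
      exacts [he.1 i, hc.1 j]
    · rintro (i | j) (i' | j') h
      · exact he.2 fun h' => h (by rw [h'])
      · exact horth i j'
      · exact inner_eq_zero_symm.1 (horth i' j)
      · exact hc.2 fun h' => h (by rw [h'])
  suffices hbot : (Submodule.span ℂ (Set.range (Sum.elim e fun j => (c j : H))))ᗮ = ⊥ from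
    ⟨_, HilbertBasis.mkOfOrthogonalEqBot hon hbot, fun i => by simp⟩
  rw [eq_bot_iff]
  intro v hv
  have h1 : ∀ x, inner ℂ (Sum.elim e (fun j => (c j : H)) x) v = 0 := fun x =>
    (Submodule.mem_orthogonal _ v).1 hv _ (Submodule.subset_span ⟨x, rfl⟩)
  have hvV : v ∈ V := by
    refine (Submodule.mem_orthogonal _ v).2 fun u hu => ?_
    induction hu using Submodule.span_induction with
    | mem x hx => obtain ⟨i, rfl⟩ := hx; exact h1 (.inl i)
    | zero => simp
    | add x y _ _ hx hy => rw [inner_add_left, hx, hy, add_zero]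
    | smul a x _ hx => rw [inner_smul_left, hx, mul_zero]
  have h2 := (hasSum_norm_inner_sq c ⟨v, hvV⟩).unique (by
    convert hasSum_zero using 2 with j
    have := h1 (.inr j)
    simpa using this)
  simpa using h2

end General

/-! ### Block diagonal operators, and entropies as double series over eigenbases. -/

section Tensor

variable {ι κ K J X Y : Type}
variable {H : Type} [NormedAddCommGroup H] [InnerProductSpace ℂ H] [CompleteSpace H]
variable {H' : Type} [NormedAddCommGroup H'] [InnerProductSpace ℂ H'] [CompleteSpace H']

/-! ### Kets, bras and block diagonal operators -/

@[simp] lemma bra_apply (j : J) (ψ : Tens J H) : bra j ψ = ψ j := rfl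

open Classical in
lemma ket_apply (j k : J) (v : H) : ket j v k = if k = j then v else 0 := by
  rw [ket, lp.singleContinuousLinearMap_apply, lp.single_apply]
  split_ifs with h
  · subst h; simp
  · rw [Pi.single_eq_of_ne h]

@[simp] lemma ket_apply_self (j : J) (v : H) : ket j v j = v := by simp [ket_apply]

lemma ket_apply_ne {j k : J} (h : k ≠ j) (v : H) : ket j v k = 0 := by simp [ket_apply, h]

@[simp] lemma ampl_apply (A : H →L[ℂ] H') (ψ : Tens J H) (j : J) : ampl J A ψ j = A (ψ j) := rfl

@[simp] lemma inner_ket_left (j : J) (v : H) (ψ : Tens J H) :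
    inner ℂ (ket j v) ψ = inner ℂ v (ψ j) := by
  classical
  rw [ket, lp.singleContinuousLinearMap_apply, lp.inner_single_left]

@[simp] lemma inner_ket_right (j : J) (v : H) (ψ : Tens J H) :
    inner ℂ ψ (ket j v) = inner ℂ (ψ j) v := by
  classical
  rw [ket, lp.singleContinuousLinearMap_apply, lp.inner_single_right]

@[simp] lemma adjoint_ket (j : J) :
    ContinuousLinearMap.adjoint (ket j : H →L[ℂ] Tens J H) = bra j := by
  refine (ContinuousLinearMap.eq_adjoint_iff _ _).2 (fun x y => ?_) |>.symm
  simp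

@[simp] lemma adjoint_bra (j : J) :
    ContinuousLinearMap.adjoint (bra j : Tens J H →L[ℂ] H) = ket j := by
  rw [← adjoint_ket, ContinuousLinearMap.adjoint_adjoint]

lemma tens_ext {ψ φ : Tens J H} (h : ∀ j, ψ j = φ j) : ψ = φ := lp.ext (funext h)

lemma norm_ket (j : J) (v : H) : ‖ket j v‖ = ‖v‖ := by
  classical
  rw [ket, lp.singleContinuousLinearMap_apply, lp.norm_single (by norm_num)]

lemma orthonormal_ket {ι : K → Type} {b : ∀ k, ι k → H} (hb : ∀ k, Orthonormal ℂ (b k)) :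
    Orthonormal ℂ fun i : Σ k, ι k => ket i.1 (b i.1 i.2) := by
  refine ⟨fun i => by rw [norm_ket, (hb i.1).1], ?_⟩
  rintro ⟨k, i⟩ ⟨l, j⟩ h
  simp only [inner_ket_left]
  by_cases hkl : k = l
  · subst hkl
    rw [ket_apply_self]
    exact (hb k).2 fun hij => h (by rw [hij])
  · rw [ket_apply_ne hkl, inner_zero_right]

/-- The Hilbert basis `|k⟩ ⊗ b k i` of `H ⊗ ℓ²(K)`. -/
def tensBasis {ι : K → Type} (b : ∀ k, HilbertBasis (ι k) ℂ H) :
    HilbertBasis (Σ k, ι k) ℂ (Tens K H) :=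
  HilbertBasis.mkOfOrthogonalEqBot (v := fun i => ket i.1 (b i.1 i.2))
    (orthonormal_ket fun k => (b k).orthonormal) (by
    rw [eq_bot_iff]
    intro v hv
    refine tens_ext fun k => ?_
    have h : ∀ i, inner ℂ (b k i) (v k) = 0 := fun i => by
      rw [← inner_ket_left]
      exact (Submodule.mem_orthogonal _ v).1 hv _ (Submodule.subset_span ⟨⟨k, i⟩, rfl⟩)
    have h2 := (hasSum_norm_inner_sq (b k) (v k)).unique (by
      convert hasSum_zero using 2 with i
      simp [h i])
    simpa using h2)

@[simp] lemma tensBasis_apply {ι : K → Type} (b : ∀ k, HilbertBasis (ι k) ℂ H) (i : Σ k, ι k) :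
    tensBasis b i = ket i.1 (b i.1 i.2) := by
  rw [tensBasis, HilbertBasis.coe_mkOfOrthogonalEqBot]

/-- The block diagonal operator `∑ k, B k ⊗ |k⟩⟨k|`. -/
def blockDiag [Fintype K] (B : K → (H →L[ℂ] H)) : Tens K H →L[ℂ] Tens K H :=
  ∑ k, ket k ∘L B k ∘L bra k

lemma blockDiag_apply [Fintype K] (B : K → (H →L[ℂ] H)) (ψ : Tens K H) (k : K) :
    blockDiag B ψ k = B k (ψ k) := by
  classical
  rw [← bra_apply, blockDiag, sum_apply, map_sum, Finset.sum_eq_single k]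
  · simp
  · intro l _ hl
    simp [ket_apply_ne hl.symm]
  · simp

lemma isEigenbasis_blockDiag [Fintype K] {B : K → (H →L[ℂ] H)} {ι : K → Type}
    {b : ∀ k, HilbertBasis (ι k) ℂ H} {μ : ∀ k, ι k → ℝ} (h : ∀ k, IsEigenbasis (B k) (b k) (μ k)) :
    IsEigenbasis (blockDiag B) (tensBasis b) fun i => μ i.1 i.2 := by
  rintro ⟨k, i⟩
  refine tens_ext fun l => ?_
  rw [blockDiag_apply, tensBasis_apply, lp.coeFn_smul, Pi.smul_apply]
  by_cases hl : l = k
  · subst hl; rw [ket_apply_self, h l i]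
  · simp [ket_apply_ne hl]

open Classical in
lemma embed_apply [Fintype Y] (x x' : X) (y : Y) (v : Tens Y H) :
    embed x v (x', y) = if x' = x then v y else 0 := by
  rw [← bra_apply, embed, sum_apply, map_sum, Finset.sum_eq_single y]
  · simp [ket_apply]
  · intro y' _ hy
    simp [ket_apply, hy.symm]
  · simp

lemma adjoint_embed_apply [Fintype Y] (x : X) (y : Y) (ψ : Tens (X × Y) H) :
    ContinuousLinearMap.adjoint (embed x) ψ y = ψ (x, y) := by
  classical
  refine ext_inner_left ℂ fun v => ?_
  rw [← inner_ket_left, ContinuousLinearMap.adjoint_inner_right, ← inner_ket_left]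
  congr 1
  refine tens_ext fun ⟨x', y'⟩ => ?_
  rw [embed_apply, ket_apply, ket_apply]
  by_cases h1 : x' = x <;> by_cases h2 : y' = y <;> simp [h1, h2]

lemma traceX_blockDiag [Fintype X] [Fintype Y] (B : X × Y → (H →L[ℂ] H)) :
    traceX (blockDiag B) = blockDiag fun y => ∑ x, B (x, y) := by
  ext1 ψ
  refine tens_ext fun y => ?_
  rw [blockDiag_apply, ← bra_apply, traceX, sum_apply, map_sum, sum_apply]
  refine Finset.sum_congr rfl fun x _ => ?_
  rw [bra_apply, ContinuousLinearMap.comp_apply, adjoint_embed_apply,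
    ContinuousLinearMap.comp_apply, blockDiag_apply, embed_apply, if_pos rfl]

/-- The Hilbert basis `|x⟩ ⊗ c i` of the space of the systems `X`, `Y` and `H`. -/
def embedBasis (X : Type) [Fintype Y] (c : HilbertBasis κ ℂ (Tens Y H)) :
    HilbertBasis (X × κ) ℂ (Tens (X × Y) H) :=
  HilbertBasis.mkOfOrthogonalEqBot (v := fun i : X × κ => embed i.1 (c i.2))
    (by
      classical
      have h : ∀ (x : X) (v : Tens Y H), ContinuousLinearMap.adjoint (embed x) (embed x v) = v :=
        fun x v => tens_ext fun y => by rw [adjoint_embed_apply, embed_apply, if_pos rfl]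
      have h' : ∀ (x x' : X) (v : Tens Y H), x ≠ x' →
          ContinuousLinearMap.adjoint (embed x) (embed x' v) = 0 :=
        fun x x' v hx => tens_ext fun y => by
          rw [adjoint_embed_apply, embed_apply, if_neg hx]; rfl
      rw [orthonormal_iff_ite]
      rintro ⟨x, i⟩ ⟨x', j⟩
      rw [← ContinuousLinearMap.adjoint_inner_right]
      by_cases hx : x = x'
      · subst hx
        rw [h, orthonormal_iff_ite.1 c.orthonormal]
        simp
      · rw [h' _ _ _ hx]
        simp [hx]) (by
    rw [eq_bot_iff]
    intro v hv
    refine tens_ext fun ⟨x, y⟩ => ?_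
    have h : ∀ i, inner ℂ (c i) (ContinuousLinearMap.adjoint (embed x) v) = 0 := fun i => by
      rw [ContinuousLinearMap.adjoint_inner_right]
      exact (Submodule.mem_orthogonal _ v).1 hv _ (Submodule.subset_span ⟨⟨x, i⟩, rfl⟩)
    have h2 := (hasSum_norm_inner_sq c (ContinuousLinearMap.adjoint (embed x) v)).unique (by
      convert hasSum_zero using 2 with i
      simp [h i])
    have h3 : ContinuousLinearMap.adjoint (embed x) v = 0 := by simpa using h2
    rw [← adjoint_embed_apply, h3]; rfl)

@[simp] lemma embedBasis_apply [Fintype Y] (c : HilbertBasis κ ℂ (Tens Y H)) (i : X × κ) :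
    embedBasis X c i = embed i.1 (c i.2) := by
  rw [embedBasis, HilbertBasis.coe_mkOfOrthogonalEqBot]

lemma isEigenbasis_oneTensor [Fintype X] [Fintype Y] {R : Tens Y H →L[ℂ] Tens Y H}
    {c : HilbertBasis κ ℂ (Tens Y H)} {ν : κ → ℝ} (h : IsEigenbasis R c ν) :
    IsEigenbasis (oneTensor X R) (embedBasis X c) fun i => ν i.2 := by
  classical
  rintro ⟨x, i⟩
  rw [embedBasis_apply, oneTensor, sum_apply, Finset.sum_eq_single x]
  · have e : ContinuousLinearMap.adjoint (embed x) (embed x (c i)) = c i :=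
      tens_ext fun y => by rw [adjoint_embed_apply, embed_apply, if_pos rfl]
    simp only [ContinuousLinearMap.comp_apply, e, h i, map_smul]
  · intro x' _ hx
    have e : ContinuousLinearMap.adjoint (embed x') (embed x (c i)) = 0 :=
      tens_ext fun y => by rw [adjoint_embed_apply, embed_apply, if_neg hx]; rfl
    simp only [ContinuousLinearMap.comp_apply, e, map_zero]
  · simp

/-! ### Entropies in terms of eigenbases -/

lemma hasSum_prod_of_nonneg {f : ι × κ → ℝ} {g : ι → ℝ} {a : ℝ} (h0 : ∀ p, 0 ≤ f p)
    (h1 : ∀ i, HasSum (fun j => f (i, j)) (g i)) (h2 : HasSum g a) : HasSum f a := by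
  have hs : Summable f := (summable_prod_of_nonneg h0).2
    ⟨fun i => (h1 i).summable, by simpa only [(h1 _).tsum_eq] using h2.summable⟩
  have h3 := hs.hasSum
  rwa [(h3.prod_fiberwise h1).unique h2] at h3

/-- The summand `l log l - l log m` of a relative entropy, in bits. -/
def logTerm (l m : ℝ) : ℝ := l * Real.logb 2 l - l * Real.logb 2 m

@[simp] lemma logTerm_zero (m : ℝ) : logTerm 0 m = 0 := by simp [logTerm]

@[simp] lemma logTerm_self (m : ℝ) : logTerm m m = 0 := by simp [logTerm]

/-- For l > 0 this is ln (m / l) ≤ m / l - 1, multiplied by l. -/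
lemma logTerm_klein {l m : ℝ} (hl : 0 ≤ l) (hm : 0 < m) :
    0 ≤ logTerm l m + (m - l) / Real.log 2 := by
  have h2 : 0 < Real.log 2 := Real.log_pos (by norm_num)
  have e : logTerm l m + (m - l) / Real.log 2 =
      (l * Real.log l - l * Real.log m + (m - l)) / Real.log 2 := by
    simp only [logTerm, Real.logb]; ring
  rw [e]
  refine div_nonneg ?_ h2.le
  rcases hl.eq_or_lt with rfl | hl
  · simpa using hm.le
  · have h := Real.log_le_sub_one_of_pos (div_pos hm hl)
    rw [Real.log_div hm.ne' hl.ne'] at h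
    have := mul_le_mul_of_nonneg_left h hl.le
    have e2 : l * (m / l - 1) = m - l := by field_simp
    rw [e2] at this
    linarith

/-- The two terms log r cancel. The assumption `hm` is essential because the logarithm of 0 has the
default value 0, so that log (r m) = log r + log m fails for m = 0. -/
lemma logTerm_smul {r l m : ℝ} (hr : 0 ≤ r) (hm : m = 0 → l = 0) :
    logTerm (r * l) (r * m) = r * logTerm l m := by
  by_cases hl : l = 0
  · simp [hl]
  rcases hr.eq_or_lt with rfl | hr
  · simp
  have hm' : m ≠ 0 := fun h => hl (hm h)
  simp only [logTerm, Real.logb, Real.log_mul hr.ne' hl, Real.log_mul hr.ne' hm']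
  ring

/-- By Parseval in either basis, the weighted eigenvalues of ρ and σ sum to 1 and s, so the terms
added in `kleinTerm` contribute (s - 1) / ln 2, which the definition subtracts again. The trace s is
arbitrary because 1 ⊗ ρ_Y is not normalised. -/
lemma relEntropy_eq_tsum {ρ σ : H →L[ℂ] H} {b : HilbertBasis ι ℂ H} {μ : ι → ℝ}
    {c : HilbertBasis κ ℂ H} {ν : κ → ℝ} (hρ : IsEigenbasis ρ b μ) (hσ : IsEigenbasis σ c ν)
    (hμ : ∀ i, 0 ≤ μ i) (hν : ∀ j, 0 ≤ ν j) {s : ℝ} (hμs : HasSum μ 1) (hνs : HasSum ν s)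
    (hsupp : ∀ i j, ν j = 0 → μ i ≠ 0 → inner ℂ (c j) (b i) = 0)
    (ht : Summable fun p : ι × κ => logTerm (μ p.1) (ν p.2) * ‖inner ℂ (c p.2) (b p.1)‖ ^ 2) :
    relEntropy ρ σ =
      ((∑' p : ι × κ, logTerm (μ p.1) (ν p.2) * ‖inner ℂ (c p.2) (b p.1)‖ ^ 2 : ℝ) : EReal) := by
  set w : ι × κ → ℝ := fun p => ‖inner ℂ (c p.2) (b p.1)‖ ^ 2 with hw
  have hposρ : posTrace ρ = 1 := by
    rw [posTrace_eq_tsum_eigenvalues (nonneg_of_isEigenbasis hρ hμ) hρ,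
      ← ENNReal.ofReal_tsum_of_nonneg hμ hμs.summable, hμs.tsum_eq, ENNReal.ofReal_one]
  have hs0 : 0 ≤ s := hνs.nonneg hν
  have hposσ : (posTrace σ).toReal = s := by
    rw [posTrace_eq_tsum_eigenvalues (nonneg_of_isEigenbasis hσ hν) hσ,
      ← ENNReal.ofReal_tsum_of_nonneg hν hνs.summable, hνs.tsum_eq, ENNReal.toReal_ofReal hs0]
  have h1 : HasSum (fun p : ι × κ => μ p.1 * w p) 1 := by
    refine hasSum_prod_of_nonneg (fun p => mul_nonneg (hμ _) (sq_nonneg _)) (fun i => ?_) hμs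
    have := (hasSum_norm_inner_sq c (b i)).mul_left (μ i)
    rwa [b.orthonormal.1 i, one_pow, mul_one] at this
  have h2 : HasSum (fun p : ι × κ => ν p.2 * w p) s := by
    have : HasSum (fun p : κ × ι => ν p.1 * w p.swap) s := by
      refine hasSum_prod_of_nonneg (fun p => mul_nonneg (hν _) (sq_nonneg _)) (fun j => ?_) hνs
      have := (hasSum_norm_inner_sq' b (c j)).mul_left (ν j)
      rwa [c.orthonormal.1 j, one_pow, mul_one] at this
    exact (Equiv.prodComm ι κ).hasSum_iff.2 this
  have h3 := ht.hasSum.add ((h2.sub h1).div_const (Real.log 2))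
  set S := ∑' p : ι × κ, logTerm (μ p.1) (ν p.2) * w p with hS
  have hterm : ∀ p : ι × κ, kleinTerm (μ p.1) (ν p.2) * ENNReal.ofReal (w p) = ENNReal.ofReal
      (logTerm (μ p.1) (ν p.2) * w p + (ν p.2 * w p - μ p.1 * w p) / Real.log 2) ∧
      0 ≤ logTerm (μ p.1) (ν p.2) * w p + (ν p.2 * w p - μ p.1 * w p) / Real.log 2 := by
    intro p
    by_cases hn : ν p.2 = 0
    · by_cases hm : μ p.1 = 0
      · simp [kleinTerm, hn, hm]
      -- Here `kleinTerm` is infinite, but its weight vanishes by `hsupp`, and ∞ · 0 = 0.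
      · simp [hw, hsupp p.1 p.2 hn hm]
    · have e : logTerm (μ p.1) (ν p.2) * w p + (ν p.2 * w p - μ p.1 * w p) / Real.log 2 =
        (logTerm (μ p.1) (ν p.2) + (ν p.2 - μ p.1) / Real.log 2) * w p := by ring
      have hpos := logTerm_klein (hμ p.1) ((hν p.2).lt_of_ne' hn)
      rw [e, kleinTerm, if_neg hn, ENNReal.ofReal_mul hpos, logTerm]
      exact ⟨rfl, mul_nonneg hpos (sq_nonneg _)⟩
  have hD : ∑' l : ℝ, ∑' m : ℝ, kleinTerm l m *
      posTrace (eigenProj ρ l ∘L eigenProj σ m ∘L eigenProj ρ l) =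
      ENNReal.ofReal (S + (s - 1) / Real.log 2) := by
    rw [tsum_mul_posTrace_eigenProj_comp hρ hσ kleinTerm,
      ← ENNReal.tsum_prod (f := fun i j => kleinTerm (μ i) (ν j) * ENNReal.ofReal (w (i, j)))]
    rw [← h3.tsum_eq, ENNReal.ofReal_tsum_of_nonneg (fun p => (hterm p).2) h3.summable]
    exact tsum_congr fun p => (hterm p).1
  have hnn : 0 ≤ S + (s - 1) / Real.log 2 := h3.nonneg fun p => (hterm p).2
  rw [relEntropy, hD, hposρ, hposσ, EReal.coe_ennreal_ofReal, max_eq_left hnn, ← EReal.coe_add,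
    ← EReal.coe_mul]
  congr 1
  simp only [ENNReal.toReal_one]
  ring

lemma vonNeumannEntropy_eq_tsum {ρ : H →L[ℂ] H} {b : HilbertBasis ι ℂ H} {μ : ι → ℝ}
    (hρ : IsEigenbasis ρ b μ) :
    vonNeumannEntropy ρ = ∑' i, ENNReal.ofReal (-(μ i * Real.logb 2 (μ i))) :=
  tsum_mul_posTrace_eigenProj hρ _

lemma le_one_of_hasSum {μ : ι → ℝ} (h0 : ∀ i, 0 ≤ μ i) (h1 : HasSum μ 1) (i : ι) : μ i ≤ 1 :=
  le_hasSum h1 i fun j _ => h0 j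

lemma neg_logb_nonneg {l : ℝ} (h0 : 0 ≤ l) (h1 : l ≤ 1) : 0 ≤ -Real.logb 2 l := by
  have := Real.logb_nonpos (b := 2) (by norm_num) h0 h1
  linarith

/-- A single formula for both branches of `condEntropy`. If H(YH) is finite, adding it to the
negated series leaves the terms -μ log μ, which sum to H(XYH). If it is infinite, the series is the
relative entropy with respect to 1 ⊗ ρ_YH. -/
lemma condEntropy_eq_neg_tsum [Fintype X] [Fintype Y] {T : Tens (X × Y) H →L[ℂ] Tens (X × Y) H}
    {b : HilbertBasis ι ℂ (Tens (X × Y) H)} {μ : ι → ℝ} {c : HilbertBasis κ ℂ (Tens Y H)}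
    {ν : κ → ℝ} (hT : IsEigenbasis T b μ) (hR : IsEigenbasis (traceX T) c ν)
    (hμ : ∀ i, 0 ≤ μ i) (hμs : HasSum μ 1)
    (ht : Summable fun p : ι × X × κ =>
      logTerm (μ p.1) (ν p.2.2) * ‖inner ℂ (embed p.2.1 (c p.2.2)) (b p.1)‖ ^ 2) :
    condEntropy T = ((-∑' p : ι × X × κ,
      logTerm (μ p.1) (ν p.2.2) * ‖inner ℂ (embed p.2.1 (c p.2.2)) (b p.1)‖ ^ 2 : ℝ) : EReal) := by
  set w : ι × X × κ → ℝ := fun p => ‖inner ℂ (embed p.2.1 (c p.2.2)) (b p.1)‖ ^ 2 with hw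
  have hw0 : ∀ p, 0 ≤ w p := fun p => sq_nonneg _
  have hwi : ∀ i, HasSum (fun q => w (i, q)) 1 := fun i => by
    have := hasSum_norm_inner_sq (embedBasis X c) (b i)
    simpa only [b.orthonormal.1 i, one_pow, embedBasis_apply] using this
  have hform : ∀ (x : X) (j : κ), HasSum (fun i => μ i * w (i, x, j))
      (inner ℂ (embed x (c j)) (T (embed x (c j)))).re := fun x j => by
    have h := b.hasSum_inner_mul_inner (embed x (c j)) (T (embed x (c j)))
    refine (Complex.hasSum_re h).congr_fun fun i => ?_
    rw [inner_basis_apply hT, ← inner_conj_symm (b i), mul_left_comm, Complex.mul_conj,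
      Complex.normSq_eq_norm_sq]
    norm_cast
  have hνsum : ∀ j, ∑ x : X, (inner ℂ (embed x (c j)) (T (embed x (c j)))).re = ν j := fun j => by
    have h : inner ℂ (c j) (traceX T (c j)) = (ν j : ℂ) := by
      rw [hR j, inner_smul_right, inner_self_eq_norm_sq_to_K, c.orthonormal.1 j]; simp
    rw [traceX, sum_apply, inner_sum] at h
    simp only [ContinuousLinearMap.comp_apply, ContinuousLinearMap.adjoint_inner_right] at h
    rw [← Complex.re_sum, h, Complex.ofReal_re]
  -- The diagonal entry of the marginal at its eigenvector c j is obtained by summing those of T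
  -- over x. This yields the normalisation of ν, the support condition and the series for H(YH).
  have hslice : ∀ j, HasSum (fun q : X × ι => μ q.2 * w (q.2, q.1, j)) (ν j) := fun j => by
    rw [← hνsum j]
    exact hasSum_prod_of_nonneg (fun q => mul_nonneg (hμ _) (hw0 _)) (fun x => hform x j)
      (hasSum_fintype _)
  have hν : ∀ j, 0 ≤ ν j := fun j => (hslice j).nonneg fun q => mul_nonneg (hμ _) (hw0 _)
  let e : κ × X × ι ≃ ι × X × κ :=
    ⟨fun q => (q.2.2, q.2.1, q.1), fun q => (q.2.2, q.2.1, q.1), fun _ => rfl, fun _ => rfl⟩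
  have htot : HasSum (fun p : ι × X × κ => μ p.1 * w p) 1 :=
    hasSum_prod_of_nonneg (fun p => mul_nonneg (hμ _) (hw0 _))
      (fun i => by simpa using (hwi i).mul_left (μ i)) hμs
  have hνs : HasSum ν 1 := (e.hasSum_iff.2 htot).prod_fiberwise hslice
  by_cases hfin : vonNeumannEntropy (traceX T) = ⊤
  · rw [condEntropy, if_neg (not_not.2 hfin)]
    have hσ := isEigenbasis_oneTensor (X := X) hR
    have hσs : HasSum (fun q : X × κ => ν q.2) (∑ _x : X, 1) :=
      hasSum_prod_of_nonneg (fun q => hν _) (fun _ => hνs) (hasSum_fintype _)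
    rw [relEntropy_eq_tsum hT hσ hμ (fun q => hν _) hμs hσs ?_ ?_]
    · simp only [embedBasis_apply]
      rw [EReal.coe_neg]
    · rintro i ⟨x, j⟩ h0 hi
      have h1 : μ i * w (i, x, j) ≤ 0 := by
        have := le_hasSum (hslice j) (x, i) fun q _ => mul_nonneg (hμ _) (hw0 _)
        exact this.trans_eq h0
      have h2 : w (i, x, j) = 0 :=
        le_antisymm (nonpos_of_mul_nonpos_right h1 ((hμ i).lt_of_ne' hi)) (hw0 _)
      rw [embedBasis_apply]
      simpa [hw] using h2
    · simpa only [embedBasis_apply] using ht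
  · rw [condEntropy, if_pos hfin]
    have hh : ∀ {l : ℝ}, 0 ≤ l → l ≤ 1 → 0 ≤ -(l * Real.logb 2 l) := fun {l} h0 h1 => by
      have := mul_nonneg h0 (neg_logb_nonneg h0 h1)
      linarith
    have hν1 := fun j => hh (hν j) (le_one_of_hasSum hν hνs j)
    have hμ1 := fun j => hh (hμ j) (le_one_of_hasSum hμ hμs j)
    have hB : HasSum (fun p : ι × X × κ => -(μ p.1 * Real.logb 2 (ν p.2.2) * w p))
        (vonNeumannEntropy (traceX T)).toReal := by
      refine e.hasSum_iff.1 (hasSum_prod_of_nonneg (g := fun j => -(ν j * Real.logb 2 (ν j)))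
        (fun q => ?_) (fun j => ?_) ?_)
      · have := mul_nonneg (mul_nonneg (hμ q.2.2) (hw0 (e q)))
          (neg_logb_nonneg (hν q.1) (le_one_of_hasSum hν hνs q.1))
        change 0 ≤ -(μ q.2.2 * Real.logb 2 (ν q.1) * w (e q))
        linarith
      · refine ((hslice j).mul_right (Real.logb 2 (ν j))).neg.congr_fun fun q => ?_
        change -(μ q.2 * Real.logb 2 (ν j) * w (q.2, q.1, j)) = _
        ring
      · rw [vonNeumannEntropy_eq_tsum hR] at hfin ⊢
        have := ENNReal.hasSum_toReal hfin
        rw [ENNReal.tsum_toReal_eq (fun _ => ENNReal.ofReal_ne_top)]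
        simpa only [ENNReal.toReal_ofReal (hν1 _)] using this
    change Summable fun p : ι × X × κ => logTerm (μ p.1) (ν p.2.2) * w p at ht
    have hA := hB.sub ht.hasSum
    -- The logarithms of ν cancel, and for fixed i the weights sum to 1.
    have hA2 := hA.prod_fiberwise (g := fun i => -(μ i * Real.logb 2 (μ i))) fun i => by
      have := (hwi i).mul_left (-(μ i * Real.logb 2 (μ i)))
      rw [mul_one] at this
      refine this.congr_fun fun q => ?_
      simp only [logTerm]
      ring
    have hvT : vonNeumannEntropy T = ENNReal.ofReal ((vonNeumannEntropy (traceX T)).toReal -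
        ∑' p : ι × X × κ, logTerm (μ p.1) (ν p.2.2) * w p) := by
      rw [vonNeumannEntropy_eq_tsum hT, ← ENNReal.ofReal_tsum_of_nonneg hμ1 hA2.summable,
        hA2.tsum_eq]
    have hnn := hA2.nonneg hμ1
    rw [hvT, EReal.coe_ennreal_ofReal, max_eq_left hnn]
    conv_lhs => rw [← ENNReal.ofReal_toReal hfin, EReal.coe_ennreal_ofReal,
      max_eq_left ENNReal.toReal_nonneg, ← EReal.coe_sub]
    congr 1
    simp only [ENNReal.toReal_ofReal ENNReal.toReal_nonneg]
    ring

end Tensor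

/-! ### The two marginals of a bipartite pure state and its Schmidt decomposition. -/

section Purification

variable {ι κ K J X Y : Type}
variable {H : Type} [NormedAddCommGroup H] [InnerProductSpace ℂ H] [CompleteSpace H]
variable {H' : Type} [NormedAddCommGroup H'] [InnerProductSpace ℂ H'] [CompleteSpace H']

/-! ### Reduced states of a pure state of `H ⊗ ℓ²(J)` -/

lemma inner_self_ofReal (x : H) : inner ℂ x x = ((‖x‖ ^ 2 : ℝ) : ℂ) := by
  rw [inner_self_eq_norm_sq_to_K]; simp

/-- The conditional vector `(⟨x| ⊗ 1) ψ`. -/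
def coSteer (ψ : Tens J H) (x : H) : Ell J := ampl J (innerSL ℂ x) ψ

@[simp] lemma coSteer_apply (ψ : Tens J H) (x : H) (j : J) : coSteer ψ x j = inner ℂ x (ψ j) := rfl

lemma coSteer_add (ψ : Tens J H) (x y : H) : coSteer ψ (x + y) = coSteer ψ x + coSteer ψ y :=
  tens_ext fun j => by simp

lemma coSteer_smul (ψ : Tens J H) (c : ℂ) (x : H) : coSteer ψ (c • x) = conj c • coSteer ψ x :=
  tens_ext fun j => by
    rw [lp.coeFn_smul, Pi.smul_apply, coSteer_apply, coSteer_apply, inner_smul_left, smul_eq_mul]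

lemma norm_ampl_apply_le (A : H →L[ℂ] H') (ψ : Tens J H) : ‖ampl J A ψ‖ ≤ ‖A‖ * ‖ψ‖ :=
  LinearMap.mkContinuous_norm_le _ (norm_nonneg A) _ |> fun h => (ampl J A).le_of_opNorm_le h ψ

lemma norm_coSteer_le (ψ : Tens J H) (x : H) : ‖coSteer ψ x‖ ≤ ‖x‖ * ‖ψ‖ := by
  have := norm_ampl_apply_le (innerSL ℂ x) ψ
  rwa [innerSL_apply_norm] at this

/-- The conditional vector `(1 ⊗ ⟨a*|) ψ`, with the complex conjugate `a*` of `a`; it is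
antilinear in `a`. -/
def steer (ψ : Tens J H) (a : Ell J) : H :=
  (toDual ℂ H).symm (LinearMap.mkContinuous (σ := RingHom.id ℂ)
    { toFun := fun x : H => inner ℂ (coSteer ψ x) a
      map_add' := fun x y => by rw [coSteer_add, inner_add_left]
      map_smul' := fun c x => by
        rw [coSteer_smul, inner_smul_left, Complex.conj_conj, RingHom.id_apply, smul_eq_mul] }
    (‖ψ‖ * ‖a‖) fun x => by
      refine (norm_inner_le_norm (𝕜 := ℂ) (coSteer ψ x) a).trans ?_
      have := mul_le_mul_of_nonneg_right (norm_coSteer_le ψ x) (norm_nonneg a)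
      linarith)

lemma inner_steer_left (ψ : Tens J H) (a : Ell J) (x : H) :
    inner ℂ (steer ψ a) x = inner ℂ (coSteer ψ x) a := by
  rw [steer, toDual_symm_apply]; rfl

lemma inner_steer_right (ψ : Tens J H) (a : Ell J) (x : H) :
    inner ℂ x (steer ψ a) = inner ℂ a (coSteer ψ x) := by
  rw [← inner_conj_symm, inner_steer_left, inner_conj_symm]

lemma coSteer_ampl (ψ : Tens J H) (A : H →L[ℂ] H') (x : H') :
    coSteer (ampl J A ψ) x = coSteer ψ (ContinuousLinearMap.adjoint A x) :=
  tens_ext fun j => by simp [ContinuousLinearMap.adjoint_inner_left]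

lemma steer_ampl (ψ : Tens J H) (A : H →L[ℂ] H') (a : Ell J) :
    steer (ampl J A ψ) a = A (steer ψ a) := by
  refine ext_inner_right ℂ fun x => ?_
  rw [inner_steer_left, coSteer_ampl, ← inner_steer_left, ContinuousLinearMap.adjoint_inner_right]

lemma norm_steer_le (ψ : Tens J H) (a : Ell J) : ‖steer ψ a‖ ≤ ‖ψ‖ * ‖a‖ := by
  rw [steer, LinearIsometryEquiv.norm_map]
  exact LinearMap.mkContinuous_norm_le _ (by positivity) _

lemma steer_add (ψ : Tens J H) (a b : Ell J) : steer ψ (a + b) = steer ψ a + steer ψ b :=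
  ext_inner_right ℂ fun x => by simp only [inner_add_left, inner_steer_left, inner_add_right]

lemma steer_smul (ψ : Tens J H) (c : ℂ) (a : Ell J) : steer ψ (c • a) = conj c • steer ψ a :=
  ext_inner_right ℂ fun x => by
    simp only [inner_smul_left, inner_steer_left, inner_smul_right, Complex.conj_conj]

lemma hasSum_tens_norm_sq (ψ : Tens J H) : HasSum (fun j => ‖ψ j‖ ^ 2) (‖ψ‖ ^ 2) := by
  have := lp.hasSum_norm (p := 2) (by norm_num) ψ
  simpa using this

lemma hasSum_norm_coSteer_prod (ψ : Tens J H) (b : HilbertBasis ι ℂ H) :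
    HasSum (fun p : ι × J => ‖inner ℂ (b p.1) (ψ p.2)‖ ^ 2) (‖ψ‖ ^ 2) := by
  refine (Equiv.prodComm J ι).hasSum_iff.1 ?_
  exact hasSum_prod_of_nonneg (fun p => sq_nonneg _) (fun j => hasSum_norm_inner_sq b (ψ j))
    (hasSum_tens_norm_sq ψ)

lemma hasSum_norm_coSteer (ψ : Tens J H) (b : HilbertBasis ι ℂ H) :
    HasSum (fun i => ‖coSteer ψ (b i)‖ ^ 2) (‖ψ‖ ^ 2) :=
  (hasSum_norm_coSteer_prod ψ b).prod_fiberwise fun i => hasSum_tens_norm_sq (coSteer ψ (b i))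

lemma hasSum_inner_coSteer (ψ φ : Tens J H) (b : HilbertBasis ι ℂ H) :
    HasSum (fun i => inner ℂ (coSteer ψ (b i)) (coSteer φ (b i))) (inner ℂ ψ φ) := by
  have hs : Summable fun p : ι × J => inner ℂ (ψ p.2) (b p.1) * inner ℂ (b p.1) (φ p.2) := by
    refine Summable.of_norm_bounded ((hasSum_norm_coSteer_prod ψ b).summable.add
      (hasSum_norm_coSteer_prod φ b).summable) fun p => ?_
    rw [norm_mul, norm_inner_symm]
    nlinarith [sq_nonneg (‖inner ℂ (b p.1) (ψ p.2)‖ - ‖inner ℂ (b p.1) (φ p.2)‖),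
      sq_nonneg ‖inner ℂ (b p.1) (ψ p.2)‖, sq_nonneg ‖inner ℂ (b p.1) (φ p.2)‖]
  have h1 := ((Equiv.prodComm J ι).hasSum_iff.2 hs.hasSum).prod_fiberwise
    fun j => b.hasSum_inner_mul_inner (ψ j) (φ j)
  have h2 : HasSum (fun j => inner ℂ (ψ j) (φ j)) (inner ℂ ψ φ) := lp.hasSum_inner ψ φ
  rw [h2.unique h1]
  refine hs.hasSum.prod_fiberwise fun i => ?_
  have h3 : HasSum (fun j => inner ℂ (coSteer ψ (b i) j) (coSteer φ (b i) j))
    (inner ℂ (coSteer ψ (b i)) (coSteer φ (b i))) := lp.hasSum_inner _ _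
  refine h3.congr_fun fun j => ?_
  simp [mul_comm]

/-- Each summand of the partial trace is again of rank one, with norm ‖coSteer φ‖ ‖coSteer ψ‖, which
is summable. So the sum in `traceLeft` converges in norm and is not the default value 0. -/
lemma hasSum_traceLeft (φ ψ : Tens J H) :
    HasSum (fun i => rankOne ℂ (coSteer φ (stdBasis H i)) (coSteer ψ (stdBasis H i)))
      (traceLeft (rankOne ℂ φ ψ)) := by
  have e : ∀ x : H, ampl J (innerSL ℂ x) ∘L rankOne ℂ φ ψ ∘L
      ContinuousLinearMap.adjoint (ampl J (innerSL ℂ x)) =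
      rankOne ℂ (coSteer φ x) (coSteer ψ x) := by
    intro x
    ext1 a
    simp only [ContinuousLinearMap.comp_apply, rankOne_apply, map_smul,
      ContinuousLinearMap.adjoint_inner_right]
    rfl
  simp only [traceLeft, e]
  refine Summable.hasSum (Summable.of_norm_bounded
    ((hasSum_norm_coSteer φ (stdBasis H)).summable.add
      (hasSum_norm_coSteer ψ (stdBasis H)).summable) fun i => ?_)
  rw [norm_rankOne]
  nlinarith [sq_nonneg (‖coSteer φ (stdBasis H i)‖ - ‖coSteer ψ (stdBasis H i)‖),
    sq_nonneg ‖coSteer φ (stdBasis H i)‖, sq_nonneg ‖coSteer ψ (stdBasis H i)‖]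

lemma inner_traceLeft (φ ψ : Tens J H) (a b : Ell J) :
    inner ℂ a (traceLeft (rankOne ℂ φ ψ) b) = inner ℂ (steer ψ b) (steer φ a) := by
  have h := (innerSL ℂ a).hasSum
    ((ContinuousLinearMap.apply ℂ (Ell J) b).hasSum (hasSum_traceLeft φ ψ))
  refine h.unique ?_
  refine ((stdBasis H).hasSum_inner_mul_inner (steer ψ b) (steer φ a)).congr_fun fun i => ?_
  simp [inner_steer_left, inner_steer_right]

/-- The unnormalised state of `ℓ²(J)` conditioned on the effect `A` on `H`. -/
def refOp (ψ : Tens J H) (A : H →L[ℂ] H) : Ell J →L[ℂ] Ell J :=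
  traceLeft (ampl J A ∘L rankOne ℂ ψ ψ)

/-- The bridge between the two tensor factors: spectral statements about the state of ℓ²(J) become
statements about vectors of H. The arguments a and b are exchanged because `steer` is antilinear. -/
lemma inner_refOp (ψ : Tens J H) (A : H →L[ℂ] H) (a b : Ell J) :
    inner ℂ a (refOp ψ A b) = inner ℂ (steer ψ b) (A (steer ψ a)) := by
  rw [refOp, comp_rankOne, inner_traceLeft, steer_ampl]

lemma refOp_sum (ψ : Tens J H) (s : Finset κ) (A : κ → (H →L[ℂ] H)) :
    refOp ψ (∑ k ∈ s, A k) = ∑ k ∈ s, refOp ψ (A k) := by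
  ext1 b
  refine ext_inner_left ℂ fun a => ?_
  simp only [inner_refOp, sum_apply, inner_sum]

lemma refOp_nonneg (ψ : Tens J H) {A : H →L[ℂ] H} (hA : 0 ≤ A) : 0 ≤ refOp ψ A := by
  rw [ContinuousLinearMap.nonneg_iff_isPositive, ContinuousLinearMap.isPositive_iff_complex]
  intro a
  rw [← inner_conj_symm, inner_refOp, inner_apply_self hA, Complex.conj_ofReal]
  exact ⟨by rw [RCLike.re_to_complex, Complex.ofReal_re], by
    rw [RCLike.re_to_complex, Complex.ofReal_re]; positivity⟩

lemma inner_ampl_sqrt (ψ : Tens J H) {A : H →L[ℂ] H} (hA : 0 ≤ A) :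
    inner ℂ ψ (ampl J A ψ) = ((‖ampl J (CFC.sqrt A) ψ‖ ^ 2 : ℝ) : ℂ) := by
  have h := Complex.hasSum_ofReal.2 (hasSum_tens_norm_sq (ampl J (CFC.sqrt A) ψ))
  refine (lp.hasSum_inner ψ (ampl J A ψ)).unique (h.congr_fun fun j => ?_)
  simp only [ampl_apply]
  rw [inner_apply_self hA]

lemma posTrace_refOp (ψ : Tens J H) {A : H →L[ℂ] H} (hA : 0 ≤ A) :
    posTrace (refOp ψ A) = ENNReal.ofReal (‖ampl J (CFC.sqrt A) ψ‖ ^ 2) := by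
  have h := hasSum_norm_coSteer (ampl J (CFC.sqrt A) ψ) (stdBasis H)
  rw [← h.tsum_eq, ENNReal.ofReal_tsum_of_nonneg (fun i => sq_nonneg _) h.summable, posTrace]
  simp_rw [inner_refOp, re_inner_apply_self hA, ← steer_ampl]
  simp_rw [← tsum_norm_inner_sq (stdBasis H) (steer _ _),
    ← tsum_norm_inner_sq (stdBasis (Ell J)) (coSteer _ _), inner_steer_right]
  exact ENNReal.tsum_comm

/-- The reduced state on `H` of the pure state `ψ`. -/
def redState (ψ : Tens J H) : H →L[ℂ] H :=
  LinearMap.mkContinuous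
    { toFun := fun x => steer ψ (coSteer ψ x)
      map_add' := fun x y => by rw [coSteer_add, steer_add]
      map_smul' := fun c x => by
        rw [coSteer_smul, steer_smul, Complex.conj_conj, RingHom.id_apply] }
    (‖ψ‖ * ‖ψ‖) fun x => by
      refine (norm_steer_le _ _).trans ?_
      have := mul_le_mul_of_nonneg_left (norm_coSteer_le ψ x) (norm_nonneg ψ)
      linarith

lemma redState_apply (ψ : Tens J H) (x : H) : redState ψ x = steer ψ (coSteer ψ x) := rfl

lemma inner_redState (ψ : Tens J H) (x y : H) :
    inner ℂ x (redState ψ y) = inner ℂ (coSteer ψ y) (coSteer ψ x) := by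
  rw [redState_apply, inner_steer_right]

lemma redState_nonneg (ψ : Tens J H) : 0 ≤ redState ψ := by
  rw [ContinuousLinearMap.nonneg_iff_isPositive, ContinuousLinearMap.isPositive_iff_complex]
  intro a
  rw [← inner_conj_symm, inner_redState, inner_self_ofReal, Complex.conj_ofReal]
  exact ⟨by rw [RCLike.re_to_complex, Complex.ofReal_re], by
    rw [RCLike.re_to_complex, Complex.ofReal_re]; positivity⟩

lemma posTrace_redState (ψ : Tens J H) : posTrace (redState ψ) = ENNReal.ofReal (‖ψ‖ ^ 2) := by
  have h := hasSum_norm_coSteer ψ (stdBasis H)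
  rw [← h.tsum_eq, ENNReal.ofReal_tsum_of_nonneg (fun i => sq_nonneg _) h.summable, posTrace]
  refine tsum_congr fun i => ?_
  rw [inner_redState, inner_self_ofReal, Complex.ofReal_re]

/-- Both sides are ⟨ψ, (A ⊗ 1) ψ⟩. Hence outcome probabilities depend on ψ only through its reduced
state. -/
lemma trace_refOp (ψ : Tens J H) {A : H →L[ℂ] H} (hA : 0 ≤ A) :
    trace (refOp ψ A) = trace (A ∘L redState ψ) := by
  rw [trace_eq_posTrace (refOp_nonneg ψ hA), posTrace_refOp ψ hA,
    ENNReal.toReal_ofReal (sq_nonneg _), ← inner_ampl_sqrt ψ hA,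
    ← (hasSum_inner_coSteer ψ (ampl J A ψ) (stdBasis H)).tsum_eq, trace]
  refine tsum_congr fun i => ?_
  rw [coSteer_ampl, ContinuousLinearMap.comp_apply, ← ContinuousLinearMap.adjoint_inner_left,
    inner_redState]

lemma coSteer_eq_zero {ψ : Tens J H} {v : HilbertBasis κ ℂ (Ell J)} {x : H}
    (h : ∀ k, inner ℂ (steer ψ (v k)) x = 0) : coSteer ψ x = 0 := by
  have h2 := (hasSum_norm_inner_sq' v (coSteer ψ x)).unique (by
    convert hasSum_zero using 2 with k
    rw [← inner_steer_left, h k]; simp)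
  simpa using h2

/-- Spectral decomposition of `A ρ A†`, with the reduced state `ρ` on `H` of `ψ`, in terms of a
spectral decomposition of the state of `ℓ²(J)` conditioned on the effect `A† A`. -/
lemma exists_isEigenbasis_conj {ψ : Tens J H} (A : H →L[ℂ] H') {v : HilbertBasis κ ℂ (Ell J)}
    {s : κ → ℝ} (hv : IsEigenbasis (refOp ψ (ContinuousLinearMap.adjoint A ∘L A)) v s) :
    ∃ (τ : Type) (c : HilbertBasis ({k // s k ≠ 0} ⊕ τ) ℂ H'),
      IsEigenbasis (A ∘L redState ψ ∘L ContinuousLinearMap.adjoint A) c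
        (Sum.elim (fun k => s k) fun _ => 0) ∧
      ∀ k : {k // s k ≠ 0}, c (.inl k) = ((Real.sqrt (s k))⁻¹ : ℂ) • A (steer ψ (v k)) := by
  classical
  -- By `inner_refOp` the Gram matrix of these vectors is the matrix of the conditional state in its
  -- eigenbasis, so it is diagonal; this is the Schmidt decomposition of (A ⊗ 1)ψ.
  have hip : ∀ k l, inner ℂ (A (steer ψ (v k))) (A (steer ψ (v l))) =
      if k = l then (s k : ℂ) else 0 := by
    intro k l
    have h := inner_refOp ψ (ContinuousLinearMap.adjoint A ∘L A) (v l) (v k)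
    rw [hv k, inner_smul_right, orthonormal_iff_ite.1 v.orthonormal,
      ContinuousLinearMap.comp_apply, ContinuousLinearMap.adjoint_inner_right] at h
    rw [← h]
    by_cases hkl : k = l
    · simp [hkl]
    · simp [hkl, Ne.symm hkl]
  have hs0 : ∀ k, 0 ≤ s k := fun k => by
    have h := hip k k
    rw [if_pos rfl, inner_self_ofReal] at h
    have h' : ‖A (steer ψ (v k))‖ ^ 2 = s k := by exact_mod_cast h
    rw [← h']; positivity
  have hzero : ∀ k, s k = 0 → A (steer ψ (v k)) = 0 := fun k hk => by
    have h := hip k k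
    rw [if_pos rfl, hk] at h
    exact inner_self_eq_zero.1 (h.trans Complex.ofReal_zero)
  have hon : Orthonormal ℂ fun k : {k // s k ≠ 0} =>
      ((Real.sqrt (s k))⁻¹ : ℂ) • A (steer ψ (v k)) := by
    rw [orthonormal_iff_ite]
    intro k l
    rw [inner_smul_left, inner_smul_right, hip]
    by_cases hkl : k = l
    · subst hkl
      rw [if_pos rfl, if_pos rfl]
      have hne : (Real.sqrt (s k) : ℂ) ≠ 0 := by
        exact_mod_cast (Real.sqrt_ne_zero'.2 ((hs0 k).lt_of_ne' k.2))
      have hsq : (s k : ℂ) = Real.sqrt (s k) * Real.sqrt (s k) := by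
        exact_mod_cast (Real.mul_self_sqrt (hs0 k)).symm
      rw [map_inv₀, Complex.conj_ofReal, hsq]
      field_simp
    · have : (k : κ) ≠ l := fun h => hkl (Subtype.ext h)
      simp [hkl, this]
  obtain ⟨τ, c, hc⟩ := exists_hilbertBasis_sum hon
  refine ⟨τ, c, ?_, hc⟩
  have heig : ∀ k, (A ∘L redState ψ ∘L ContinuousLinearMap.adjoint A) (A (steer ψ (v k))) =
      (s k : ℂ) • A (steer ψ (v k)) := by
    intro k
    refine ext_inner_left ℂ fun x => ?_
    simp only [ContinuousLinearMap.comp_apply]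
    rw [← ContinuousLinearMap.adjoint_inner_left, inner_redState, ← inner_steer_left,
      ← ContinuousLinearMap.comp_apply, ← inner_refOp, inner_basis_apply hv, inner_smul_right,
      ← inner_steer_right, ContinuousLinearMap.adjoint_inner_left]
  rintro (k | t)
  · rw [hc, map_smul, heig, smul_comm]
    rfl
  -- A completing vector is orthogonal to all A (steer ψ (v k)), which are zero when s k = 0. Then
  -- `coSteer` vanishes on its image under A†, and the vector lies in the kernel.
  · have horth : ∀ k, inner ℂ (steer ψ (v k)) (ContinuousLinearMap.adjoint A (c (.inr t))) = 0 := by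
      intro k
      rw [ContinuousLinearMap.adjoint_inner_right]
      by_cases hk : s k = 0
      · rw [hzero k hk, inner_zero_left]
      · have h := c.orthonormal.2 (Sum.inl_ne_inr : Sum.inl (⟨k, hk⟩ : {k // s k ≠ 0}) ≠ .inr t)
        beta_reduce at h
        rw [hc, inner_smul_left] at h
        refine (mul_eq_zero.1 h).resolve_left ?_
        have hne : (Real.sqrt (s k) : ℂ) ≠ 0 := by
          exact_mod_cast (Real.sqrt_ne_zero'.2 ((hs0 k).lt_of_ne' hk))
        simpa using hne
    simp only [ContinuousLinearMap.comp_apply, redState_apply, coSteer_eq_zero horth]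
    have h0 : steer ψ 0 = 0 := by simpa using norm_steer_le ψ 0
    simp [h0]

end Purification

/-! ### Duality between the relative entropies on the two sides of a pure state. -/

section EntropyIdentity

variable {ι κ K J X Y Z : Type}
variable {H : Type} [NormedAddCommGroup H] [InnerProductSpace ℂ H] [CompleteSpace H]

/-! ### The entropy identity for pure states -/

lemma hasSum_sigma_fintype [Fintype K] {ι : K → Type} {F : (Σ k, ι k) → ℝ} {g : K → ℝ}
    (h : ∀ k, HasSum (fun i => F ⟨k, i⟩) (g k)) : HasSum F (∑ k, g k) := by
  have hs : Summable F := by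
    rw [← summable_abs_iff, summable_sigma_of_nonneg fun _ => abs_nonneg _]
    exact ⟨fun k => (h k).summable.abs, (hasSum_fintype _).summable⟩
  exact (hasSum_fintype g).sigma_of_hasSum h hs

lemma hasSum_elim_zero {μ : ι → ℝ} {a : ℝ} (h : HasSum μ a) (κ : Type) :
    HasSum (Sum.elim (fun i : {i // μ i ≠ 0} => μ i) fun _ : κ => 0) a := by
  refine (Function.Injective.hasSum_iff Sum.inl_injective ?_).1 ?_
  · rintro (i | k) hi
    · exact absurd ⟨i, rfl⟩ hi
    · rfl
  · exact (hasSum_subtype_iff_of_support_subset (s := {i | μ i ≠ 0}) fun i hi => hi).2 h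

/-- `logTerm_klein` for (l, m) bounds the term from below; for (m, l), multiplied by l / m, it
bounds it from above. After multiplication by overlaps, both summands of the bound have finite sums.
-/
lemma abs_logTerm_le {l m : ℝ} (hl : 0 < l) (hm : 0 < m) :
    |logTerm l m| ≤ (m + l * (l / m)) / Real.log 2 := by
  have h2 : 0 < Real.log 2 := Real.log_pos (by norm_num)
  have h1 := logTerm_klein hl.le hm
  have h3 := mul_nonneg (div_pos hl hm).le (logTerm_klein hm.le hl)
  have e : l / m * (logTerm m l + (l - m) / Real.log 2) =
      -logTerm l m + (l * (l / m) - l) / Real.log 2 := by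
    simp only [logTerm]; field_simp; ring
  rw [e] at h3
  have e1 : (m + l * (l / m)) / Real.log 2 =
      (m - l) / Real.log 2 + (l + l * (l / m)) / Real.log 2 := by ring
  have e2 : (m + l * (l / m)) / Real.log 2 =
      (l * (l / m) - l) / Real.log 2 + (l + m) / Real.log 2 := by ring
  have p1 : 0 ≤ (l + l * (l / m)) / Real.log 2 := by positivity
  have p2 : 0 ≤ (l + m) / Real.log 2 := by positivity
  rw [abs_le]
  constructor <;> linarith

lemma adjoint_comp_self_nonneg (A : H →L[ℂ] H) : 0 ≤ ContinuousLinearMap.adjoint A ∘L A :=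
  (ContinuousLinearMap.nonneg_iff_isPositive _).2 (ContinuousLinearMap.isPositive_adjoint_comp_self A)

lemma posTrace_refOp_ne_top (ψ : Tens J H) {A : H →L[ℂ] H} (hA : 0 ≤ A) :
    posTrace (refOp ψ A) ≠ ⊤ := by
  rw [posTrace_refOp ψ hA]; exact ENNReal.ofReal_ne_top

lemma posTrace_refOp_eq_re (ψ : Tens J H) {A : H →L[ℂ] H} (hA : 0 ≤ A) :
    posTrace (refOp ψ A) = ENNReal.ofReal (inner ℂ ψ (ampl J A ψ)).re := by
  rw [posTrace_refOp ψ hA, inner_ampl_sqrt ψ hA, Complex.ofReal_re]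

lemma id_nonneg : 0 ≤ ContinuousLinearMap.id ℂ H :=
  (ContinuousLinearMap.nonneg_iff_isPositive _).2 ContinuousLinearMap.isPositive_id

lemma posTrace_refOp_id (ψ : Tens J H) :
    posTrace (refOp ψ (ContinuousLinearMap.id ℂ H)) = ENNReal.ofReal (‖ψ‖ ^ 2) := by
  rw [posTrace_refOp_eq_re ψ id_nonneg]
  have e : ampl J (ContinuousLinearMap.id ℂ H) ψ = ψ := tens_ext fun j => rfl
  rw [e, inner_self_ofReal, Complex.ofReal_re]

lemma steer_eq_zero {ψ : Tens J H} {f : HilbertBasis ι ℂ (Ell J)} {l : ι → ℝ}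
    (hf : IsEigenbasis (refOp ψ (ContinuousLinearMap.id ℂ H)) f l) {i : ι} (hi : l i = 0) :
    steer ψ (f i) = 0 := by
  have h := inner_refOp ψ (ContinuousLinearMap.id ℂ H) (f i) (f i)
  rw [hf i, hi, Complex.ofReal_zero, zero_smul, inner_zero_right] at h
  exact inner_self_eq_zero.1 h.symm

lemma inner_steer_conj {ψ : Tens J H} {A : H →L[ℂ] H} {v : HilbertBasis κ ℂ (Ell J)} {s : κ → ℝ}
    (hv : IsEigenbasis (refOp ψ (ContinuousLinearMap.adjoint A ∘L A)) v s) (k : κ) (a : Ell J) :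
    inner ℂ (A (steer ψ (v k))) (A (steer ψ a)) = (s k : ℂ) * inner ℂ a (v k) := by
  rw [← inner_smul_right, ← hv k, inner_refOp, ContinuousLinearMap.comp_apply,
    ContinuousLinearMap.adjoint_inner_right]

/-- The support of a conditional state lies in that of the reduced state: ψ steers the kernel of the
latter to zero, whatever effect is applied afterwards. -/
lemma inner_eq_zero_of_eigenvalue_eq_zero {ψ : Tens J H} {f : HilbertBasis ι ℂ (Ell J)}
    {l : ι → ℝ} (hf : IsEigenbasis (refOp ψ (ContinuousLinearMap.id ℂ H)) f l) {A : H →L[ℂ] H}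
    {v : HilbertBasis κ ℂ (Ell J)} {s : κ → ℝ}
    (hv : IsEigenbasis (refOp ψ (ContinuousLinearMap.adjoint A ∘L A)) v s) {i : ι} {k : κ}
    (hi : l i = 0) (hk : s k ≠ 0) : inner ℂ (f i) (v k) = 0 := by
  have h := inner_steer_conj hv k (f i)
  rw [steer_eq_zero hf hi, map_zero, inner_zero_right] at h
  exact (mul_eq_zero.1 h.symm).resolve_left (by exact_mod_cast hk)

/-- For an isometry `G = ∑ z, K z ⊗ |z⟩` and the reduced state `ρ` of a pure state, the relative
entropy of `G ρ G†` with respect to its pinching is minus the relative entropy of the conditional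
states of the purifying system with respect to its reduced state. -/
lemma relEntropy_conj_blockDiag [Fintype Z] {ψ : Tens J H} (hψ : ‖ψ‖ = 1) {A : Z → (H →L[ℂ] H)}
    {G : H →L[ℂ] Tens Z H} (hGA : ∀ x z, G x z = A z x)
    (hG : ContinuousLinearMap.adjoint G ∘L G = ContinuousLinearMap.id ℂ H)
    {f : HilbertBasis ι ℂ (Ell J)} {l : ι → ℝ}
    (hf : IsEigenbasis (refOp ψ (ContinuousLinearMap.id ℂ H)) f l)
    {κ : Z → Type} {v : ∀ z, HilbertBasis (κ z) ℂ (Ell J)} {s : ∀ z, κ z → ℝ}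
    (hv : ∀ z, IsEigenbasis (refOp ψ (ContinuousLinearMap.adjoint (A z) ∘L A z)) (v z) (s z)) :
    (∀ z, Summable fun p : κ z × ι =>
      logTerm (s z p.1) (l p.2) * ‖inner ℂ (f p.2) (v z p.1)‖ ^ 2) ∧
    relEntropy (G ∘L redState ψ ∘L ContinuousLinearMap.adjoint G)
      (blockDiag fun z => A z ∘L redState ψ ∘L ContinuousLinearMap.adjoint (A z)) =
      ((-∑ z, ∑' p : κ z × ι,
        logTerm (s z p.1) (l p.2) * ‖inner ℂ (f p.2) (v z p.1)‖ ^ 2 : ℝ) : EReal) := by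
  have hl0 := eigenvalue_nonneg (refOp_nonneg ψ id_nonneg) hf
  have hs0 := fun z => eigenvalue_nonneg (refOp_nonneg ψ (adjoint_comp_self_nonneg (A z))) (hv z)
  have hl1 : HasSum l 1 := by
    have h := hasSum_eigenvalues (refOp_nonneg ψ id_nonneg) hf (posTrace_refOp_ne_top ψ id_nonneg)
    simpa [posTrace_refOp_id, hψ] using h
  have hs1 := fun z => hasSum_eigenvalues (refOp_nonneg ψ (adjoint_comp_self_nonneg (A z))) (hv z)
    (posTrace_refOp_ne_top ψ (adjoint_comp_self_nonneg (A z)))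
  -- As G is an isometry, conditioning on G† G is the same as not conditioning, so f also produces
  -- the eigenvectors of GρG†.
  obtain ⟨τ, b, hb, hbl⟩ := exists_isEigenbasis_conj G (hG.symm ▸ hf)
  choose τ' c hc hcl using fun z => exists_isEigenbasis_conj (A z) (hv z)
  set μ : {i // l i ≠ 0} ⊕ τ → ℝ := Sum.elim (fun i => l i) fun _ => 0 with hμ
  set ν : ∀ z, {k // s z k ≠ 0} ⊕ τ' z → ℝ := fun z => Sum.elim (fun k => s z k) fun _ => 0 with hν
  have hμ0 : ∀ a, 0 ≤ μ a := by rintro (i | t) <;> simp [hμ, hl0]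
  have hν0 : ∀ z q, 0 ≤ ν z q := by rintro z (k | t) <;> simp [hν, hs0]
  have hbz : ∀ z i, b (.inl i) z = ((Real.sqrt (l i))⁻¹ : ℂ) • A z (steer ψ (f i)) := by
    intro z i
    rw [hbl, lp.coeFn_smul, Pi.smul_apply, hGA]
  -- The overlap ⟨A v, A f⟩ has modulus s |⟨f, v⟩| by `inner_steer_conj`, and the normalisations
  -- contribute 1 / √(s l).
  have hov : ∀ z (i : {i // l i ≠ 0}) (k : {k // s z k ≠ 0}),
      ‖inner ℂ (c z (.inl k)) (b (.inl i) z)‖ ^ 2 = s z k / l i * ‖inner ℂ (f i) (v z k)‖ ^ 2 := by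
    intro z i k
    have hk := (hs0 z k).lt_of_ne' k.2
    have hi := (hl0 i).lt_of_ne' i.2
    rw [hbz, hcl, inner_smul_left, inner_smul_right, inner_steer_conj (hv z), map_inv₀,
      Complex.conj_ofReal, norm_mul, norm_mul, norm_mul, norm_inv, norm_inv, Complex.norm_real,
      Complex.norm_real, Complex.norm_real, Real.norm_of_nonneg (Real.sqrt_nonneg _),
      Real.norm_of_nonneg (Real.sqrt_nonneg _), Real.norm_of_nonneg hk.le, mul_pow, mul_pow,
      mul_pow, inv_pow, inv_pow, Real.sq_sqrt hk.le, Real.sq_sqrt hi.le]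
    field_simp
  -- For a null vector c, 0 = ⟨c, A ρ A† c⟩ = ‖coSteer ψ (A† c)‖², so c is orthogonal to every A
  -- (steer ψ a).
  have hsupp : ∀ z a q, ν z q = 0 → μ a ≠ 0 → inner ℂ (c z q) (b a z) = 0 := by
    rintro z (i | t) q hq ha
    · have h1 := hc z q
      have h2 : inner ℂ (c z q) ((A z ∘L redState ψ ∘L ContinuousLinearMap.adjoint (A z)) (c z q)) =
          0 := by
        rw [h1]
        change inner ℂ (c z q) ((ν z q : ℂ) • c z q) = 0
        rw [hq, Complex.ofReal_zero, zero_smul, inner_zero_right]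
      rw [ContinuousLinearMap.comp_apply, ← ContinuousLinearMap.adjoint_inner_left,
        ContinuousLinearMap.comp_apply, inner_redState] at h2
      rw [hbz, inner_smul_right, ← ContinuousLinearMap.adjoint_inner_left, inner_steer_right,
        inner_self_eq_zero.1 h2, inner_zero_right, mul_zero]
    · exact absurd rfl ha
  have hket : ∀ a z q, inner ℂ (tensBasis c ⟨z, q⟩) (b a) = inner ℂ (c z q) (b a z) := by
    intro a z q
    rw [tensBasis_apply, inner_ket_left]
  let t : ∀ z, κ z × ι → ℝ := fun z p =>
    logTerm (s z p.1) (l p.2) * ‖inner ℂ (f p.2) (v z p.1)‖ ^ 2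
  let t' : ∀ z, ({i // l i ≠ 0} ⊕ τ) × ({k // s z k ≠ 0} ⊕ τ' z) → ℝ := fun z p =>
    logTerm (μ p.1) (ν z p.2) * ‖inner ℂ (c z p.2) (b p.1 z)‖ ^ 2
  let e : ∀ z, {k // s z k ≠ 0} × {i // l i ≠ 0} → κ z × ι := fun z d => (d.1, d.2)
  let e' : ∀ z, {k // s z k ≠ 0} × {i // l i ≠ 0} →
    ({i // l i ≠ 0} ⊕ τ) × ({k // s z k ≠ 0} ⊕ τ' z) := fun z d => (.inl d.2, .inl d.1)
  have he : ∀ z, Function.Injective (e z) := fun z d d' h => by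
    simp only [e, Prod.mk.injEq] at h
    exact Prod.ext (Subtype.ext h.1) (Subtype.ext h.2)
  have he' : ∀ z, Function.Injective (e' z) := fun z d d' h => by
    simp only [e', Prod.mk.injEq, Sum.inl.injEq] at h
    exact Prod.ext h.2 h.1
  have htz : ∀ z p, p ∉ Set.range (e z) → t z p = 0 := by
    rintro z ⟨k, i⟩ hp
    by_cases hk : s z k = 0
    · simp [t, hk]
    by_cases hi : l i = 0
    · simp [t, inner_eq_zero_of_eigenvalue_eq_zero hf (hv z) hi hk]
    · exact absurd ⟨(⟨k, hk⟩, ⟨i, hi⟩), rfl⟩ hp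
  have htz' : ∀ z p, p ∉ Set.range (e' z) → t' z p = 0 := by
    rintro z ⟨i | a, k | q⟩ hp
    · exact absurd ⟨(k, i), rfl⟩ hp
    · have := hsupp z (.inl i) (.inr q) rfl i.2
      simp [t', this]
    · simp [t', hμ]
    · simp [t', hμ]
  -- The heart of the identity: the factor s / l of the overlap turns l log l - l log s into -(s log
  -- s - s log l).
  have htt : ∀ z, t' z ∘ e' z = fun d => -(t z ∘ e z) d := by
    intro z
    funext ⟨k, i⟩
    have hk := (hs0 z k).lt_of_ne' k.2
    have hi := (hl0 i).lt_of_ne' i.2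
    simp only [Function.comp, t, t', e, e', hov, hμ, hν, Sum.elim_inl, logTerm]
    field_simp
    ring
  have hg : ∀ z, Summable fun p : κ z × ι => l p.2 * ‖inner ℂ (f p.2) (v z p.1)‖ ^ 2 := by
    intro z
    have : HasSum (fun p : ι × κ z => l p.1 * ‖inner ℂ (f p.1) (v z p.2)‖ ^ 2) 1 := by
      refine hasSum_prod_of_nonneg (fun p => mul_nonneg (hl0 _) (sq_nonneg _)) (fun i => ?_) hl1
      simpa [f.orthonormal.1 i] using (hasSum_norm_inner_sq' (v z) (f i)).mul_left (l i)
    exact ((Equiv.prodComm (κ z) ι).hasSum_iff.2 this).summable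
  have hg' : ∀ z, Summable fun p : ({i // l i ≠ 0} ⊕ τ) × ({k // s z k ≠ 0} ⊕ τ' z) =>
      ν z p.2 * ‖inner ℂ (c z p.2) (b p.1 z)‖ ^ 2 := by
    intro z
    have h : HasSum (fun p : ({k // s z k ≠ 0} ⊕ τ' z) × ({i // l i ≠ 0} ⊕ τ) =>
        ν z p.1 * ‖inner ℂ (c z p.1) (b p.2 z)‖ ^ 2)
        (posTrace (refOp ψ (ContinuousLinearMap.adjoint (A z) ∘L A z))).toReal := by
      refine hasSum_prod_of_nonneg (fun p => mul_nonneg (hν0 z _) (sq_nonneg _)) (fun q => ?_)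
        (hasSum_elim_zero (hs1 z) (τ' z))
      have := (hasSum_norm_inner_sq' b (tensBasis c ⟨z, q⟩)).mul_left (ν z q)
      simpa only [hket, (tensBasis c).orthonormal.1, one_pow, mul_one] using this
    exact ((Equiv.prodComm _ _).hasSum_iff.2 h).summable
  have hts : ∀ z, Summable (t z) := by
    intro z
    rw [← (he z).summable_iff (htz z)]
    -- In the bound of `abs_logTerm_le`, l |⟨f, v⟩|² is summable by `hg`, while (s² / l) |⟨f, v⟩|² =
    -- s |⟨c, b_z⟩|² is summable by `hg'`.
    refine Summable.of_norm_bounded ((((hg z).comp_injective (he z)).add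
      ((hg' z).comp_injective (he' z))).div_const (Real.log 2)) ?_
    rintro ⟨k, i⟩
    have hk := (hs0 z k).lt_of_ne' k.2
    have hi := (hl0 i).lt_of_ne' i.2
    simp only [Function.comp, t, e, e', hov, hν, Sum.elim_inl, norm_mul, norm_pow, norm_norm]
    refine (mul_le_mul_of_nonneg_right (abs_logTerm_le hk hi) (sq_nonneg _)).trans (le_of_eq ?_)
    ring
  have hts' : ∀ z, HasSum (t' z) (-∑' p, t z p) := by
    intro z
    rw [← (he' z).hasSum_iff (htz' z), htt]
    exact (((he z).hasSum_iff (htz z)).2 (hts z).hasSum).neg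
  refine ⟨hts, ?_⟩
  have hc' := isEigenbasis_blockDiag hc
  let E : (Σ z, ({i // l i ≠ 0} ⊕ τ) × ({k // s z k ≠ 0} ⊕ τ' z)) ≃
      ({i // l i ≠ 0} ⊕ τ) × (Σ z, {k // s z k ≠ 0} ⊕ τ' z) :=
    ⟨fun p => (p.2.1, ⟨p.1, p.2.2⟩), fun p => ⟨p.2.1, (p.1, p.2.2)⟩, fun _ => rfl, fun _ => rfl⟩
  have hall : HasSum (fun p : ({i // l i ≠ 0} ⊕ τ) × (Σ z, {k // s z k ≠ 0} ⊕ τ' z) =>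
      logTerm (μ p.1) (ν p.2.1 p.2.2) * ‖inner ℂ (tensBasis c p.2) (b p.1)‖ ^ 2)
      (∑ z, -∑' p, t z p) := by
    refine E.hasSum_iff.1 (hasSum_sigma_fintype fun z => ?_)
    refine (hts' z).congr_fun fun p => ?_
    simp only [Function.comp, E, Equiv.coe_fn_mk, hket]
    rfl
  rw [relEntropy_eq_tsum hb hc' hμ0 (fun q => hν0 q.1 q.2) (hasSum_elim_zero hl1 τ)
    (hasSum_sigma_fintype fun z => hasSum_elim_zero (hs1 z) (τ' z)) ?_ hall.summable]
  · rw [hall.tsum_eq, Finset.sum_neg_distrib]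
  · rintro a ⟨z, q⟩ hq ha
    rw [hket]
    exact hsupp z a q hq ha

/-- The conditional entropy of a state that is classical on `X` and `Y`, in terms of the relative
entropies of the conditional states. -/
lemma condEntropy_blockDiag [Fintype X] [Fintype Y] {B : X × Y → (H →L[ℂ] H)}
    (hB : ∀ k, 0 ≤ B k) (htr : ∑ k, posTrace (B k) = 1) {f : HilbertBasis ι ℂ H} {ν : Y → ι → ℝ}
    (hν : ∀ y, IsEigenbasis (∑ x, B (x, y)) f (ν y)) {τ : X × Y → ℝ}
    (h : ∀ k, ∃ (κ : Type) (v : HilbertBasis κ ℂ H) (s : κ → ℝ), IsEigenbasis (B k) v s ∧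
      HasSum (fun p : κ × ι => logTerm (s p.1) (ν k.2 p.2) * ‖inner ℂ (f p.2) (v p.1)‖ ^ 2) (τ k)) :
    condEntropy (blockDiag B) = ((-∑ k, τ k : ℝ) : EReal) := by
  classical
  choose κ v s hv hτ using h
  have hne : ∀ k, posTrace (B k) ≠ ⊤ := fun k h => by
    have := Finset.single_le_sum (f := fun k => posTrace (B k)) (fun _ _ => zero_le)
      (Finset.mem_univ k)
    rw [htr] at this
    simp [h] at this
  have hs1 : HasSum (fun i : Σ k, κ k => s i.1 i.2) 1 := by
    have h1 := hasSum_sigma_fintype (F := fun i : Σ k, κ k => s i.1 i.2)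
      fun k => hasSum_eigenvalues (hB k) (hv k) (hne k)
    rwa [← ENNReal.toReal_sum fun k _ => hne k, htr, ENNReal.toReal_one] at h1
  have hR : IsEigenbasis (traceX (blockDiag B)) (tensBasis fun _ : Y => f)
      fun i => ν i.1 i.2 := by
    rw [traceX_blockDiag]
    exact isEigenbasis_blockDiag hν
  have hT := isEigenbasis_blockDiag hv
  let e : (Σ k, κ k × ι) → (Σ k, κ k) × X × (Σ _ : Y, ι) := fun q =>
    (⟨q.1, q.2.1⟩, q.1.1, ⟨q.1.2, q.2.2⟩)
  have he : Function.Injective e := by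
    rintro ⟨k, p, i⟩ ⟨k', p', i'⟩ h
    simp only [e, Prod.mk.injEq, Sigma.mk.injEq] at h
    obtain ⟨⟨rfl, h1⟩, -, -, h2⟩ := h
    rw [eq_of_heq h1, eq_of_heq h2]
  have hin : ∀ (k : X × Y) (p : κ k) (x : X) (y : Y) (i : ι),
      inner ℂ (embed x (ket y (f i))) (ket k (v k p)) =
      if k = (x, y) then inner ℂ (f i) (v k p) else 0 := by
    rintro ⟨x', y'⟩ p x y i
    rw [inner_ket_right, embed_apply, ket_apply]
    by_cases h1 : x' = x <;> by_cases h2 : y' = y <;> simp [h1, h2]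
  have hsum : HasSum (fun p : (Σ k, κ k) × X × (Σ _ : Y, ι) =>
      logTerm (s p.1.1 p.1.2) (ν p.2.2.1 p.2.2.2) *
      ‖inner ℂ (embed p.2.1 ((tensBasis fun _ : Y => f) p.2.2)) (tensBasis v p.1)‖ ^ 2)
      (∑ k, τ k) := by
    -- Eigenvectors from different blocks are orthogonal, so only the indices in the range of e
    -- contribute.
    refine (he.hasSum_iff ?_).1 (hasSum_sigma_fintype fun k => ?_)
    · rintro ⟨⟨k, p⟩, x, ⟨y, i⟩⟩ hp
      simp only [tensBasis_apply, hin]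
      rw [if_neg]
      · simp
      · rintro rfl
        exact hp ⟨⟨(x, y), p, i⟩, rfl⟩
    · refine (hτ k).congr_fun fun p => ?_
      simp only [Function.comp, e, tensBasis_apply, hin, if_true]
  rw [condEntropy_eq_neg_tsum hT hR (fun i => eigenvalue_nonneg (hB i.1) (hv i.1) i.2) hs1
    hsum.summable, hsum.tsum_eq]

end EntropyIdentity

/-! ### Completeness of the heterodyne measurements. -/

section Heterodyne

variable {ι : Type}

/-! ### Resolutions of the identity -/

lemma heterodyne_nonneg (N : ℕ∞) (S : Set ℂ) : 0 ≤ heterodyne N S := by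
  rw [ContinuousLinearMap.nonneg_iff_isPositive, ContinuousLinearMap.isPositive_iff_complex]
  have h : ∀ ψ, inner ℂ ψ (heterodyne N S ψ) =
      ((Real.pi⁻¹ * ∫ y in S, ‖inner ℂ (coherent N y) ψ‖ ^ 2 : ℝ) : ℂ) := by
    intro ψ
    rw [inner_heterodyne]
    push_cast
    rw [← integral_complex_ofReal]
    congr 2
    funext y
    rw [← inner_conj_symm ψ, mul_comm, Complex.mul_conj, Complex.normSq_eq_norm_sq]
  intro ψ
  rw [← inner_conj_symm, h, Complex.conj_ofReal]
  refine ⟨by rw [RCLike.re_to_complex, Complex.ofReal_re], ?_⟩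
  rw [RCLike.re_to_complex, Complex.ofReal_re]
  exact mul_nonneg (inv_nonneg.2 Real.pi_pos.le) (integral_nonneg fun y => sq_nonneg _)

lemma hasSum_ket {J H : Type} [NormedAddCommGroup H] [InnerProductSpace ℂ H] [CompleteSpace H]
    (ψ : Tens J H) : HasSum (fun j => ket j (ψ j)) ψ := by
  classical
  exact lp.hasSum_single (by norm_num) ψ

lemma inner_coherent_ket (N : ℕ∞) (k : Fock N) (y : ℂ) :
    inner ℂ (coherent N y) (ket k (1 : ℂ)) = conj (coherentAmp y k) := by
  rw [inner_ket_right]; simp [coherent]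

/-- The matrix elements between number states are the orthogonality integrals of the amplitudes,
which hold for each pair of photon numbers and hence with any cutoff. -/
lemma heterodyne_univ (N : ℕ∞) : heterodyne N Set.univ = ContinuousLinearMap.id ℂ (HB N) := by
  classical
  have hbasis : ∀ k l : Fock N, inner ℂ (ket k (1 : ℂ)) (heterodyne N Set.univ (ket l (1 : ℂ))) =
      inner ℂ (ket k (1 : ℂ)) (ket l (1 : ℂ)) := by
    intro k l
    rw [inner_heterodyne]
    have e : ∀ y : ℂ, inner ℂ (ket k (1 : ℂ)) (coherent N y) *
        inner ℂ (coherent N y) (ket l (1 : ℂ)) =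
        conj (coherentAmp y l) * coherentAmp y k := by
      intro y
      rw [inner_coherent_ket, ← inner_conj_symm, inner_coherent_ket, Complex.conj_conj, mul_comm]
    simp only [e, setIntegral_univ, integral_conj_coherentAmp_mul]
    rw [inner_ket_left, ket_apply]
    have hpi : (Real.pi : ℂ) ≠ 0 := by exact_mod_cast Real.pi_ne_zero
    by_cases h : k = l
    · subst h; simp [hpi]
    · have : (l : ℕ) ≠ k := fun h' => h (Subtype.ext h'.symm)
      simp [h, this]
  have hket : ∀ l : Fock N, heterodyne N Set.univ (ket l (1 : ℂ)) = ket l (1 : ℂ) := by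
    intro l
    refine tens_ext fun k => ?_
    have := hbasis k l
    rw [inner_ket_left, inner_ket_left] at this
    simpa using this
  ext1 ψ
  have h1 : HasSum (fun k => ket k (ψ k)) ψ := hasSum_ket ψ
  have h2 := (heterodyne N Set.univ).hasSum h1
  refine h2.unique (h1.congr_fun fun k => ?_)
  have e : ket k (ψ k) = ψ k • ket k (1 : ℂ) := by rw [← map_smul, smul_eq_mul, mul_one]
  rw [e, map_smul, hket]

/-- A partition up to null sets is all that can be used: the sectors all contain the origin. -/
lemma sum_heterodyne [Fintype ι] (N : ℕ∞) {S S' : ι → Set ℂ} (hSS : ∀ i, S i =ᵐ[volume] S' i)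
    (hm : ∀ i, MeasurableSet (S' i)) (hu : ∀ y, ∃! i, y ∈ S' i) :
    ∑ i, heterodyne N (S i) = ContinuousLinearMap.id ℂ (HB N) := by
  rw [← heterodyne_univ]
  ext1 ψ
  refine ext_inner_left ℂ fun φ => ?_
  rw [sum_apply, inner_sum]
  simp only [inner_heterodyne]
  rw [← Finset.mul_sum]
  congr 1
  have hU : ⋃ i, S' i = Set.univ := Set.eq_univ_of_forall fun y =>
    Set.mem_iUnion.2 (hu y).exists
  rw [← hU, integral_iUnion_fintype hm (fun i j hij => Set.disjoint_left.2 fun y hi hj =>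
    hij ((hu y).unique hi hj)) fun i => integrable_heterodyneForm N _ φ ψ]
  exact Finset.sum_congr rfl fun i _ => setIntegral_congr_set (hSS i)

/-- The values of the argument in the angular sectors. -/
def angles : ℕ → Set ℝ
  | 0 => Set.Ico (-(Real.pi / 4)) (Real.pi / 4)
  | 1 => Set.Ico (Real.pi / 4) (3 * Real.pi / 4)
  | 2 => Set.Ici (3 * Real.pi / 4) ∪ Set.Iio (-(3 * Real.pi / 4))
  | _ => Set.Ico (-(3 * Real.pi / 4)) (-(Real.pi / 4))

lemma measurableSet_angles (j : ℕ) : MeasurableSet (angles j) := by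
  rcases j with _ | _ | _ | j
  · exact measurableSet_Ico
  · exact measurableSet_Ico
  · exact measurableSet_Ici.union measurableSet_Iio
  · exact measurableSet_Ico

/-- The set for j = 2 is unbounded on both sides, so the four sets partition all of ℝ and not just
the range (-π, π] of the argument. -/
lemma existsUnique_angles (t : ℝ) : ∃! j : Fin 4, t ∈ angles j := by
  have hpi := Real.pi_pos
  have h : ∀ j : Fin 4, t ∈ angles j ↔ j =
      if t < -(3 * Real.pi / 4) then 2 else if t < -(Real.pi / 4) then 3 else
      if t < Real.pi / 4 then 0 else if t < 3 * Real.pi / 4 then 1 else 2 := by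
    intro j
    fin_cases j <;> simp only [angles, Set.mem_Ico, Set.mem_Ici, Set.mem_Iio, Set.mem_union] <;>
      split_ifs <;> simp <;> first | constructor <;> linarith | (right; linarith) | grind
  exact ⟨_, (h _).2 rfl, fun j hj => (h j).1 hj⟩

/-- The angles of a sector run up to 7π/4, beyond the branch cut of the argument; those exceeding π
are shifted by 2π. For j = 2 the cut divides the sector, which accounts for the union in `angles`.
-/
lemma mem_sector_iff {j : ℕ} (hj : j < 4) {y : ℂ} (hy : y ≠ 0) :
    y ∈ sector j ↔ y.arg ∈ angles j := by
  have hpi := Real.pi_pos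
  have harg : ∀ r θ : ℝ, 0 < r → -Real.pi < θ → θ ≤ Real.pi →
      (r * Complex.exp (θ * Complex.I)).arg = θ := fun r θ hr h1 h2 => by
    rw [Complex.exp_mul_I]
    exact Complex.arg_mul_cos_add_sin_mul_I hr ⟨h1, h2⟩
  have hper : ∀ θ : ℝ, Complex.exp (θ * Complex.I) =
      Complex.exp ((θ - 2 * Real.pi : ℝ) * Complex.I) := fun θ => by
    rw [Complex.ofReal_sub, sub_mul]
    push_cast
    rw [Complex.exp_sub, Complex.exp_two_pi_mul_I, div_one]
  have h1 := Complex.neg_pi_lt_arg y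
  have h2 := Complex.arg_le_pi y
  constructor
  · rintro ⟨r, θ, hr, hθ1, hθ2, rfl⟩
    have hr0 : 0 < r := hr.lt_of_ne' fun h => hy (by simp [h])
    by_cases hθ : θ ≤ Real.pi
    · have hj0 : (0 : ℝ) ≤ j := by positivity
      rw [harg r θ hr0 (by nlinarith) hθ]
      interval_cases j <;> norm_num [angles] at hθ1 hθ2 ⊢
      · constructor <;> linarith
      · constructor <;> linarith
      · left; linarith
      · linarith
    · have hj3 : (j : ℝ) ≤ 3 := by exact_mod_cast Nat.le_of_lt_succ hj
      rw [hper, harg r _ hr0 (by linarith) (by nlinarith)]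
      interval_cases j <;> norm_num [angles] at hθ1 hθ2 ⊢
      · linarith
      · linarith
      · right; linarith
      · constructor <;> linarith
  · intro h
    have hy2 := Complex.norm_mul_exp_arg_mul_I y
    have hmain : ∀ θ : ℝ, θ = y.arg ∨ θ - 2 * Real.pi = y.arg →
        Real.pi / 4 * (2 * j - 1) ≤ θ → θ < Real.pi / 4 * (2 * j + 1) → y ∈ sector j := by
      intro θ hθ a b
      refine ⟨‖y‖, θ, norm_nonneg y, a, b, ?_⟩
      rcases hθ with hθ | hθ
      · rw [hθ, hy2]
      · rw [hper, hθ, hy2]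
    interval_cases j <;> norm_num [angles] at h hmain
    · exact hmain.1 (by linarith) (by linarith)
    · exact hmain.1 (by linarith) (by linarith)
    · rcases h with h | h
      · exact hmain.1 (by linarith) (by linarith)
      · exact hmain.2 (y.arg + 2 * Real.pi) (by ring) (by linarith) (by linarith)
    · exact hmain.2 (y.arg + 2 * Real.pi) (by ring) (by linarith) (by linarith)

lemma sector_ae_eq {j : ℕ} (hj : j < 4) :
    sector j =ᵐ[volume] Complex.arg ⁻¹' angles j := by
  have h0 : ∀ᵐ y : ℂ, y ≠ 0 := by
    rw [ae_iff]; simp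
  filter_upwards [h0] with y hy
  exact propext (mem_sector_iff hj hy)

lemma sum_regionOp (N : ℕ∞) : ∑ z, regionOp N z = ContinuousLinearMap.id ℂ (HB N) :=
  sum_heterodyne N (fun z => sector_ae_eq z.2)
    (fun z => Complex.measurable_arg (measurableSet_angles z)) fun y => existsUnique_angles y.arg

lemma Protocol.sum_heterodyne_module (P : Protocol) (N : ℕ∞) :
    ∑ z, heterodyne N (P.module z) = ContinuousLinearMap.id ℂ (HB N) := by
  let rad : ℕ → Set ℂ := fun k =>
    {y | P.δ * (k : ℕ) ≤ ‖y‖ ∧ (k < P.modules → ‖y‖ < P.δ * ((k : ℕ) + 1))}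
  have hrad : ∀ y, ∃ k ≤ P.modules, y ∈ rad k := by
    intro y
    -- The number of the ring is capped at Δ / δ, where the upper bound on the radius is void.
    refine ⟨min ⌊‖y‖ / P.δ⌋₊ P.modules, min_le_right _ _, ?_, fun hk => ?_⟩
    · have h1 : ((min ⌊‖y‖ / P.δ⌋₊ P.modules : ℕ) : ℝ) ≤ ‖y‖ / P.δ :=
        (Nat.cast_le.2 (min_le_left _ _)).trans
          (Nat.floor_le (div_nonneg (norm_nonneg y) P.δ_pos.le))
      rwa [le_div_iff₀' P.δ_pos] at h1
    · have hk' : min ⌊‖y‖ / P.δ⌋₊ P.modules = ⌊‖y‖ / P.δ⌋₊ := by omega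
      rw [hk']
      have h1 := Nat.lt_floor_add_one (‖y‖ / P.δ)
      rwa [div_lt_iff₀' P.δ_pos] at h1
  have hrad_le : ∀ y k k', k' ≤ P.modules → y ∈ rad k → y ∈ rad k' → k' ≤ k := by
    intro y k k' hk' h h'
    by_contra! hlt
    have h1 := h.2 (by omega)
    have h2 : ((k : ℝ) + 1) ≤ k' := by exact_mod_cast hlt
    have h3 := mul_le_mul_of_nonneg_left h2 P.δ_pos.le
    linarith [h'.1]
  refine sum_heterodyne N (S' := fun z : Fin P.m =>
    Complex.arg ⁻¹' angles ((z : ℕ) % 4) ∩ rad ((z : ℕ) / 4)) (fun z => ?_) (fun z => ?_)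
    fun y => ?_
  · exact (sector_ae_eq (Nat.mod_lt _ (by norm_num))).inter (ae_eq_refl _)
  · refine (Complex.measurable_arg (measurableSet_angles _)).inter ?_
    by_cases h : (z : ℕ) / 4 < P.modules
    · simp only [rad, h, true_implies]
      exact (measurableSet_le measurable_const measurable_norm).inter
        (measurableSet_lt measurable_norm measurable_const)
    · simp only [rad, h, false_implies, and_true]
      exact measurableSet_le measurable_const measurable_norm
  · obtain ⟨j, hj, hj'⟩ := existsUnique_angles y.arg
    obtain ⟨k, hk, hy⟩ := hrad y
    refine ⟨⟨j + 4 * k, by have := j.2; simp only [Protocol.m]; omega⟩, ?_, ?_⟩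
    · have h1 : ((j : ℕ) + 4 * k) % 4 = j := by omega
      have h2 : ((j : ℕ) + 4 * k) / 4 = k := by omega
      simp only [h1, h2]
      exact ⟨hj, hy⟩
    · rintro ⟨z, hz⟩ ⟨h1, h2⟩
      have h3 := hj' ⟨z % 4, Nat.mod_lt _ (by norm_num)⟩ h1
      have h4 : z % 4 = j := by rw [← h3]
      have hz' : z / 4 ≤ P.modules := by simp only [Protocol.m] at hz; omega
      have h5 := le_antisymm (hrad_le y _ _ hz' hy h2) (hrad_le y _ _ hk h2 hy)
      simp only [Fin.mk.injEq]
      omega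

end Heterodyne

/-! ### Effects of a round, the key map, and marginals of the channel output. -/

section Channel

variable {ι κ K J X Y Z : Type}
variable {H : Type} [NormedAddCommGroup H] [InnerProductSpace ℂ H] [CompleteSpace H]

/-! ### Effects on `AB` -/

lemma inner_opSqrt_opSqrt {T : H →L[ℂ] H} (hT : 0 ≤ T) (x y : H) :
    inner ℂ (opSqrt T x) (opSqrt T y) = inner ℂ x (T y) :=
  inner_sqrt_sqrt hT x y

lemma opTensor_apply {N : ℕ∞} (a : Matrix (Fin 4) (Fin 4) ℂ) (R : HB N →L[ℂ] HB N) (ψ : HAB N)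
    (x : Fin 4) : opTensor a R ψ x = ∑ y, a x y • R (ψ y) := by
  rw [← bra_apply, opTensor, sum_apply, map_sum, Finset.sum_eq_single x]
  · rw [sum_apply, map_sum]
    refine Finset.sum_congr rfl fun y _ => ?_
    rw [smul_apply, map_smul]
    simp
  · intro x' _ hx
    rw [sum_apply, map_sum]
    refine Finset.sum_eq_zero fun y _ => ?_
    rw [smul_apply, map_smul]
    simp [ket_apply_ne hx.symm]
  · simp

lemma opTensor_one_apply {N : ℕ∞} (R : HB N →L[ℂ] HB N) (ψ : HAB N) (x : Fin 4) :
    opTensor 1 R ψ x = R (ψ x) := by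
  simp [opTensor_apply, Matrix.one_apply, ite_smul]

lemma opTensor_one_id (N : ℕ∞) :
    opTensor 1 (ContinuousLinearMap.id ℂ (HB N)) = ContinuousLinearMap.id ℂ (HAB N) := by
  ext1 ψ
  exact tens_ext fun x => by rw [opTensor_one_apply]; rfl

lemma sum_opTensor_left {N : ℕ∞} [Fintype ι] (a : ι → Matrix (Fin 4) (Fin 4) ℂ)
    (R : HB N →L[ℂ] HB N) : ∑ i, opTensor (a i) R = opTensor (∑ i, a i) R := by
  ext1 ψ
  refine tens_ext fun x => ?_
  rw [sum_apply, ← bra_apply, map_sum, opTensor_apply]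
  simp only [bra_apply, opTensor_apply, Matrix.sum_apply, Finset.sum_smul]
  exact Finset.sum_comm

lemma sum_opTensor_right {N : ℕ∞} [Fintype ι] (a : Matrix (Fin 4) (Fin 4) ℂ)
    (R : ι → (HB N →L[ℂ] HB N)) : ∑ i, opTensor a (R i) = opTensor a (∑ i, R i) := by
  ext1 ψ
  refine tens_ext fun x => ?_
  rw [sum_apply, ← bra_apply, map_sum, opTensor_apply]
  simp only [bra_apply, opTensor_apply, sum_apply, Finset.smul_sum]
  exact Finset.sum_comm

lemma sum_single_eq_one : ∑ x : Fin 4, Matrix.single x x (1 : ℂ) = 1 := by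
  ext i j
  rw [Matrix.sum_apply]
  simp only [Matrix.single_apply, Matrix.one_apply]
  by_cases h : i = j
  · subst h; simp
  · rw [if_neg h]
    refine Finset.sum_eq_zero fun x _ => if_neg ?_
    rintro ⟨rfl, h'⟩
    exact h h'

lemma inner_tens_fintype [Fintype J] (ψ φ : Tens J H) :
    inner ℂ ψ φ = ∑ j, inner ℂ (ψ j) (φ j) := by
  have h : HasSum (fun j => inner ℂ (ψ j) (φ j)) (inner ℂ ψ φ) := lp.hasSum_inner ψ φ
  exact h.unique (hasSum_fintype _)

/-- The quadratic form is a sum of squares, namely of the norms of the components of (b ⊗ √R) ψ. -/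
lemma opTensor_conjTranspose_mul_self_nonneg {N : ℕ∞} (b : Matrix (Fin 4) (Fin 4) ℂ)
    {R : HB N →L[ℂ] HB N} (hR : 0 ≤ R) : 0 ≤ opTensor (b.conjTranspose * b) R := by
  have h : ∀ ψ, inner ℂ ψ (opTensor (b.conjTranspose * b) R ψ) =
      ((∑ k, ‖∑ y, b k y • opSqrt R (ψ y)‖ ^ 2 : ℝ) : ℂ) := by
    intro ψ
    push_cast
    have e : ∀ k, ((‖∑ y, b k y • opSqrt R (ψ y)‖ : ℂ)) ^ 2 =
        ∑ x, ∑ y, conj (b k x) * b k y * inner ℂ (ψ x) (R (ψ y)) := by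
      intro k
      have h1 := inner_self_ofReal (∑ y, b k y • opSqrt R (ψ y))
      push_cast at h1
      rw [← h1, sum_inner]
      refine Finset.sum_congr rfl fun x _ => ?_
      rw [inner_sum]
      refine Finset.sum_congr rfl fun y _ => ?_
      rw [inner_smul_left, inner_smul_right, inner_opSqrt_opSqrt hR, mul_assoc]
    simp only [e]
    rw [inner_tens_fintype, Finset.sum_comm]
    refine Finset.sum_congr rfl fun x _ => ?_
    rw [opTensor_apply, inner_sum, Finset.sum_comm]
    refine Finset.sum_congr rfl fun y _ => ?_
    rw [inner_smul_right, Matrix.mul_apply, Finset.sum_mul]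
    rfl
  rw [ContinuousLinearMap.nonneg_iff_isPositive, ContinuousLinearMap.isPositive_iff_complex]
  intro ψ
  rw [← inner_conj_symm, h, Complex.conj_ofReal]
  refine ⟨by rw [RCLike.re_to_complex, Complex.ofReal_re], ?_⟩
  rw [RCLike.re_to_complex, Complex.ofReal_re]
  positivity

open scoped ComplexOrder MatrixOrder in
lemma exists_eq_conjTranspose_mul_self {a : Matrix (Fin 4) (Fin 4) ℂ} (ha : a.PosSemidef) :
    ∃ b : Matrix (Fin 4) (Fin 4) ℂ, a = b.conjTranspose * b := by
  refine ⟨CFC.sqrt a, ?_⟩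
  have h : (CFC.sqrt a).conjTranspose = CFC.sqrt a :=
    (Matrix.nonneg_iff_posSemidef.1 (CFC.sqrt_nonneg a)).isHermitian
  rw [h, CFC.sqrt_mul_sqrt_self a ha.nonneg]

open scoped ComplexOrder in
lemma opTensor_nonneg {N : ℕ∞} {a : Matrix (Fin 4) (Fin 4) ℂ} (ha : a.PosSemidef)
    {R : HB N →L[ℂ] HB N} (hR : 0 ≤ R) : 0 ≤ opTensor a R := by
  obtain ⟨b, rfl⟩ := exists_eq_conjTranspose_mul_self ha
  exact opTensor_conjTranspose_mul_self_nonneg b hR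

open scoped ComplexOrder in
lemma posSemidef_single (x : Fin 4) : (Matrix.single x x (1 : ℂ)).PosSemidef := by
  have e : Matrix.single x x (1 : ℂ) = (Matrix.single x x 1).conjTranspose * Matrix.single x x 1 := by
    simp [Matrix.conjTranspose_single]
  rw [e]
  exact Matrix.posSemidef_conjTranspose_mul_self _

lemma Protocol.effect_nonneg (P : Protocol) (N : ℕ∞) (e : P.Event) : 0 ≤ P.effect N e := by
  rcases e with ⟨x, z⟩ | ⟨x, z⟩ | x'
  · exact opTensor_nonneg (posSemidef_single x) (heterodyne_nonneg N _)
  · exact opTensor_nonneg (posSemidef_single x) (heterodyne_nonneg N _)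
  · exact opTensor_nonneg (P.Γ_posSemidef x') id_nonneg

lemma sum_opTensor_single {N : ℕ∞} (R : HB N →L[ℂ] HB N) :
    ∑ x : Fin 4, opTensor (Matrix.single x x 1) R = opTensor 1 R := by
  rw [sum_opTensor_left, sum_single_eq_one]

/-! ### The key map -/

lemma adjoint_opTensor_sqrt {N : ℕ∞} {R : HB N →L[ℂ] HB N} (hR : 0 ≤ R) :
    ContinuousLinearMap.adjoint (opTensor 1 (opSqrt R)) ∘L opTensor 1 (opSqrt R) = opTensor 1 R := by
  ext1 ψ
  refine ext_inner_left ℂ fun φ => ?_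
  rw [ContinuousLinearMap.comp_apply, ContinuousLinearMap.adjoint_inner_right, inner_tens_fintype,
    inner_tens_fintype]
  simp only [opTensor_one_apply, inner_opSqrt_opSqrt hR]

lemma regionOp_nonneg (N : ℕ∞) (z : Fin 4) : 0 ≤ regionOp N z := heterodyne_nonneg N _

lemma krausG_apply {N : ℕ∞} (ψ : HAB N) (z : Fin 4) :
    krausG N ψ z = opTensor 1 (opSqrt (regionOp N z)) ψ := by
  rw [← bra_apply, krausG, sum_apply, map_sum, Finset.sum_eq_single z]
  · simp
  · intro z' _ hz
    simp [ket_apply_ne hz.symm]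
  · simp

/-- G is an isometry because the region operators sum to 1. -/
lemma adjoint_krausG_comp (N : ℕ∞) :
    ContinuousLinearMap.adjoint (krausG N) ∘L krausG N = ContinuousLinearMap.id ℂ (HAB N) := by
  rw [← opTensor_one_id, ← sum_regionOp, ← sum_opTensor_right]
  ext1 ψ
  refine ext_inner_left ℂ fun φ => ?_
  rw [ContinuousLinearMap.comp_apply, ContinuousLinearMap.adjoint_inner_right, inner_tens_fintype,
    sum_apply, inner_sum]
  refine Finset.sum_congr rfl fun z _ => ?_
  rw [krausG_apply, krausG_apply, ← ContinuousLinearMap.adjoint_inner_right,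
    ← ContinuousLinearMap.comp_apply, adjoint_opTensor_sqrt (regionOp_nonneg N z)]

lemma pinch_keyMap (N : ℕ∞) (ρ : HAB N →L[ℂ] HAB N) :
    pinch (keyMap N ρ) = blockDiag fun z => opTensor 1 (opSqrt (regionOp N z)) ∘L ρ ∘L
      ContinuousLinearMap.adjoint (opTensor 1 (opSqrt (regionOp N z))) := by
  have h1 : ∀ z, bra z ∘L krausG N = opTensor 1 (opSqrt (regionOp N z)) := fun z => by
    ext1 ψ
    exact krausG_apply ψ z
  rw [pinch, blockDiag]
  refine Finset.sum_congr rfl fun z _ => ?_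
  rw [← h1 z, ContinuousLinearMap.adjoint_comp, adjoint_bra]
  rfl

/-! ### Classical registers -/

lemma trace_id : trace (ContinuousLinearMap.id ℂ ℂ) = 1 := by
  let b : HilbertBasis Unit ℂ ℂ := (OrthonormalBasis.singleton Unit ℂ).toHilbertBasis
  rw [trace_eq_posTrace id_nonneg, posTrace_eq id_nonneg b]
  simp [b]

lemma trace_smul (c : ℂ) (T : H →L[ℂ] H) : trace (c • T) = c * trace T := by
  simp only [trace, smul_apply, inner_smul_right]
  exact tsum_mul_left

-- The map o from events to register values need not be injective: the block at x collects all
-- events whose output is sent to x.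
open Classical in
lemma marginal_sum_ket_bra [Fintype K] [Fintype X] [Fintype ι] (f : K → X) (o : ι → K) (c : ι → ℂ)
    (B : ι → (H →L[ℂ] H)) :
    marginal f (∑ e, c e • (ket (o e) ∘L B e ∘L bra (o e))) =
      blockDiag fun x => ∑ e, if f (o e) = x then c e • B e else 0 := by
  have h : ∀ k, bra k ∘L (∑ e, c e • (ket (o e) ∘L B e ∘L bra (o e))) ∘L ket k =
      ∑ e, if o e = k then c e • B e else 0 := by
    intro k
    ext1 v
    rw [ContinuousLinearMap.comp_apply, ContinuousLinearMap.comp_apply, sum_apply, sum_apply,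
      map_sum]
    refine Finset.sum_congr rfl fun e _ => ?_
    rw [smul_apply, map_smul]
    simp only [ContinuousLinearMap.comp_apply, bra_apply, ket_apply]
    by_cases h : o e = k
    · simp [h]
    · simp [h]
  ext1 ψ
  refine tens_ext fun x => ?_
  rw [blockDiag_apply, ← bra_apply, marginal, sum_apply, map_sum, sum_apply]
  simp only [h]
  simp only [ContinuousLinearMap.comp_apply, bra_apply, sum_apply, ket_apply]
  have e1 : ∀ k, (if x = f k then ∑ e, (if o e = k then c e • B e else 0) (ψ (f k)) else 0) =
      ∑ e, if o e = k then (if f (o e) = x then c e • B e else 0) (ψ x) else 0 := by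
    intro k
    by_cases hx : x = f k
    · subst hx
      rw [if_pos rfl]
      refine Finset.sum_congr rfl fun e _ => ?_
      by_cases hk : o e = k
      · simp [hk]
      · simp [hk]
    · rw [if_neg hx]
      refine (Finset.sum_eq_zero fun e _ => ?_).symm
      by_cases hk : o e = k
      · subst hk; simp [Ne.symm hx]
      · simp [hk]
  simp only [e1]
  rw [Finset.sum_comm]
  exact Finset.sum_congr rfl fun e _ => by simp

lemma diagEntry_blockDiag [Fintype K] (B : K → (H →L[ℂ] H)) (k : K) :
    diagEntry k (blockDiag B) = trace (B k) := by
  rw [diagEntry]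
  congr 1
  ext1 v
  simp [blockDiag_apply]

namespace Protocol

variable (P : Protocol)

/-- The event with the test outcome `c`. -/
def testEvent : P.CTest → P.Event
  | .inl xz => .inr (.inl xz)
  | .inr x' => .inr (.inr x')

/-- A key round gives C = (⊥, ⊥, ⊥), which is no test value, and in the other rounds C determines
the event. So each test probability involves exactly one effect. -/
lemma output_eq_iff (e : P.Event) (c : P.CTest) :
    (P.output e).2.2 = c.toCReg ↔ e = P.testEvent c := by
  rcases e with ⟨x, z⟩ | ⟨x, z⟩ | x' <;> rcases c with ⟨y, w⟩ | y' <;>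
    simp [output, CTest.toCReg, testEvent, xTilde, zTilde, xPrime]

lemma diagEntry_channelRef (N : ℕ∞) (w : Fin 3 → ℝ) (ψ : Tens J (HAB N)) (c : P.CTest) :
    diagEntry c.toCReg (marginal (fun k => k.2.2) (P.channelRef N w (rankOne ℂ ψ ψ))) =
      (w (P.side (P.testEvent c)) : ℂ) *
        trace (P.effect N (P.testEvent c) ∘L redState ψ) := by
  classical
  rw [channelRef, marginal_sum_ket_bra (fun k : P.Reg => k.2.2) P.output, diagEntry_blockDiag]
  simp only [output_eq_iff, Finset.sum_ite_eq', Finset.mem_univ, if_true]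
  rw [trace_smul, ← trace_refOp ψ (P.effect_nonneg N _)]
  rfl

lemma diagEntry_channel (N : ℕ∞) (w : Fin 3 → ℝ) (ρ : HAB N →L[ℂ] HAB N) (c : P.CTest) :
    diagEntry c.toCReg (marginal (fun k => k.2.2) (P.channel N w ρ)) =
      (w (P.side (P.testEvent c)) : ℂ) * trace (P.effect N (P.testEvent c) ∘L ρ) := by
  classical
  have h : P.channel N w ρ = ∑ e : P.Event, ((w (P.side e) : ℂ) * trace (P.effect N e ∘L ρ)) •
      (ket (P.output e) ∘L ContinuousLinearMap.id ℂ ℂ ∘L bra (P.output e)) := rfl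
  rw [h, marginal_sum_ket_bra (fun k : P.Reg => k.2.2) P.output, diagEntry_blockDiag]
  simp only [output_eq_iff, Finset.sum_ite_eq', Finset.mem_univ, if_true]
  rw [trace_smul, trace_id, mul_one]

/-- By `trace_refOp` the two families of statistics agree, and the trace of the reduced state is
‖ψ‖². -/
lemma mem_pureStates_iff (N : ℕ∞) (p : P.CTest → ℝ) (ψ : Tens J (HAB N)) :
    ψ ∈ P.pureStates N J p ↔ redState ψ ∈ P.states N p := by
  simp only [pureStates, states, Set.mem_ofPred_eq, diagEntry_channel, diagEntry_channelRef]
  refine and_congr_left fun _ => ?_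
  rw [IsDensity, posTrace_redState]
  constructor
  · intro h
    exact ⟨redState_nonneg ψ, by simp [h]⟩
  · rintro ⟨-, h⟩
    have h2 : ‖ψ‖ ^ 2 = 1 := by
      rw [ENNReal.ofReal_eq_one] at h; exact h
    nlinarith [norm_nonneg ψ]

end Protocol

end Channel

/-! ### The entropy of the key as a relative entropy, and purifications. -/

section KeyEntropy

variable {ι κ K J : Type}
variable {H : Type} [NormedAddCommGroup H] [InnerProductSpace ℂ H] [CompleteSpace H]

/-! ### The conditional entropy of the key -/

lemma posTrace_sum [Fintype K] {B : K → (H →L[ℂ] H)} (hB : ∀ k, 0 ≤ B k) :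
    posTrace (∑ k, B k) = ∑ k, posTrace (B k) := by
  simp only [posTrace, sum_apply, inner_sum, Complex.re_sum]
  rw [← Summable.tsum_finsetSum fun k _ => ENNReal.summable]
  refine tsum_congr fun i => ENNReal.ofReal_sum_of_nonneg fun k _ => ?_
  rw [re_inner_apply_self (hB k)]
  positivity

lemma IsEigenbasis.smul {T : H →L[ℂ] H} {b : HilbertBasis ι ℂ H} {μ : ι → ℝ}
    (h : IsEigenbasis T b μ) (c : ℝ) : IsEigenbasis ((c : ℂ) • T) b fun i => c * μ i := fun i => by
  rw [smul_apply, h i, smul_smul, Complex.ofReal_mul]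

lemma isEigenbasis_zero (b : HilbertBasis ι ℂ H) : IsEigenbasis (0 : H →L[ℂ] H) b fun _ => 0 :=
  fun i => by simp

lemma ofReal_smul_nonneg {c : ℝ} (hc : 0 ≤ c) {T : H →L[ℂ] H} (hT : 0 ≤ T) : 0 ≤ (c : ℂ) • T := by
  rw [ContinuousLinearMap.nonneg_iff_isPositive, ContinuousLinearMap.isPositive_iff_complex]
  intro a
  have h : inner ℂ a (((c : ℂ) • T) a) = ((c * ‖CFC.sqrt T a‖ ^ 2 : ℝ) : ℂ) := by
    rw [smul_apply, inner_smul_right, inner_apply_self hT, Complex.ofReal_mul]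
  rw [← inner_conj_symm, h, Complex.conj_ofReal]
  exact ⟨by rw [RCLike.re_to_complex, Complex.ofReal_re], by
    rw [RCLike.re_to_complex, Complex.ofReal_re]; positivity⟩

lemma logTerm_mul_norm_inner (b : HilbertBasis ι ℂ H) (μ : ι → ℝ) (p : ι × ι) :
    logTerm (μ p.1) (μ p.2) * ‖inner ℂ (b p.2) (b p.1)‖ ^ 2 = 0 := by
  by_cases h : p.2 = p.1
  · rw [h, logTerm_self, zero_mul]
  · rw [b.orthonormal.2 h]; simp

namespace Protocol

variable (P : Protocol)

/-- The unnormalised states of `Ê` conditioned on the values of the registers `Ẑ` and `S`. -/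
def keyBlock (N : ℕ∞) (ψ : Tens J (HAB N)) : Option (Fin 4) × Fin 3 → (Ell J →L[ℂ] Ell J)
  | (some z, 0) => (P.pkey : ℂ) • refOp ψ (opTensor 1 (regionOp N z))
  | (none, 1) => (P.pPE : ℂ) • refOp ψ (ContinuousLinearMap.id ℂ (HAB N))
  | (none, 2) => (P.ptom : ℂ) • refOp ψ (ContinuousLinearMap.id ℂ (HAB N))
  | _ => 0

lemma opTensor_one_regionOp_nonneg (N : ℕ∞) (z : Fin 4) : 0 ≤ opTensor 1 (regionOp N z) := by
  rw [← adjoint_opTensor_sqrt (regionOp_nonneg N z)]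
  exact adjoint_comp_self_nonneg _

lemma keyBlock_nonneg (N : ℕ∞) (ψ : Tens J (HAB N)) :
    ∀ k, 0 ≤ P.keyBlock N ψ k := by
  have h0 := fun z => ofReal_smul_nonneg P.pkey_nonneg
    (refOp_nonneg ψ (opTensor_one_regionOp_nonneg N z))
  have h1 := ofReal_smul_nonneg P.pPE_nonneg (refOp_nonneg ψ id_nonneg)
  have h2 := ofReal_smul_nonneg P.ptom_nonneg (refOp_nonneg ψ id_nonneg)
  rintro ⟨_ | z, s⟩ <;> fin_cases s
  exacts [le_rfl, h1, h2, h0 z, le_rfl, le_rfl]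

lemma sum_refOp_effect_key (N : ℕ∞) (ψ : Tens J (HAB N)) (z : Fin 4) :
    ∑ x : Fin 4, refOp ψ (opTensor (Matrix.single x x 1) (regionOp N z)) =
      refOp ψ (opTensor 1 (regionOp N z)) := by
  rw [← refOp_sum, sum_opTensor_single]

lemma sum_refOp_effect_PE (N : ℕ∞) (ψ : Tens J (HAB N)) :
    ∑ x : Fin 4, ∑ z, refOp ψ (opTensor (Matrix.single x x 1) (heterodyne N (P.module z))) =
      refOp ψ (ContinuousLinearMap.id ℂ (HAB N)) := by
  simp only [← refOp_sum, sum_opTensor_right, P.sum_heterodyne_module]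
  rw [sum_opTensor_single, opTensor_one_id]

lemma sum_refOp_effect_tom (N : ℕ∞) (ψ : Tens J (HAB N)) :
    ∑ x', refOp ψ (opTensor (P.Γ x') (ContinuousLinearMap.id ℂ (HB N))) =
      refOp ψ (ContinuousLinearMap.id ℂ (HAB N)) := by
  rw [← refOp_sum, sum_opTensor_left, P.Γ_sum, opTensor_one_id]

/-- Outcomes not recorded in Ẑ and S are summed out: Alice's in key rounds, and all of them in test
rounds, where completeness of the measurements leaves the identity. -/
lemma marginal_channelRef (N : ℕ∞) (ψ : Tens J (HAB N)) :
    marginal (fun k : P.Reg => (k.1.2.2.1, k.2.1)) (P.channelRef N P.law (rankOne ℂ ψ ψ)) =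
      blockDiag (P.keyBlock N ψ) := by
  classical
  rw [channelRef, marginal_sum_ket_bra (fun k : P.Reg => (k.1.2.2.1, k.2.1)) P.output]
  congr 1
  ext1 k
  have hr : ∀ e, traceLeft (ampl J (P.effect N e) ∘L rankOne ℂ ψ ψ) = refOp ψ (P.effect N e) :=
    fun e => rfl
  simp only [hr]
  simp only [Fintype.sum_sum_type, Fintype.sum_prod_type, output, zHat, side, effect, law]
  rcases k with ⟨_ | z, s⟩ <;> fin_cases s
  · simp [keyBlock]
  · simp [keyBlock, -Complex.coe_smul]
    simp only [← Finset.smul_sum, sum_refOp_effect_PE]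
  · simp [keyBlock, -Complex.coe_smul]
    simp only [← Finset.smul_sum, sum_refOp_effect_tom]
  · simp [keyBlock, -Complex.coe_smul]
    simp only [← Finset.smul_sum, sum_refOp_effect_key]
  · simp [keyBlock]
  · simp [keyBlock]

/-- The type of the round does not influence Ê. Therefore one eigenbasis of the reduced state of Ê
serves for all values of S. -/
lemma sum_keyBlock (N : ℕ∞) (ψ : Tens J (HAB N)) (s : Fin 3) :
    ∑ z, P.keyBlock N ψ (z, s) = (P.law s : ℂ) • refOp ψ (ContinuousLinearMap.id ℂ (HAB N)) := by
  have h : ∑ z, refOp ψ (opTensor 1 (regionOp N z)) =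
      refOp ψ (ContinuousLinearMap.id ℂ (HAB N)) := by
    rw [← refOp_sum, sum_opTensor_right, sum_regionOp, opTensor_one_id]
  rw [Fintype.sum_option]
  fin_cases s
  · simp [keyBlock, law, -Complex.coe_smul]
    rw [← Finset.smul_sum, h]
  · simp [keyBlock, law]
  · simp [keyBlock, law]

lemma sum_posTrace_keyBlock (N : ℕ∞) {ψ : Tens J (HAB N)} (hψ : ‖ψ‖ = 1) :
    ∑ k, posTrace (P.keyBlock N ψ k) = 1 := by
  rw [← posTrace_sum (P.keyBlock_nonneg N ψ), Fintype.sum_prod_type_right]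
  simp only [sum_keyBlock]
  rw [← Finset.sum_smul, ← Complex.ofReal_sum, Fin.sum_univ_three]
  have h : P.law 0 + P.law 1 + P.law 2 = 1 := P.sum_eq_one
  rw [h, Complex.ofReal_one, one_smul, posTrace_refOp_id, hψ]
  simp

lemma keyEntropy_eq (N : ℕ∞) {ψ : Tens J (HAB N)} (hψ : ‖ψ‖ = 1) :
    P.keyEntropy N ψ =
      (P.pkey : EReal) * relEntropy (keyMap N (redState ψ)) (pinch (keyMap N (redState ψ))) := by
  obtain ⟨ι, f, l, hf⟩ := exists_isEigenbasis (refOp_nonneg ψ (id_nonneg (H := HAB N)))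
    (posTrace_refOp_ne_top ψ id_nonneg)
  set A : Fin 4 → (HAB N →L[ℂ] HAB N) := fun z => opTensor 1 (opSqrt (regionOp N z)) with hA
  have hAA : ∀ z, ContinuousLinearMap.adjoint (A z) ∘L A z = opTensor 1 (regionOp N z) :=
    fun z => adjoint_opTensor_sqrt (regionOp_nonneg N z)
  have hv := fun z => exists_isEigenbasis (refOp_nonneg ψ (adjoint_comp_self_nonneg (A z)))
    (posTrace_refOp_ne_top ψ (adjoint_comp_self_nonneg (A z)))
  choose κ v s hv using hv
  obtain ⟨hsum, hrel⟩ := relEntropy_conj_blockDiag hψ (krausG_apply (N := N))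
    (adjoint_krausG_comp N) hf hv
  set t : Fin 4 → ℝ := fun z => ∑' p : κ z × ι,
    logTerm (s z p.1) (l p.2) * ‖inner ℂ (f p.2) (v z p.1)‖ ^ 2 with ht
  have hrel' : relEntropy (keyMap N (redState ψ)) (pinch (keyMap N (redState ψ))) =
      ((-∑ z, t z : ℝ) : EReal) := by
    rw [pinch_keyMap]; exact hrel
  have hkey : ∀ z, HasSum (fun p : κ z × ι => logTerm (P.pkey * s z p.1) (P.pkey * l p.2) *
      ‖inner ℂ (f p.2) (v z p.1)‖ ^ 2) (P.pkey * t z) := by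
    intro z
    refine ((hsum z).hasSum.mul_left P.pkey).congr_fun fun p => ?_
    -- The excluded case of `logTerm_smul` has overlap zero.
    by_cases h : l p.2 = 0 ∧ s z p.1 ≠ 0
    · rw [inner_eq_zero_of_eigenvalue_eq_zero hf (hv z) h.1 h.2]; simp
    · rw [logTerm_smul P.pkey_nonneg fun h0 => by_contra fun h1 => h ⟨h0, h1⟩, mul_assoc]
  -- Only key blocks contribute. A test block coincides with the marginal for its value of S, so its
  -- relative entropy vanishes; the other blocks are zero.
  let τ : Option (Fin 4) × Fin 3 → ℝ := fun k => match k with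
    | (some z, 0) => P.pkey * t z
    | _ => 0
  have hzero : ∀ ν : ι → ℝ, HasSum (fun p : ι × ι => logTerm 0 (ν p.2) *
      ‖inner ℂ (f p.2) (f p.1)‖ ^ 2) 0 := fun ν => by
    simp
  have hself : ∀ c : ℝ, HasSum (fun p : ι × ι => logTerm (c * l p.1) (c * l p.2) *
      ‖inner ℂ (f p.2) (f p.1)‖ ^ 2) 0 := fun c =>
    hasSum_zero.congr_fun fun p => logTerm_mul_norm_inner f (fun i => c * l i) p
  have hτ : ∑ k, τ k = P.pkey * ∑ z, t z := by
    simp [τ, Fintype.sum_prod_type, Fin.sum_univ_three, Finset.mul_sum]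
  rw [keyEntropy, marginal_channelRef, condEntropy_blockDiag (τ := τ) (f := f)
    (ν := fun y i => P.law y * l i) (P.keyBlock_nonneg N ψ)
    (P.sum_posTrace_keyBlock N hψ) (fun y => by rw [sum_keyBlock]; exact hf.smul _), hτ, hrel',
    ← EReal.coe_mul, mul_neg]
  rintro ⟨_ | z, y⟩ <;> fin_cases y
  · exact ⟨ι, f, fun _ => 0, isEigenbasis_zero f, hzero fun i => P.law 0 * l i⟩
  · exact ⟨ι, f, _, hf.smul P.pPE, hself P.pPE⟩
  · exact ⟨ι, f, _, hf.smul P.ptom, hself P.ptom⟩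
  · refine ⟨κ z, v z, _, IsEigenbasis.smul (T := refOp ψ (opTensor 1 (regionOp N z))) ?_ P.pkey,
      hkey z⟩
    rw [← hAA]; exact hv z
  · exact ⟨ι, f, fun _ => 0, isEigenbasis_zero f, hzero fun i => P.law 1 * l i⟩
  · exact ⟨ι, f, fun _ => 0, isEigenbasis_zero f, hzero fun i => P.law 2 * l i⟩

end Protocol

/-! ### Purification -/

/-- The vector ∑ i, √ρ (b i) ⊗ |e i⟩ is a purification of ρ; any basis b will do, by Parseval, and
its norm is finite since ρ has finite trace. -/
lemma exists_redState_eq {ρ : H →L[ℂ] H} (hρ : 0 ≤ ρ) (hfin : posTrace ρ ≠ ⊤)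
    (b : HilbertBasis ι ℂ H) {e : ι → J} (he : Function.Injective e) :
    ∃ ψ : Tens J H, redState ψ = ρ := by
  have hs : Summable fun i => ‖CFC.sqrt ρ (b i)‖ ^ 2 := by
    rw [posTrace_eq_norm hρ b] at hfin
    refine (ENNReal.summable_toReal hfin).congr fun i => ?_
    rw [ENNReal.toReal_ofReal (sq_nonneg _)]
  let u : J → H := Function.extend e (fun i => CFC.sqrt ρ (b i)) 0
  have hu : ∀ i, u (e i) = CFC.sqrt ρ (b i) := fun i => he.extend_apply _ _ i
  have hu0 : ∀ j, j ∉ Set.range e → u j = 0 := fun j hj => Function.extend_apply' _ _ _ hj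
  have hmem : Memℓp u 2 := by
    refine memℓp_gen ?_
    refine (he.summable_iff fun j hj => by rw [hu0 j hj]; simp).1 ?_
    simpa [Function.comp_def, hu] using hs
  refine ⟨⟨u, hmem⟩, ?_⟩
  ext1 y
  refine ext_inner_left ℂ fun x => ?_
  rw [inner_redState]
  have h1 : HasSum (fun j => inner ℂ (inner ℂ y (u j)) (inner ℂ x (u j)))
    (inner ℂ (coSteer ⟨u, hmem⟩ y) (coSteer ⟨u, hmem⟩ x)) := lp.hasSum_inner _ _
  rw [← he.hasSum_iff fun j hj => by rw [hu0 j hj]; simp] at h1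
  refine h1.unique ?_
  rw [← inner_sqrt_sqrt hρ]
  refine (b.hasSum_inner_mul_inner (CFC.sqrt ρ x) (CFC.sqrt ρ y)).congr_fun fun i => ?_
  have hsa : ∀ a c, inner ℂ (CFC.sqrt ρ a) c = inner ℂ a (CFC.sqrt ρ c) := fun a c => by
    rw [← ContinuousLinearMap.adjoint_inner_right, sqrt_selfAdjoint]
  simp only [Function.comp_apply, hu, RCLike.inner_apply, inner_conj_symm]
  rw [hsa x, hsa (b i) y |>.symm]

lemma exists_hilbertBasis_HAB (N : ℕ∞) {n : ℕ} (hn : 2 ≤ n) :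
    ∃ (ι : Type) (_ : HilbertBasis ι ℂ (HAB N)) (e : ι → Fin (n - 1) → Fin 4 × Fock N),
      Function.Injective e := by
  let b : HilbertBasis Unit ℂ ℂ := (OrthonormalBasis.singleton Unit ℂ).toHilbertBasis
  refine ⟨_, tensBasis fun _ : Fin 4 => tensBasis fun _ : Fock N => b,
    fun i _ => (i.1, i.2.1), ?_⟩
  rintro ⟨x, k, ⟨⟩⟩ ⟨x', k', ⟨⟩⟩ h
  -- A pair (x, k) is encoded as a constant tuple; since n ≥ 2 the tuple has an entry from which the
  -- pair is recovered.
  have h := congrFun h ⟨0, by omega⟩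
  simp only [Prod.mk.injEq] at h
  obtain ⟨rfl, rfl⟩ := h
  rfl

/-- The case c = 0 with s empty has to be excluded: then the left side is 0 · ∞ = 0, but the right
side is +∞. -/
lemma ereal_mul_iInf {S : Type} {s : Set S} {F : S → EReal} {c : ℝ} (hc : 0 ≤ c)
    (h : 0 < c ∨ s.Nonempty) : (c : EReal) * ⨅ x ∈ s, F x = ⨅ x ∈ s, (c : EReal) * F x := by
  rcases hc.eq_or_lt with rfl | hc
  · simp [biInf_const (h.resolve_left (lt_irrefl _))]
  have hc' : (0 : EReal) < c := by exact_mod_cast hc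
  refine le_antisymm (le_iInf₂ fun x hx => mul_le_mul_of_nonneg_left (iInf₂_le x hx) hc'.le) ?_
  rw [← EReal.div_le_iff_le_mul hc' (EReal.coe_ne_top c)]
  refine le_iInf₂ fun x hx => ?_
  rw [EReal.div_le_iff_le_mul hc' (EReal.coe_ne_top c)]
  exact iInf₂_le x hx

end KeyEntropy

end

end CVQKD

theorem lemma3 (N : ℕ∞) (P : CVQKD.Protocol) (n : ℕ) (hn : 2 ≤ n) (hkey : P.pkey < 1)
    (p : P.CTest → ℝ) (hp : p ∈ stdSimplex ℝ P.CTest)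
    (hpos : 0 < P.pkey ∨ (P.states N p).Nonempty) :
    P.crossover N n p =
      (P.pkey : EReal) * ⨅ ρ ∈ P.states N p,
        CVQKD.relEntropy (CVQKD.keyMap N ρ) (CVQKD.pinch (CVQKD.keyMap N ρ)) := by
  rw [CVQKD.ereal_mul_iInf P.pkey_nonneg hpos]
  refine le_antisymm (le_iInf₂ fun ρ hρ => sInf_le ?_) (le_sInf ?_)
  -- Upper bound: a compatible ρ is purified with Ê = Q_1 itself.
  · obtain ⟨ι, b, e, he⟩ := CVQKD.exists_hilbertBasis_HAB N hn
    have htr : CVQKD.posTrace ρ ≠ ⊤ := by rw [hρ.1.2]; exact ENNReal.one_ne_top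
    obtain ⟨ψ, rfl⟩ := CVQKD.exists_redState_eq hρ.1.1 htr b he
    have hψ := (P.mem_pureStates_iff N p ψ).2 hρ
    exact ⟨_, ⟨Equiv.refl _⟩, ψ, hψ, (P.keyEntropy_eq N hψ.1).symm⟩
  -- Lower bound: here the size of Ê plays no role, as the reduced state of ψ is compatible in any
  -- case.
  · rintro _ ⟨J, -, ψ, hψ, rfl⟩
    rw [P.keyEntropy_eq N hψ.1]
    exact iInf₂_le _ ((P.mem_pureStates_iff N p ψ).1 hψ)
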